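/- **Setting.** Fix $c\in\mathbb R$ and consider on $\mathbb R^2$, with coordinates $(u^1,u^2)=(u,v)$, the vector potential $$A^1=-\tfrac23\left(c+\tfrac34\right)u^3+uv,\qquad A^2=-\tfrac16(c+1)(2c+1)u^4+\tfrac12v^2,$$ and the structure constants $c^i_{jk}=\partial_j\partial_kA^i$. The principal hierarchy of $B_2$ consists of the flows $(p,l)$, $p\in\{1,2\}$, $l\ge 0$, given by $u^i_t=\partial_xX^i_{(p,l+1)}(u,v)$, where $X_{(p,0)}=\partial_p$, $\partial_jX^i_{(p,l+1)}=c^i_{jm}X^m_{(p,l)}$ and $X_{(p,l+1)}(0)=0$. For instance, flow $(1,0)$ is $$u_t=\partial_x\left[v-2\left(c+\tfrac34\right)u^2\right],\qquad v_t=\partial_x\left[-\tfrac43\left(c+\tfrac12\right)(c+1)u^3\right],$$ and flow $(2,1)$ is $u_t=\partial_x[uv+\frac13u^3]$, $v_t=\partial_x[\frac12v^2]$ if $c=-1$, and $u_t=\partial_x[uv-\frac13u^3]$, $v_t=\partial_x[\frac12v^2]$ if $c=-\frac12$. A *first order deformation* of a flow $u^i_t=\partial_xa^i(u,v)$ on an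 open set $U\subseteq\mathbb R^2$ is a system $u^i_t=\partial_x\left[a^i+\epsilon B^i_ju^j_x\right]$ with $B^i_j$ real analytic on $U$, considered modulo $\epsilon^2$. It is *integrable* on $U$ if for each symmetry (commuting flow) $u^i_\tau=W^i_ju^j_x$ of its dispersionless limit, with $W$ analytic on $U$, there are analytic coefficients such that the system $u^i_\tau=W^i_ju^j_x+\epsilon(\tilde B^i_ju^j_{xx}+\tilde C^i_{jk}u^j_xu^k_x)$ commutes with it modulo $\epsilon^2$. It is *Miura trivial* on an open set if some Miura transformation $w^i=F_0^i(u,v)+\epsilon N^i_j(u,v)u^j_x$ with analytic coefficients, where $F_0$ is a local diffeomorphism, transforms it modulo $\epsilon^2$ into a system $w^i_t=\tilde A^i_j(w)w^j_x$. **Theorem.** (a) Let $c\ne-1,-\frac12$. Let a first order deformation of the flow $(1,0)$ be integrable on an open set $U$. Then each point of $U$ has an open neighbourhood $V\subseteq U$ on which the deformation is Miura trivial. More precisely, there is an analytic map $M=(M^1,M^2)$ on $V$ such that $w^i=u^i+\epsilon\,\partial_xM^i(u,v)$ reduces the deformed flow, modulo $\epsilon^2$, to its dispersionless limit. The same transformation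 reduces to its dispersionless limit every system $u^i_\tau=W^i_ju^j_x+\epsilon(\tilde B^i_ju^j_{xx}+\tilde C^i_{jk}u^j_xu^k_x)$ with analytic coefficients on $V$ that commutes with the deformed flow modulo $\epsilon^2$. (b) Let $c=-1$ and $r=v+\frac12u^2$, or $c=-\frac12$ and $r=v-\frac12u^2$; this $r$ is a Riemann invariant. For a function $F$ of one variable let $D_F$ be the following deformation of the flow $(2,1)$: $$c=-1:\quad u_t=\partial_x\left[uv+\tfrac13u^3\right],\quad v_t=\partial_x\left[\tfrac12v^2+\epsilon F(r)\left(u^2u_x+u\,v_x\right)\right];$$ $$c=-\tfrac12:\quad u_t=\partial_x\left[uv-\tfrac13u^3+\epsilon F(r)\,u\,u_x\right],\quad v_t=\partial_x\left[\tfrac12v^2\right].$$ Let $U$ be an open subset of $\{u\neq0\}$ (where the two Riemann invariants are independent). Then the integrable first order deformations are parameterized, up to Miura transformations, by the one arbitrary function $F$ of $r$: 1. If a first order deformation of the flow $(2,1)$ is integrable on $U$, then each point of $U$ has an open neighbourhood $V\subseteq U$ on which, for some analytic $M$ on $V$ and some $F$ analytic on a neighbourhood of $r(V)$, the transformation $w^i=u^i+\epsilon\,\partial_xM^i(u,v)$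 takes it to $D_F$ modulo $\epsilon^2$. 2. For every $F$ analytic on a neighbourhood of $r(U)$, the deformation $D_F$ is integrable on $U$, and the extensions of all the symmetries can be chosen so that they also commute with each other modulo $\epsilon^2$. 3. Let $F,G$ be analytic on a neighbourhood of $r(U)$. If a Miura transformation $w^i=u^i+\epsilon N^i_j(u,v)u^j_x$ with $N$ analytic on $U$ takes $D_F$ to $D_G$ modulo $\epsilon^2$, then $F=G$ on $r(U)$. 4. For $F$ analytic on a neighbourhood of $r(U)$, $D_F$ is Miura trivial on $U$ if and only if $F=0$ on $r(U)$. In particular, $D_F$ is non-trivial for each $F$ that does not vanish identically on $r(U)$. -/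

import Mathlib

open Filter Topology Asymptotics
open scoped ContDiff

/-- Points of the target space of the two fields, in the flat coordinates `(u, v) = (z 0, z 1)`. -/
abbrev Pt : Type := Fin 2 → ℝ

/-- Matrix valued functions of the fields, `W z i j` being the entry in row `i` and column `j`. -/
abbrev MatField : Type := Pt → Fin 2 → Fin 2 → ℝ

/-- Coefficients `C z i j k` of quadratic expressions `∑ j k, C^i_{jk} u^j_x u^k_x`. -/
abbrev QuadField : Type := Pt → Fin 2 → Fin 2 → Fin 2 → ℝ

/-- The partial derivative with respect to the `j`-th field. -/
noncomputable def pd (j : Fin 2) (f : Pt → ℝ) (z : Pt) : ℝ :=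
  fderiv ℝ f z (Pi.single j 1)

/-- The Jacobian matrix `∂_j a^i`. -/
noncomputable def jac (a : Pt → Pt) : MatField :=
  fun z i j => pd j (fun w => a w i) z

/-! ### The `B₂` family of flat F-manifolds and its principal hierarchy -/

/-- The vector potential of the one-parameter `B₂` family. -/
noncomputable def vecPot (c : ℝ) : Pt → Pt := fun z =>
  ![-(2 / 3) * (c + 3 / 4) * z 0 ^ 3 + z 0 * z 1,
    -(1 / 6) * (c + 1) * (2 * c + 1) * z 0 ^ 4 + 1 / 2 * z 1 ^ 2]

/-- The structure constants `c^i_{jk} = ∂_j ∂_k A^i` of the product. -/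
noncomputable def structConst (c : ℝ) (i j k : Fin 2) (z : Pt) : ℝ :=
  pd j (pd k (fun w => vecPot c w i)) z

/-- `X k l` is the `l`-th vector field of the chain that starts at the flat vector field `∂_k`:
in flat coordinates `∂_j X_{(k,l+1)}^i = ∑ m, c^i_{jm} X_{(k,l)}^m`, the integration constants
being fixed by `X_{(k,l+1)}(0) = 0`.  The indices `k = 0, 1` stand for the fields `u, v`. The flow
`(k,l)` of the principal hierarchy is the system of conservation laws
`u_t = ∂_x (X_{(k,l+1)}(u))`. -/
structure IsPrincipalHierarchy (c : ℝ) (X : Fin 2 → ℕ → Pt → Pt) : Prop where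
  flat : ∀ k z, X k 0 z = Pi.single k 1
  differentiable : ∀ k l, Differentiable ℝ (X k l)
  recursion : ∀ k l z i j,
    pd j (fun w => X k (l + 1) w i) z = ∑ m, structConst c i j m z * X k l z m
  origin : ∀ k l, X k (l + 1) 0 = 0

theorem pd_eq {f : Pt → ℝ} {z : Pt} {a b : ℝ}
    (h : HasFDerivAt f (a • (ContinuousLinearMap.proj 0 : Pt →L[ℝ] ℝ)
      + b • (ContinuousLinearMap.proj 1 : Pt →L[ℝ] ℝ)) z) :
    pd 0 f z = a ∧ pd 1 f z = b := by
  simp [pd, h.fderiv]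

theorem hasFDerivAt_coord (i : Fin 2) (z : Pt) :
    HasFDerivAt (fun w : Pt => w i) (ContinuousLinearMap.proj i : Pt →L[ℝ] ℝ) z :=
  (ContinuousLinearMap.proj i : Pt →L[ℝ] ℝ).hasFDerivAt

/-- The structure constants: multiplication by `∂_u` has the matrix below, and `∂_v` is the unit. -/
theorem structConst_eq (c : ℝ) (z : Pt) :
    (∀ i k, structConst c i 0 k z =
      ![![-4 * (c + 3 / 4) * z 0, 1], ![-2 * (c + 1) * (2 * c + 1) * z 0 ^ 2, 0]] i k) ∧
    (∀ i k, structConst c i 1 k z = if i = k then 1 else 0) := by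
  have e0 : ∀ w : Pt, pd 0 (fun w => vecPot c w 0) w = -2 * (c + 3 / 4) * w 0 ^ 2 + w 1 ∧
      pd 1 (fun w => vecPot c w 0) w = w 0 := by
    intro w
    apply pd_eq
    have := (((hasFDerivAt_coord 0 w).pow 3).const_mul (-(2 / 3) * (c + 3 / 4))).add
      ((hasFDerivAt_coord 0 w).mul (hasFDerivAt_coord 1 w))
    refine (this.congr_fderiv ?_).congr_of_eventuallyEq ?_
    · ext v; simp; ring
    · exact .of_forall fun y => by simp [vecPot]
  have e1 : ∀ w : Pt, pd 0 (fun w => vecPot c w 1) w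
        = -(2 / 3) * (c + 1) * (2 * c + 1) * w 0 ^ 3 ∧
      pd 1 (fun w => vecPot c w 1) w = w 1 := by
    intro w
    apply pd_eq
    have := (((hasFDerivAt_coord 0 w).pow 4).const_mul (-(1 / 6) * (c + 1) * (2 * c + 1))).add
      (((hasFDerivAt_coord 1 w).pow 2).const_mul (1 / 2))
    refine (this.congr_fderiv ?_).congr_of_eventuallyEq ?_
    · ext v; simp; ring
    · exact .of_forall fun y => by simp [vecPot]
  have a00 := funext fun w => (e0 w).1
  have a01 := funext fun w => (e0 w).2
  have a10 := funext fun w => (e1 w).1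
  have a11 := funext fun w => (e1 w).2
  have f00 : pd 0 (fun w : Pt => -2 * (c + 3 / 4) * w 0 ^ 2 + w 1) z = -4 * (c + 3 / 4) * z 0 ∧
      pd 1 (fun w : Pt => -2 * (c + 3 / 4) * w 0 ^ 2 + w 1) z = 1 := by
    apply pd_eq
    have := (((hasFDerivAt_coord 0 z).pow 2).const_mul (-2 * (c + 3 / 4))).add
      (hasFDerivAt_coord 1 z)
    refine (this.congr_fderiv ?_)
    ext v; simp; ring
  have f10 : pd 0 (fun w : Pt => -(2 / 3) * (c + 1) * (2 * c + 1) * w 0 ^ 3) z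
        = -2 * (c + 1) * (2 * c + 1) * z 0 ^ 2 ∧
      pd 1 (fun w : Pt => -(2 / 3) * (c + 1) * (2 * c + 1) * w 0 ^ 3) z = 0 := by
    apply pd_eq
    have := (((hasFDerivAt_coord 0 z).pow 3).const_mul (-(2 / 3) * (c + 1) * (2 * c + 1)))
    refine (this.congr_fderiv ?_)
    ext v; simp; ring
  have g0 : pd 0 (fun w : Pt => w 0) z = 1 ∧ pd 1 (fun w : Pt => w 0) z = 0 := by
    apply pd_eq
    refine (hasFDerivAt_coord 0 z).congr_fderiv ?_
    ext v; simp
  have g1 : pd 0 (fun w : Pt => w 1) z = 0 ∧ pd 1 (fun w : Pt => w 1) z = 1 := by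
    apply pd_eq
    refine (hasFDerivAt_coord 1 z).congr_fderiv ?_
    ext v; simp
  constructor
  · intro i k
    fin_cases i <;> fin_cases k <;> simp only [structConst, Fin.zero_eta, Fin.mk_one, Fin.isValue,
      a00, a01, a10, a11, f00.1, f10.1, g0.1, g1.1] <;> simp
  · intro i k
    fin_cases i <;> fin_cases k <;> simp only [structConst, Fin.zero_eta, Fin.mk_one, Fin.isValue,
      a00, a01, a10, a11, f00.2, f10.2, g0.2, g1.2] <;> simp

/-- The restrictions to `v = 0` of the vector fields of a chain of the hierarchy. -/
noncomputable def chainY (c : ℝ) (k : Fin 2) : ℕ → ℝ → Pt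
  | 0 => fun _ => Pi.single k 1
  | l + 1 => fun t i => ∫ s in (0 : ℝ)..t, ∑ m, structConst c i 0 m ![s, 0] * chainY c k l s m

theorem chainY_cont (c : ℝ) (k : Fin 2) (l : ℕ) : ∀ i, Continuous fun t => chainY c k l t i := by
  induction l with
  | zero => intro i; exact continuous_const
  | succ l ih =>
    intro i
    have hc : Continuous fun s : ℝ => ∑ m, structConst c i 0 m ![s, 0] * chainY c k l s m := by
      refine continuous_finsetSum _ fun m _ => Continuous.mul ?_ (ih m)
      simp only [(structConst_eq c _).1]
      fin_cases i <;> fin_cases m <;> simp <;> fun_prop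
    exact intervalIntegral.continuous_primitive (fun a b => hc.intervalIntegrable a b) 0

theorem chainY_deriv (c : ℝ) (k : Fin 2) (l : ℕ) (i : Fin 2) (z : Pt) :
    HasDerivAt (fun t => chainY c k (l + 1) t i)
      (∑ m, structConst c i 0 m z * chainY c k l (z 0) m) (z 0) := by
  have hc : Continuous fun s : ℝ => ∑ m, structConst c i 0 m ![s, 0] * chainY c k l s m := by
    refine continuous_finsetSum _ fun m _ => Continuous.mul ?_ (chainY_cont c k l m)
    simp only [(structConst_eq c _).1]
    fin_cases i <;> fin_cases m <;> simp <;> fun_prop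
  have := intervalIntegral.integral_hasDerivAt_right (hc.intervalIntegrable 0 (z 0))
    (hc.stronglyMeasurableAtFilter _ _) hc.continuousAt
  refine this.congr_deriv ?_
  refine Finset.sum_congr rfl fun m _ => ?_
  simp only [(structConst_eq c _).1]
  simp

theorem chain_hasFDerivAt (c : ℝ) (k : Fin 2) (l : ℕ) (i : Fin 2) (z : Pt) :
    HasFDerivAt (fun w : Pt => ∑ q ∈ Finset.range (l + 2),
        w 1 ^ q / (q.factorial : ℝ) * chainY c k (l + 1 - q) (w 0) i)
      ((∑ m, structConst c i 0 m z * ∑ q ∈ Finset.range (l + 1),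
          z 1 ^ q / (q.factorial : ℝ) * chainY c k (l - q) (z 0) m)
          • (ContinuousLinearMap.proj 0 : Pt →L[ℝ] ℝ)
        + (∑ q ∈ Finset.range (l + 1),
          z 1 ^ q / (q.factorial : ℝ) * chainY c k (l - q) (z 0) i)
          • (ContinuousLinearMap.proj 1 : Pt →L[ℝ] ℝ)) z := by
  have hY : ∀ m, HasFDerivAt (fun w : Pt => chainY c k (m + 1) (w 0) i)
      ((∑ n, structConst c i 0 n z * chainY c k m (z 0) n)
        • (ContinuousLinearMap.proj 0 : Pt →L[ℝ] ℝ)) z := fun m =>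
    HasDerivAt.comp_hasFDerivAt (h₂ := fun t => chainY c k (m + 1) t i) z
      (chainY_deriv c k m i z) (hasFDerivAt_coord 0 z)
  have hp : ∀ q : ℕ, HasFDerivAt (fun w : Pt => w 1 ^ (q + 1) / ((q + 1).factorial : ℝ))
      ((z 1 ^ q / (q.factorial : ℝ)) • (ContinuousLinearMap.proj 1 : Pt →L[ℝ] ℝ)) z := by
    intro q
    have := ((hasFDerivAt_coord 1 z).pow (q + 1)).mul_const (((q + 1).factorial : ℝ)⁻¹)
    simp only [div_eq_mul_inv]
    refine this.congr_fderiv ?_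
    ext v
    have h1 : (q.factorial : ℝ) ≠ 0 := by positivity
    have h2 : ((q : ℝ) + 1) ≠ 0 := by positivity
    simp [Nat.factorial_succ]
    field_simp
  have hp0 : ∀ q : ℕ, ∃ L : Pt →L[ℝ] ℝ,
      HasFDerivAt (fun w : Pt => w 1 ^ q / (q.factorial : ℝ)) L z ∧
      L = (if q = 0 then 0 else z 1 ^ (q - 1) / ((q - 1).factorial : ℝ))
        • (ContinuousLinearMap.proj 1 : Pt →L[ℝ] ℝ) := by
    intro q
    cases q with
    | zero => exact ⟨0, by simpa using hasFDerivAt_const (1 : ℝ) z, by simp⟩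
    | succ q => exact ⟨_, hp q, by simp⟩
  have hY0 : ∀ m, HasFDerivAt (fun w : Pt => chainY c k m (w 0) i)
      ((if m = 0 then 0 else ∑ n, structConst c i 0 n z * chainY c k (m - 1) (z 0) n)
        • (ContinuousLinearMap.proj 0 : Pt →L[ℝ] ℝ)) z := by
    intro m
    cases m with
    | zero => simpa [chainY] using hasFDerivAt_const ((Pi.single k 1 : Pt) i) z
    | succ m => simpa using hY m
  have key := HasFDerivAt.fun_sum (u := Finset.range (l + 2)) (x := z)
    (A := fun q w => w 1 ^ q / (q.factorial : ℝ) * chainY c k (l + 1 - q) (w 0) i)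
    (fun q _ => by
      obtain ⟨L, hL, hL'⟩ := hp0 q
      rw [hL'] at hL
      exact hL.mul (hY0 (l + 1 - q)))
  refine key.congr_fderiv ?_
  ext v
  simp only [sum_apply, add_apply, smul_apply, ContinuousLinearMap.proj_apply, smul_eq_mul,
    Finset.sum_add_distrib]
  congr 1
  · rw [Finset.sum_range_succ]
    simp only [Fin.sum_univ_two, Finset.mul_sum, Finset.sum_mul, ← Finset.sum_add_distrib]
    simp only [Nat.sub_self, if_true, zero_mul, mul_zero, add_zero]
    refine Finset.sum_congr rfl fun q hq => ?_
    have hq' : q ≤ l := by simpa [Nat.lt_succ_iff] using hq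
    have h1 : l + 1 - q ≠ 0 := by omega
    have h2 : l + 1 - q - 1 = l - q := by omega
    rw [if_neg h1, h2]
    ring
  · rw [Finset.sum_range_succ', Finset.sum_mul]
    simp only [if_true, zero_mul, mul_zero, add_zero]
    refine Finset.sum_congr rfl fun q hq => ?_
    have h2 : l + 1 - (q + 1) = l - q := by omega
    simp [h2]
    ring

/-- The principal hierarchy exists, for every value of the parameter. -/
theorem exists_principalHierarchy (c : ℝ) :
    ∃ X : Fin 2 → ℕ → Pt → Pt, IsPrincipalHierarchy c X := by
  refine ⟨fun k l z i => ∑ q ∈ Finset.range (l + 1),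
    z 1 ^ q / (q.factorial : ℝ) * chainY c k (l - q) (z 0) i, ?_, ?_, ?_, ?_⟩
  · intro k z
    funext i
    simp [chainY]
  · intro k l
    rw [differentiable_pi]
    intro i z
    cases l with
    | zero => simp [chainY]
    | succ l => exact (chain_hasFDerivAt c k l i z).differentiableAt
  · intro k l z i j
    have h := pd_eq (chain_hasFDerivAt c k l i z)
    fin_cases j
    · exact h.1
    · refine h.2.trans ?_
      simp [(structConst_eq c z).2]
  · intro k l
    funext i
    refine Finset.sum_eq_zero fun q _ => ?_
    cases q with
    | zero => simp [chainY]
    | succ q => simp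

theorem eq_of_pd {f g : Pt → ℝ} (hf : Differentiable ℝ f) (hg : Differentiable ℝ g)
    (h : ∀ j z, pd j f z = pd j g z) (h0 : f 0 = g 0) : f = g := by
  refine funext fun z => ?_
  refine congrFun (eq_of_fderiv_eq hf hg ?_ 0 h0) z
  intro x
  ext v
  have hv : v = v 0 • Pi.single 0 1 + v 1 • Pi.single 1 1 := by
    funext i; fin_cases i <;> simp
  have h0 := h 0 x
  have h1 := h 1 x
  simp only [pd] at h0 h1
  rw [hv, map_add, map_add, map_smul, map_smul, map_smul, map_smul, h0, h1]

theorem eq_of_hasFDerivAt {f g a b : Pt → ℝ} (hf : Differentiable ℝ f)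
    (hg : ∀ z, HasFDerivAt g (a z • (ContinuousLinearMap.proj 0 : Pt →L[ℝ] ℝ)
      + b z • (ContinuousLinearMap.proj 1 : Pt →L[ℝ] ℝ)) z)
    (ha : ∀ z, pd 0 f z = a z) (hb : ∀ z, pd 1 f z = b z) (h0 : f 0 = g 0) : f = g := by
  refine eq_of_pd hf (fun z => (hg z).differentiableAt) (fun j z => ?_) h0
  fin_cases j
  · exact (ha z).trans (pd_eq (hg z)).1.symm
  · exact (hb z).trans (pd_eq (hg z)).2.symm

/-- The fluxes of the primary flow that starts at `∂_u`. -/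
theorem IsPrincipalHierarchy.flux_zero_one {c : ℝ} {X : Fin 2 → ℕ → Pt → Pt}
    (h : IsPrincipalHierarchy c X) (z : Pt) :
    X 0 1 z = ![z 1 - 2 * (c + 3 / 4) * z 0 ^ 2, -(4 / 3) * (c + 1 / 2) * (c + 1) * z 0 ^ 3] := by
  have hd := fun i => differentiable_pi.1 (h.differentiable 0 1) i
  have hr := fun z i j => h.recursion 0 0 z i j
  simp only [h.flat, Fin.sum_univ_two] at hr
  have h0 := h.origin 0 0
  funext i
  fin_cases i
  · refine congrFun (eq_of_hasFDerivAt (f := fun z => X 0 1 z 0)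
      (g := fun z => z 1 - 2 * (c + 3 / 4) * z 0 ^ 2)
      (a := fun z => -4 * (c + 3 / 4) * z 0) (b := fun _ => 1) (hd 0) (fun z => ?_)
      (fun z => ?_) (fun z => ?_) ?_) z
    · refine ((hasFDerivAt_coord 1 z).sub
        (((hasFDerivAt_coord 0 z).pow 2).const_mul (2 * (c + 3 / 4)))).congr_fderiv ?_
      ext v; simp; ring
    · rw [hr]; simp [(structConst_eq c z).1]
    · rw [hr]; simp [(structConst_eq c z).2]
    · simp [h0]
  · refine congrFun (eq_of_hasFDerivAt (f := fun z => X 0 1 z 1)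
      (g := fun z => -(4 / 3) * (c + 1 / 2) * (c + 1) * z 0 ^ 3)
      (a := fun z => -2 * (c + 1) * (2 * c + 1) * z 0 ^ 2) (b := fun _ => 0) (hd 1) (fun z => ?_)
      (fun z => ?_) (fun z => ?_) ?_) z
    · refine (((hasFDerivAt_coord 0 z).pow 3).const_mul
        (-(4 / 3) * (c + 1 / 2) * (c + 1))).congr_fderiv ?_
      ext v; simp; ring
    · rw [hr]; simp [(structConst_eq c z).1]
    · rw [hr]; simp [(structConst_eq c z).2]
    · simp [h0]

/-- The primary flow that starts at `∂_v` is translation in `x`. -/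
theorem IsPrincipalHierarchy.flux_one_one {c : ℝ} {X : Fin 2 → ℕ → Pt → Pt}
    (h : IsPrincipalHierarchy c X) (z : Pt) : X 1 1 z = z := by
  have hd := fun i => differentiable_pi.1 (h.differentiable 1 1) i
  have hr := fun z i j => h.recursion 1 0 z i j
  simp only [h.flat, Fin.sum_univ_two] at hr
  have h0 := h.origin 1 0
  funext i
  fin_cases i
  · refine congrFun (eq_of_hasFDerivAt (f := fun z => X 1 1 z 0) (g := fun z => z 0)
      (a := fun z => 1) (b := fun _ => 0) (hd 0) (fun z => ?_)
      (fun z => ?_) (fun z => ?_) ?_) z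
    · refine (hasFDerivAt_coord 0 z).congr_fderiv ?_
      ext v; simp
    · rw [hr]; simp [(structConst_eq c z).1]
    · rw [hr]; simp [(structConst_eq c z).2]
    · simp [h0]
  · refine congrFun (eq_of_hasFDerivAt (f := fun z => X 1 1 z 1) (g := fun z => z 1)
      (a := fun z => 0) (b := fun _ => 1) (hd 1) (fun z => ?_)
      (fun z => ?_) (fun z => ?_) ?_) z
    · refine (hasFDerivAt_coord 1 z).congr_fderiv ?_
      ext v; simp
    · rw [hr]; simp [(structConst_eq c z).1]
    · rw [hr]; simp [(structConst_eq c z).2]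
    · simp [h0]

/-- The fluxes of the first flow above the translation in `x`. -/
theorem IsPrincipalHierarchy.flux_one_two {c : ℝ} {X : Fin 2 → ℕ → Pt → Pt}
    (h : IsPrincipalHierarchy c X) (z : Pt) :
    X 1 2 z = ![-(4 / 3) * (c + 3 / 4) * z 0 ^ 3 + z 0 * z 1,
      -(c + 1 / 2) * (c + 1) * z 0 ^ 4 + z 1 ^ 2 / 2] := by
  have hd := fun i => differentiable_pi.1 (h.differentiable 1 2) i
  have hr := fun z i j => h.recursion 1 1 z i j
  simp only [h.flux_one_one, Fin.sum_univ_two] at hr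
  have h0 := h.origin 1 1
  funext i
  fin_cases i
  · refine congrFun (eq_of_hasFDerivAt (f := fun z => X 1 2 z 0)
      (g := fun z => -(4 / 3) * (c + 3 / 4) * z 0 ^ 3 + z 0 * z 1)
      (a := fun z => -4 * (c + 3 / 4) * z 0 ^ 2 + z 1) (b := fun z => z 0) (hd 0) (fun z => ?_)
      (fun z => ?_) (fun z => ?_) ?_) z
    · refine ((((hasFDerivAt_coord 0 z).pow 3).const_mul (-(4 / 3) * (c + 3 / 4))).add
        ((hasFDerivAt_coord 0 z).mul (hasFDerivAt_coord 1 z))).congr_fderiv ?_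
      ext v; simp; ring
    · rw [hr]; simp [(structConst_eq c z).1]; ring
    · rw [hr]; simp [(structConst_eq c z).2]
    · simp [h0]
  · refine congrFun (eq_of_hasFDerivAt (f := fun z => X 1 2 z 1)
      (g := fun z => -(c + 1 / 2) * (c + 1) * z 0 ^ 4 + z 1 ^ 2 * (1 / 2))
      (a := fun z => -2 * (c + 1) * (2 * c + 1) * z 0 ^ 3) (b := fun z => z 1) (hd 1)
      (fun z => ?_) (fun z => ?_) (fun z => ?_) ?_) z |>.trans ?_
    · refine ((((hasFDerivAt_coord 0 z).pow 4).const_mul (-(c + 1 / 2) * (c + 1))).add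
        (((hasFDerivAt_coord 1 z).pow 2).mul_const (1 / 2))).congr_fderiv ?_
      ext v; simp; ring
    · rw [hr]; simp [(structConst_eq c z).1]; ring
    · rw [hr]; simp [(structConst_eq c z).2]
    · simp [h0]
    · simp; ring

/-! ### Evolutionary systems, depending on the formal parameter `ε` -/

/-- The right-hand side `X_ε[u](x)` of a system `u_t = X_ε[u]` for a field `x ↦ u(x)`. -/
abbrev Evol : Type := ℝ → (ℝ → Pt) → ℝ → Pt

/-- The system of hydrodynamic type `u^i_t = W^i_j(u) u^j_x`. -/
noncomputable def hydro (W : MatField) : Evol := fun _ u x i =>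
  ∑ j, W (u x) i j * deriv u x j

/-- The general system up to first order in `ε`,
`u^i_t = W^i_j(u) u^j_x + ε (B^i_j(u) u^j_xx + C^i_{jk}(u) u^j_x u^k_x)`. -/
noncomputable def firstOrder (W B : MatField) (C : QuadField) : Evol := fun ε u x i =>
  ∑ j, W (u x) i j * deriv u x j
    + ε * (∑ j, B (u x) i j * deriv (deriv u) x j
      + ∑ j, ∑ k, C (u x) i j k * deriv u x j * deriv u x k)

/-- The first order deformation `u^i_t = ∂_x (a^i(u) + ε B^i_j(u) u^j_x)`, in the form of
conservation laws, of the system `u^i_t = ∂_x (a^i(u))`. -/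
noncomputable def consLaw (a : Pt → Pt) (B : MatField) : Evol := fun ε u x i =>
  deriv (fun y => a (u y) i + ε * ∑ j, B (u y) i j * deriv u y j) x

/-- The Lie bracket of two evolutionary vector fields. -/
noncomputable def evBracket (P Q : (ℝ → Pt) → ℝ → Pt) (u : ℝ → Pt) (x : ℝ) : Pt :=
  deriv (fun s : ℝ => P (u + s • Q u) x) 0 - deriv (fun s : ℝ => Q (u + s • P u) x) 0

/-- The flows of `X` and `Y` commute on `U` up to `O(ε²)`. Everything is local in `x`, so it is
enough to ask that the value of the field at the point under consideration lies in `U`. -/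
def CommuteUpToFirstOrder (U : Set Pt) (X Y : Evol) : Prop :=
  ∀ u : ℝ → Pt, ContDiff ℝ ∞ u → ∀ x : ℝ, u x ∈ U →
    (fun ε : ℝ => evBracket (X ε) (Y ε) u x) =O[𝓝 0] (fun ε : ℝ => ε ^ 2)

/-- `u_t = W(u) u_x` is a symmetry on `U` of the dispersionless limit `u_t = X₀[u]`. -/
def IsDispersionlessSymmetry (U : Set Pt) (X : Evol) (W : MatField) : Prop :=
  AnalyticOnNhd ℝ W U ∧
    ∀ u : ℝ → Pt, ContDiff ℝ ∞ u → ∀ x : ℝ, u x ∈ U → evBracket (X 0) (hydro W 0) u x = 0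

/-- Integrability on `U` up to first order in `ε`: every symmetry of the dispersionless limit
extends to a symmetry, up to `O(ε²)`, of the complete system. -/
def IsIntegrable (U : Set Pt) (X : Evol) : Prop :=
  ∀ W : MatField, IsDispersionlessSymmetry U X W →
    ∃ (B : MatField) (C : QuadField), AnalyticOnNhd ℝ B U ∧ AnalyticOnNhd ℝ C U ∧
      CommuteUpToFirstOrder U X (firstOrder W B C)

/-- All the symmetries of the dispersionless limit extend to symmetries of the complete system in
such a way that the extended symmetries also commute with each other, up to `O(ε²)`. -/
def HasCommutingExtensions (U : Set Pt) (X : Evol) : Prop :=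
  ∃ (B : MatField → MatField) (C : MatField → QuadField),
    (∀ W, IsDispersionlessSymmetry U X W →
      AnalyticOnNhd ℝ (B W) U ∧ AnalyticOnNhd ℝ (C W) U ∧
        CommuteUpToFirstOrder U X (firstOrder W (B W) (C W))) ∧
    ∀ W W', IsDispersionlessSymmetry U X W → IsDispersionlessSymmetry U X W' →
      CommuteUpToFirstOrder U (firstOrder W (B W) (C W)) (firstOrder W' (B W') (C W'))

/-! ### Miura transformations -/

/-- The Miura transformation `w^i = F^i(u) + ε N^i_j(u) u^j_x + O(ε²)`. -/
noncomputable def miura (F : Pt → Pt) (N : MatField) : Evol := fun ε u x i =>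
  F (u x) i + ε * ∑ j, N (u x) i j * deriv u x j

/-- The transformation `w = φ_ε[u]` takes the system `u_t = X_ε[u]`, for fields with values in
`V`, to the system `w_t = Y_ε[w]` up to `O(ε²)`: the derivative of `φ_ε` along `X_ε` is
`Y_ε ∘ φ_ε` up to `O(ε²)`. -/
def TransformsTo (V : Set Pt) (φ X Y : Evol) : Prop :=
  ∀ u : ℝ → Pt, ContDiff ℝ ∞ u → ∀ x : ℝ, u x ∈ V →
    (fun ε : ℝ => deriv (fun s : ℝ => φ ε (u + s • X ε u) x) 0 - Y ε (φ ε u) x)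
      =O[𝓝 0] (fun ε : ℝ => ε ^ 2)

/-- The system `u_t = X_ε[u]` is Miura trivial on `V` up to `O(ε²)`: some Miura transformation,
whose leading term is a local diffeomorphism, takes it to a system of hydrodynamic type. -/
def IsMiuraTrivial (V : Set Pt) (X : Evol) : Prop :=
  ∃ (F : Pt → Pt) (N A : MatField),
    AnalyticOnNhd ℝ F V ∧ (∀ z ∈ V, Function.Bijective (fderiv ℝ F z)) ∧
    AnalyticOnNhd ℝ N V ∧ AnalyticOnNhd ℝ A (F '' V) ∧
    TransformsTo V (miura F N) X (hydro A)

/-! ### The exceptional cases -/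

/-- The Riemann invariant `v + u²/2` of the case `c = -1`. -/
noncomputable def rPlus (z : Pt) : ℝ := z 0 ^ 2 / 2 + z 1

/-- The Riemann invariant `v - u²/2` of the case `c = -1/2`. -/
noncomputable def rMinus (z : Pt) : ℝ := -(z 0 ^ 2 / 2) + z 1

/-- For `c = -1`: the deformation with `ε`-term `(0, F(r) (u² u_x + u v_x))`. -/
noncomputable def normalFormPlus (F : ℝ → ℝ) : MatField := fun z =>
  ![![0, 0], ![F (rPlus z) * z 0 ^ 2, F (rPlus z) * z 0]]

/-- For `c = -1/2`: the deformation with `ε`-term `(F(r) u u_x, 0)`. -/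
noncomputable def normalFormMinus (F : ℝ → ℝ) : MatField := fun z =>
  ![![F (rMinus z) * z 0, 0], ![0, 0]]

/-- The integrable first order deformations of `u_t = ∂_x (a(u))` on the domain `u ≠ 0` are, up to
Miura transformations, parameterized by an arbitrary function `F` of the single variable `r`, the
deformation with parameter `F` being `u_t = ∂_x (a(u) + ε (nf F)(u) u_x)`. -/
def ParameterizedBy (a : Pt → Pt) (r : Pt → ℝ) (nf : (ℝ → ℝ) → MatField) : Prop :=
  -- every integrable deformation is locally equivalent to one of the family
  (∀ (U : Set Pt) (B : MatField), IsOpen U → (∀ z ∈ U, z 0 ≠ 0) → AnalyticOnNhd ℝ B U →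
    IsIntegrable U (consLaw a B) →
    ∀ p ∈ U, ∃ V : Set Pt, IsOpen V ∧ p ∈ V ∧ V ⊆ U ∧
      ∃ (F : ℝ → ℝ) (M : Pt → Pt), AnalyticOnNhd ℝ F (r '' V) ∧ AnalyticOnNhd ℝ M V ∧
        TransformsTo V (miura id (jac M)) (consLaw a B) (consLaw a (nf F))) ∧
  -- every function of one variable occurs
  (∀ (U : Set Pt) (F : ℝ → ℝ), IsOpen U → (∀ z ∈ U, z 0 ≠ 0) → AnalyticOnNhd ℝ F (r '' U) →
    IsIntegrable U (consLaw a (nf F)) ∧ HasCommutingExtensions U (consLaw a (nf F))) ∧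
  -- different functions give deformations that are not equivalent
  (∀ (U : Set Pt) (F G : ℝ → ℝ) (N : MatField), IsOpen U → (∀ z ∈ U, z 0 ≠ 0) →
    AnalyticOnNhd ℝ F (r '' U) → AnalyticOnNhd ℝ G (r '' U) → AnalyticOnNhd ℝ N U →
    TransformsTo U (miura id N) (consLaw a (nf F)) (consLaw a (nf G)) →
    ∀ z ∈ U, F (r z) = G (r z)) ∧
  -- only the function zero gives a trivial deformation
  (∀ (U : Set Pt) (F : ℝ → ℝ), IsOpen U → (∀ z ∈ U, z 0 ≠ 0) → AnalyticOnNhd ℝ F (r '' U) →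
    (IsMiuraTrivial U (consLaw a (nf F)) ↔ ∀ z ∈ U, F (r z) = 0))

/-! ### Calculus of differential polynomials along a curve -/

/-! Put k = -(2c+1), so that c = -1 and c = -1/2 become k = 1 and k = 0. The flow (1,0) has matrix A
= `mA k`, with eigenvalues ku, (k-1)u and eigenvectors e₁ = (1,(1-k)u), e₂ = (1,-ku); the flow (2,1)
has matrix T = `mT k` = v + uA.

Along a curve the bracket of two systems is a quadratic polynomial in ε, and the jets of curves are
arbitrary, so commutation modulo ε² is a finite list of identities between coefficients. At order
zero they say that W commutes with A and has closed rows (`CommuteZero.comm_and_curlFree`). At order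
one, write the quadratic part of a symmetry with coefficient B' as dB' + Q. The bracket is then the
x-derivative of a flux K u_xx + G(u_x,u_x), up to terms in Q (`order_one_eq`). The conditions give K
= 0, make A self-adjoint for the symmetric part of Q, and make that form vanish on both eigenvectors
when the flow is genuinely nonlinear. Hence extended symmetries are again conservation laws
(`remainder_zero_mA`, `remainder_zero_mT`) and the form G vanishes too.

For the pair A, T with corrections B, B' the condition K = 0 means B' - uB = γ + δA. Evaluating G on
eᵢ gives ℓᵢ(Beᵢ) eᵢ = μᵢ ∂A(eᵢ,eᵢ), with ℓᵢ a left eigenvector of A and μᵢ the eigenvalue of γ + δA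
on eᵢ. The vector ∂A(e₁,e₁) is parallel to e₁ only for k = 1, and ∂A(e₂,e₂) to e₂ only for k = 0;
otherwise the corresponding μᵢ is zero.

Generic case: μ₁ = μ₂ = 0, so B has no diagonal part in the eigenbasis, that is tr B = tr AB = 0.
The equation B = [A, jac M] is then a linear Cauchy problem in u for M, solved by majorised power
series (`exists_cauchy_solution`, `exists_potential`). The substitution w = u + ε ∂_x M changes a
correction by exactly such a commutator (`transformsTo_of_comm`), so it removes B. For any other
commuting system, B' - [W, jac M] solves the homogeneous conditions, whose only solution is zero
(`extension_eq_commMat`), so the same M works.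

Exceptional cases: one μᵢ survives, γ = 0, and the mixed part of G makes δ a function of r. The
traces of B' and AB' are determined by δ, and deformations with the same two traces are equivalent
by the same Cauchy problem; this gives the normal form. Conversely `extPlus` and `extMinus` extend
every symmetry explicitly, and these extensions commute with each other. Finally the trace of the
ε-coefficient is invariant under Miura transformations (`TransformsTo.trace_eq`); for the normal
forms it is F(r)u, which recovers F. -/

/-- The derivative `∂_k W^i_j` of a matrix field, with indices `i j k`. -/
noncomputable def dMat (W : MatField) : QuadField := fun z i j k => pd k (fun w => W w i j) z

/-- The derivative `∂_l C^i_{jk}` of a field of quadratic forms, with indices `i j k l`. -/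
noncomputable def dQuad (C : QuadField) : Pt → Fin 2 → Fin 2 → Fin 2 → Fin 2 → ℝ :=
  fun z i j k l => pd l (fun w => C w i j k) z

/-- The vector `W(u) q` along a curve. -/
noncomputable def mulV (W : MatField) (u q : ℝ → Pt) : ℝ → Pt := fun y i =>
  ∑ j, W (u y) i j * q y j

/-- The vector `C(u)(p, q)` along a curve. -/
noncomputable def quadV (C : QuadField) (u p q : ℝ → Pt) : ℝ → Pt := fun y i =>
  ∑ j, ∑ k, C (u y) i j k * p y j * q y k

/-- The vector `T(u)(p, q, r)` along a curve. -/
noncomputable def cubV (T : Pt → Fin 2 → Fin 2 → Fin 2 → Fin 2 → ℝ) (u p q r : ℝ → Pt) :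
    ℝ → Pt := fun y i =>
  ∑ j, ∑ k, ∑ l, T (u y) i j k l * p y j * q y k * r y l

theorem AnalyticAt.entry {W : MatField} {z : Pt} (h : AnalyticAt ℝ W z) (i j : Fin 2) :
    AnalyticAt ℝ (fun w => W w i j) z :=
  analyticAt_pi_iff.1 (analyticAt_pi_iff.1 h i) j

theorem AnalyticAt.entry₃ {C : QuadField} {z : Pt} (h : AnalyticAt ℝ C z) (i j k : Fin 2) :
    AnalyticAt ℝ (fun w => C w i j k) z :=
  analyticAt_pi_iff.1 (analyticAt_pi_iff.1 (analyticAt_pi_iff.1 h i) j) k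

theorem analyticAt_mat {W : MatField} {z : Pt} (h : ∀ i j, AnalyticAt ℝ (fun w => W w i j) z) :
    AnalyticAt ℝ W z :=
  analyticAt_pi_iff.2 fun i => analyticAt_pi_iff.2 (h i)

theorem analyticAt_quad {C : QuadField} {z : Pt}
    (h : ∀ i j k, AnalyticAt ℝ (fun w => C w i j k) z) : AnalyticAt ℝ C z :=
  analyticAt_pi_iff.2 fun i => analyticAt_pi_iff.2 fun j => analyticAt_pi_iff.2 (h i j)

theorem AnalyticAt.pd {f : Pt → ℝ} {z : Pt} (h : AnalyticAt ℝ f z) (k : Fin 2) :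
    AnalyticAt ℝ (pd k f) z :=
  ((ContinuousLinearMap.apply ℝ ℝ (Pi.single k 1 : Pt)).analyticAt _).comp h.fderiv

theorem AnalyticAt.dMat {W : MatField} {z : Pt} (h : AnalyticAt ℝ W z) :
    AnalyticAt ℝ (dMat W) z :=
  analyticAt_quad fun i j k => (h.entry i j).pd k

theorem fderiv_eq_sum_pd (f : Pt → ℝ) (z v : Pt) : fderiv ℝ f z v = ∑ k, pd k f z * v k := by
  have hv : v = v 0 • Pi.single 0 1 + v 1 • Pi.single 1 1 := by
    funext i; fin_cases i <;> simp
  conv_lhs => rw [hv]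
  simp only [map_add, map_smul, pd, Fin.sum_univ_two, smul_eq_mul]
  ring

theorem hasDerivAt_comp_pd {f : Pt → ℝ} {u : ℝ → Pt} {u' : Pt} {y : ℝ}
    (hf : AnalyticAt ℝ f (u y)) (hu : HasDerivAt u u' y) :
    HasDerivAt (fun t => f (u t)) (∑ k, pd k f (u y) * u' k) y := by
  rw [← fderiv_eq_sum_pd]
  exact hf.differentiableAt.hasFDerivAt.comp_hasDerivAt y hu

theorem pd_comm {f : Pt → ℝ} {z : Pt} (hf : AnalyticAt ℝ f z) (j k : Fin 2) :
    pd j (pd k f) z = pd k (pd j f) z := by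
  have h2 := ContDiffAt.isSymmSndFDerivAt_of_omega (hf.contDiffAt (n := ω))
  have hd : DifferentiableAt ℝ (fderiv ℝ f) z := hf.fderiv.differentiableAt
  have key : ∀ a b : Fin 2, pd a (pd b f) z
      = fderiv ℝ (fderiv ℝ f) z (Pi.single a 1) (Pi.single b 1) := by
    intro a b
    have : pd b f = fun w => fderiv ℝ f w (Pi.single b 1) := rfl
    rw [pd, this, fderiv_clm_apply hd (differentiableAt_const _)]
    simp
  rw [key, key, h2]

theorem pd_congr {f g : Pt → ℝ} {z : Pt} (h : f =ᶠ[𝓝 z] g) (k : Fin 2) : pd k f z = pd k g z := by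
  rw [pd, pd, h.fderiv_eq]

/-- Smoothness near a point. -/
abbrev SmoothAt (q : ℝ → Pt) (x : ℝ) : Prop := ContDiffAt ℝ ∞ q x

namespace SmoothAt
variable {q p r u : ℝ → Pt} {x : ℝ}

theorem hasDerivAt (h : SmoothAt q x) : HasDerivAt q (deriv q x) x :=
  (h.differentiableAt (by simp)).hasDerivAt

theorem coord (h : SmoothAt q x) (j : Fin 2) : HasDerivAt (fun y => q y j) (deriv q x j) x :=
  hasDerivAt_pi.1 h.hasDerivAt j

theorem derivAt (h : SmoothAt q x) : SmoothAt (deriv q) x := by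
  have h1 : ContDiffAt ℝ ∞ (fderiv ℝ q) x := h.fderiv_right (m := ∞) (by simp)
  have : deriv q = fun y => fderiv ℝ q y 1 := by
    funext y; exact fderiv_apply_one_eq_deriv.symm
  rw [SmoothAt, this]
  exact h1.clm_apply contDiffAt_const

theorem mulV {W : MatField} (hu : SmoothAt u x) (hW : AnalyticAt ℝ W (u x)) (hq : SmoothAt q x) :
    SmoothAt (mulV W u q) x := by
  refine contDiffAt_pi.2 fun i => ContDiffAt.sum fun j _ => ?_
  exact ((hW.entry i j).contDiffAt.comp x hu).mul (contDiffAt_pi.1 hq j)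

theorem quadV {C : QuadField} (hu : SmoothAt u x) (hC : AnalyticAt ℝ C (u x))
    (hp : SmoothAt p x) (hq : SmoothAt q x) : SmoothAt (quadV C u p q) x := by
  refine contDiffAt_pi.2 fun i => ContDiffAt.sum fun j _ => ContDiffAt.sum fun k _ => ?_
  exact (((hC.entry₃ i j k).contDiffAt.comp x hu).mul (contDiffAt_pi.1 hp j)).mul
    (contDiffAt_pi.1 hq k)

theorem deriv_mulV {W : MatField} (hu : SmoothAt u x) (hW : AnalyticAt ℝ W (u x))
    (hq : SmoothAt q x) :
    deriv (_root_.mulV W u q) x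
      = _root_.quadV (dMat W) u q (deriv u) x + _root_.mulV W u (deriv q) x := by
  refine HasDerivAt.deriv (hasDerivAt_pi.2 fun i => ?_)
  have := HasDerivAt.fun_sum (u := Finset.univ) fun (j : Fin 2) _ =>
    (hasDerivAt_comp_pd (hW.entry i j) hu.hasDerivAt).mul (hq.coord j)
  refine this.congr_deriv ?_
  simp only [_root_.quadV, _root_.mulV, Pi.add_apply, dMat, Fin.sum_univ_two]
  ring

theorem deriv_quadV {C : QuadField} (hu : SmoothAt u x) (hC : AnalyticAt ℝ C (u x))
    (hp : SmoothAt p x) (hq : SmoothAt q x) :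
    deriv (_root_.quadV C u p q) x = cubV (dQuad C) u p q (deriv u) x
      + _root_.quadV C u (deriv p) q x + _root_.quadV C u p (deriv q) x := by
  refine HasDerivAt.deriv (hasDerivAt_pi.2 fun i => ?_)
  have := HasDerivAt.fun_sum (u := Finset.univ) fun (j : Fin 2) _ =>
    HasDerivAt.fun_sum (u := Finset.univ) fun (k : Fin 2) _ =>
    ((hasDerivAt_comp_pd (hC.entry₃ i j k) hu.hasDerivAt).mul (hp.coord j)).mul (hq.coord k)
  refine this.congr_deriv ?_
  simp only [_root_.quadV, cubV, Pi.add_apply, Pi.mul_apply, dQuad, Fin.sum_univ_two]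
  ring

theorem eventually_mem {U : Set Pt} (hu : SmoothAt u x) (hU : IsOpen U) (h : u x ∈ U) :
    ∀ᶠ y in 𝓝 x, u y ∈ U :=
  hu.continuousAt.preimage_mem_nhds (hU.mem_nhds h)

theorem eventually (h : SmoothAt q x) : ∀ᶠ y in 𝓝 x, DifferentiableAt ℝ q y := by
  have h1 : ContDiffAt ℝ 1 q x := h.of_le (by exact_mod_cast le_top)
  filter_upwards [h1.eventually (by simp)] with y hy
  exact hy.differentiableAt (by simp)

end SmoothAt

theorem firstOrder_eq (W B : MatField) (C : QuadField) (ε : ℝ) (u : ℝ → Pt) :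
    firstOrder W B C ε u = mulV W u (deriv u)
      + ε • (mulV B u (deriv (deriv u)) + quadV C u (deriv u) (deriv u)) := by
  funext x i
  simp only [firstOrder, mulV, quadV, Pi.add_apply, Pi.smul_apply, smul_eq_mul]

theorem hydro_eq_firstOrder (W : MatField) : hydro W = firstOrder W 0 0 := by
  funext ε u x i
  simp [firstOrder, hydro]

/-- A smooth curve with values in `U` at `x`. -/
theorem consLaw_eq {a : Pt → Pt} {B : MatField} {u : ℝ → Pt} {x : ℝ} (ε : ℝ) (hu : SmoothAt u x)
    (ha : AnalyticAt ℝ a (u x)) (hB : AnalyticAt ℝ B (u x)) :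
    consLaw a B ε u x = firstOrder (jac a) B (dMat B) ε u x := by
  funext i
  have h1 := hasDerivAt_comp_pd (analyticAt_pi_iff.1 ha i) hu.hasDerivAt
  have h2 := (hu.mulV hB hu.derivAt).coord i
  rw [hu.deriv_mulV hB hu.derivAt] at h2
  refine ((h1.add (h2.const_mul ε)).deriv.trans ?_)
  simp only [firstOrder_eq, mulV, quadV, jac, Pi.add_apply, Pi.smul_apply, smul_eq_mul]
  ring

/-- The variation of `W(u) u_x` in the direction `q`. -/
noncomputable def varV (W : MatField) (u q : ℝ → Pt) : ℝ → Pt :=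
  quadV (dMat W) u (deriv u) q + mulV W u (deriv q)

/-- The variation of `B(u) u_xx + C(u)(u_x, u_x)` in the direction `q`. -/
noncomputable def varV₂ (B : MatField) (C : QuadField) (u q : ℝ → Pt) : ℝ → Pt :=
  quadV (dMat B) u (deriv (deriv u)) q + mulV B u (deriv (deriv q))
    + cubV (dQuad C) u (deriv u) (deriv u) q
    + quadV C u (deriv q) (deriv u) + quadV C u (deriv u) (deriv q)

theorem deriv_add_smul {u q : ℝ → Pt} {x : ℝ} (hu : SmoothAt u x) (hq : SmoothAt q x) (s : ℝ) :
    deriv (u + s • q) x = deriv u x + s • deriv q x :=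
  (hu.hasDerivAt.add (hq.hasDerivAt.const_smul s)).deriv

theorem deriv_deriv_add_smul {u q : ℝ → Pt} {x : ℝ} (hu : SmoothAt u x) (hq : SmoothAt q x)
    (s : ℝ) : deriv (deriv (u + s • q)) x = deriv (deriv u) x + s • deriv (deriv q) x := by
  have : deriv (u + s • q) =ᶠ[𝓝 x] deriv u + s • deriv q := by
    filter_upwards [hu.eventually, hq.eventually] with y h1 h2
    exact (h1.hasDerivAt.add (h2.hasDerivAt.const_smul s)).deriv
  rw [this.deriv_eq]
  exact deriv_add_smul hu.derivAt hq.derivAt s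

theorem hasDerivAt_line (a b : Pt) : HasDerivAt (fun s : ℝ => a + s • b) b 0 := by
  simpa using ((hasDerivAt_id (0 : ℝ)).smul_const b).const_add a

theorem hasDerivAt_line_coord (a b : Pt) (j : Fin 2) :
    HasDerivAt (fun s : ℝ => a j + s * b j) (b j) 0 := by
  simpa using ((hasDerivAt_id (0 : ℝ)).mul_const (b j)).const_add (a j)

theorem hasDerivAt_firstOrder {W B : MatField} {C : QuadField} {u q : ℝ → Pt} {x : ℝ} (ε : ℝ)
    (hu : SmoothAt u x) (hq : SmoothAt q x) (hW : AnalyticAt ℝ W (u x))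
    (hB : AnalyticAt ℝ B (u x)) (hC : AnalyticAt ℝ C (u x)) :
    HasDerivAt (fun s : ℝ => firstOrder W B C ε (u + s • q) x)
      (varV W u q x + ε • varV₂ B C u q x) 0 := by
  have hf : (fun s : ℝ => firstOrder W B C ε (u + s • q) x) = fun s i =>
      ∑ j, W (u x + s • q x) i j * (deriv u x j + s * deriv q x j)
      + ε * (∑ j, B (u x + s • q x) i j * (deriv (deriv u) x j + s * deriv (deriv q) x j)
        + ∑ j, ∑ k, C (u x + s • q x) i j k * (deriv u x j + s * deriv q x j)
          * (deriv u x k + s * deriv q x k)) := by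
    funext s i
    simp [firstOrder, deriv_add_smul hu hq, deriv_deriv_add_smul hu hq]
  rw [hf]
  refine hasDerivAt_pi.2 fun i => ?_
  have l0 := hasDerivAt_line (u x) (q x)
  have l1 := hasDerivAt_line_coord (deriv u x) (deriv q x)
  have l2 := hasDerivAt_line_coord (deriv (deriv u) x) (deriv (deriv q) x)
  have e0 : u x = u x + (0 : ℝ) • q x := by simp
  rw [e0] at hW hB hC
  have t1 := HasDerivAt.fun_sum (u := Finset.univ) fun (j : Fin 2) _ =>
    (hasDerivAt_comp_pd (u := fun s : ℝ => u x + s • q x) (hW.entry i j) l0).mul (l1 j)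
  have t2 := HasDerivAt.fun_sum (u := Finset.univ) fun (j : Fin 2) _ =>
    (hasDerivAt_comp_pd (u := fun s : ℝ => u x + s • q x) (hB.entry i j) l0).mul (l2 j)
  have t3 := HasDerivAt.fun_sum (u := Finset.univ) fun (j : Fin 2) _ =>
    HasDerivAt.fun_sum (u := Finset.univ) fun (k : Fin 2) _ =>
    ((hasDerivAt_comp_pd (u := fun s : ℝ => u x + s • q x) (hC.entry₃ i j k) l0).mul (l1 j)).mul
      (l1 k)
  refine (t1.add ((t2.add t3).const_mul ε)).congr_deriv ?_
  simp only [varV, varV₂, quadV, mulV, cubV, Pi.add_apply, Pi.mul_apply, Pi.smul_apply, smul_eq_mul,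
    dMat, dQuad,
    Fin.sum_univ_two, zero_smul, add_zero, zero_mul]
  ring

/-! ### Expansion in the formal parameter -/

/-- Taylor's theorem for an analytic function of ε. Analyticity rather than polynomiality is what is
available for a system evaluated at a Miura-transformed field. -/
theorem isBigO_sq_iff {g : ℝ → Pt} (hg : AnalyticAt ℝ g 0) :
    (g =O[𝓝 0] fun ε : ℝ => ε ^ 2) ↔ g 0 = 0 ∧ deriv g 0 = 0 := by
  have h2 := natCast_le_analyticOrderAt_iff_iteratedDeriv_eq_zero (n := 2) hg
  have h3 := natCast_le_analyticOrderAt (n := 2) hg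
  constructor
  · intro h
    have hs : Tendsto (fun ε : ℝ => ε ^ 2) (𝓝 0) (𝓝 0) := by
      have : ContinuousAt (fun ε : ℝ => ε ^ 2) 0 := by fun_prop
      simpa [ContinuousAt] using this
    have h0 : g 0 = 0 :=
      tendsto_nhds_unique hg.continuousAt (h.trans_tendsto hs)
    refine ⟨h0, ?_⟩
    have hd : HasDerivAt g 0 0 := by
      rw [hasDerivAt_iff_isLittleO]
      have : (fun ε : ℝ => ε ^ 2) =o[𝓝 0] fun ε : ℝ => ε := by
        simpa using isLittleO_pow_id (𝕜 := ℝ) (n := 2) (by norm_num)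
      simpa [h0] using h.trans_isLittleO this
    exact hd.deriv
  · rintro ⟨h0, h1⟩
    obtain ⟨f, hf, hfg⟩ := h3.1 (h2.2 fun i hi => by
      interval_cases i
      · simpa using h0
      · simpa using h1)
    have hb : f =O[𝓝 0] fun _ => (1 : ℝ) := hf.continuousAt.isBigO_one ℝ
    have : (fun z : ℝ => (z - 0) ^ 2 • f z) =O[𝓝 0] fun ε : ℝ => ε ^ 2 * 1 := by
      simpa using (isBigO_refl (fun z : ℝ => z ^ 2) (𝓝 0)).smul hb
    refine (this.congr' (hfg.mono fun z hz => hz.symm) ?_)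
    exact .of_forall fun z => by simp

theorem isBigO_sq_poly (a b c : Pt) :
    ((fun ε : ℝ => a + ε • b + ε ^ 2 • c) =O[𝓝 0] fun ε : ℝ => ε ^ 2) ↔ a = 0 ∧ b = 0 := by
  have hd : HasDerivAt (fun ε : ℝ => a + ε • b + ε ^ 2 • c) b 0 := by
    have := (hasDerivAt_line a b).add ((hasDerivAt_pow 2 (0 : ℝ)).smul_const c)
    exact this.congr_deriv (by simp)
  rw [isBigO_sq_iff (by fun_prop), hd.deriv]
  simp

section
variable {A B W B' : MatField} {C C' : QuadField} {u q p : ℝ → Pt} {x : ℝ}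

theorem firstOrder_congr (W B : MatField) (C : QuadField) (ε : ℝ) {v : ℝ → Pt}
    (h : u =ᶠ[𝓝 x] v) : firstOrder W B C ε u x = firstOrder W B C ε v x := by
  funext i
  simp only [firstOrder, h.eq_of_nhds, h.deriv_eq, h.deriv.deriv_eq]

theorem miura_congr (F : Pt → Pt) (N : MatField) (ε : ℝ) {v : ℝ → Pt}
    (h : u =ᶠ[𝓝 x] v) : miura F N ε u x = miura F N ε v x := by
  funext i
  simp only [miura, h.eq_of_nhds, h.deriv_eq]

theorem varV_line (hu : SmoothAt q x) (hp : SmoothAt p x) (ε : ℝ) :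
    varV W u (q + ε • p) x = varV W u q x + ε • varV W u p x := by
  funext i
  simp only [varV, quadV, mulV, deriv_add_smul hu hp, Pi.add_apply, Pi.smul_apply, smul_eq_mul,
    Fin.sum_univ_two]
  ring

theorem varV₂_line (hu : SmoothAt q x) (hp : SmoothAt p x) (ε : ℝ) :
    varV₂ B C u (q + ε • p) x = varV₂ B C u q x + ε • varV₂ B C u p x := by
  funext i
  simp only [varV₂, quadV, mulV, cubV, deriv_add_smul hu hp, deriv_deriv_add_smul hu hp,
    Pi.add_apply, Pi.smul_apply, smul_eq_mul, Fin.sum_univ_two]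
  ring

/-- The part of first order in `ε` of a system. -/
noncomputable def corr (B : MatField) (C : QuadField) (u : ℝ → Pt) : ℝ → Pt :=
  mulV B u (deriv (deriv u)) + quadV C u (deriv u) (deriv u)

theorem SmoothAt.corr (hu : SmoothAt u x) (hB : AnalyticAt ℝ B (u x))
    (hC : AnalyticAt ℝ C (u x)) : SmoothAt (corr B C u) x :=
  (hu.mulV hB hu.derivAt.derivAt).add (hu.quadV hC hu.derivAt hu.derivAt)

theorem SmoothAt.firstOrder (hu : SmoothAt u x) (hW : AnalyticAt ℝ W (u x))
    (hB : AnalyticAt ℝ B (u x)) (hC : AnalyticAt ℝ C (u x)) (ε : ℝ) :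
    SmoothAt (firstOrder W B C ε u) x := by
  rw [firstOrder_eq]
  exact (hu.mulV hW hu.derivAt).add ((hu.corr hB hC).const_smul ε)

/-- Each system is affine in ε and its variation is linear in the direction, so the bracket is
exactly quadratic in ε; only its first two coefficients matter later. -/
theorem evBracket_firstOrder (hu : SmoothAt u x) (hA : AnalyticAt ℝ A (u x))
    (hB : AnalyticAt ℝ B (u x)) (hC : AnalyticAt ℝ C (u x)) (hW : AnalyticAt ℝ W (u x))
    (hB' : AnalyticAt ℝ B' (u x)) (hC' : AnalyticAt ℝ C' (u x)) (ε : ℝ) :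
    evBracket (firstOrder A B C ε) (firstOrder W B' C' ε) u x =
      (varV A u (mulV W u (deriv u)) x - varV W u (mulV A u (deriv u)) x)
      + ε • (varV A u (corr B' C' u) x + varV₂ B C u (mulV W u (deriv u)) x
        - varV W u (corr B C u) x - varV₂ B' C' u (mulV A u (deriv u)) x)
      + ε ^ 2 • (varV₂ B C u (corr B' C' u) x - varV₂ B' C' u (corr B C u) x) := by
  have s1 := hu.mulV hA hu.derivAt
  have s2 := hu.mulV hW hu.derivAt
  have s3 := hu.corr hB hC
  have s4 := hu.corr hB' hC'
  rw [evBracket, (hasDerivAt_firstOrder ε hu (hu.firstOrder hW hB' hC' ε) hA hB hC).deriv,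
    (hasDerivAt_firstOrder ε hu (hu.firstOrder hA hB hC ε) hW hB' hC').deriv,
    firstOrder_eq, firstOrder_eq]
  change varV A u (_ + ε • corr B' C' u) x + ε • varV₂ B C u (_ + ε • corr B' C' u) x
    - (varV W u (_ + ε • corr B C u) x + ε • varV₂ B' C' u (_ + ε • corr B C u) x) = _
  rw [varV_line s2 s4, varV_line s1 s3, varV₂_line s2 s4, varV₂_line s1 s3]
  module

/-- The two forms of the flow agree only where the field lies in U. Openness supplies this near x,
and at x for small variations s, which suffices for both derivatives in the bracket. -/
theorem evBracket_consLaw {a : Pt → Pt} {U : Set Pt} (hU : IsOpen U) (hu' : ContDiff ℝ ∞ u)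
    (hx : u x ∈ U) (ha : AnalyticOnNhd ℝ a U) (hB : AnalyticOnNhd ℝ B U)
    (hW : AnalyticOnNhd ℝ W U) (hB' : AnalyticOnNhd ℝ B' U) (hC' : AnalyticOnNhd ℝ C' U) (ε : ℝ) :
    evBracket (consLaw a B ε) (firstOrder W B' C' ε) u x
      = evBracket (firstOrder (jac a) B (dMat B) ε) (firstOrder W B' C' ε) u x := by
  have hu : SmoothAt u x := hu'.contDiffAt
  have sq := hu.firstOrder (hW _ hx) (hB' _ hx) (hC' _ hx) ε
  have e1 : (fun s : ℝ => consLaw a B ε (u + s • firstOrder W B' C' ε u) x) =ᶠ[𝓝 0]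
      fun s : ℝ => firstOrder (jac a) B (dMat B) ε (u + s • firstOrder W B' C' ε u) x := by
    have hc : ContinuousAt (fun s : ℝ => u x + s • firstOrder W B' C' ε u x) 0 := by fun_prop
    filter_upwards [hc.preimage_mem_nhds (hU.mem_nhds (by simpa using hx))] with s hs
    exact consLaw_eq ε (hu.add (sq.const_smul s)) (ha _ hs) (hB _ hs)
  have e2 : consLaw a B ε u =ᶠ[𝓝 x] firstOrder (jac a) B (dMat B) ε u := by
    filter_upwards [hu.eventually_mem hU hx] with y hy
    exact consLaw_eq ε hu'.contDiffAt (ha _ hy) (hB _ hy)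
  rw [evBracket, evBracket, e1.deriv_eq]
  congr 2
  funext s
  refine firstOrder_congr _ _ _ _ ?_
  filter_upwards [e2] with y hy
  simp [hy]
end

section
variable {a F : Pt → Pt} {A B W B' N : MatField} {C C' : QuadField} {u : ℝ → Pt} {x : ℝ}

/-- The order `0` and `1` parts of the condition that two systems commute. -/
theorem commute_iff {U : Set Pt} (hU : IsOpen U) (ha : AnalyticOnNhd ℝ a U)
    (hB : AnalyticOnNhd ℝ B U) (hW : AnalyticOnNhd ℝ W U) (hB' : AnalyticOnNhd ℝ B' U)
    (hC' : AnalyticOnNhd ℝ C' U) :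
    CommuteUpToFirstOrder U (consLaw a B) (firstOrder W B' C') ↔
      CommuteUpToFirstOrder U (firstOrder (jac a) B (dMat B)) (firstOrder W B' C') := by
  refine forall_congr' fun u => forall_congr' fun hu => forall_congr' fun x =>
    forall_congr' fun hx => ?_
  simp only [evBracket_consLaw hU hu hx ha hB hW hB' hC']

theorem commute_firstOrder_iff {U : Set Pt} (hA : AnalyticOnNhd ℝ A U)
    (hB : AnalyticOnNhd ℝ B U) (hC : AnalyticOnNhd ℝ C U) (hW : AnalyticOnNhd ℝ W U)
    (hB' : AnalyticOnNhd ℝ B' U) (hC' : AnalyticOnNhd ℝ C' U) :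
    CommuteUpToFirstOrder U (firstOrder A B C) (firstOrder W B' C') ↔
      ∀ u : ℝ → Pt, ContDiff ℝ ∞ u → ∀ x : ℝ, u x ∈ U →
        varV A u (mulV W u (deriv u)) x = varV W u (mulV A u (deriv u)) x ∧
        varV A u (corr B' C' u) x + varV₂ B C u (mulV W u (deriv u)) x
          = varV W u (corr B C u) x + varV₂ B' C' u (mulV A u (deriv u)) x := by
  refine forall_congr' fun u => forall_congr' fun hu => forall_congr' fun x =>
    forall_congr' fun hx => ?_
  simp only [evBracket_firstOrder (x := x) hu.contDiffAt (hA _ hx) (hB _ hx) (hC _ hx) (hW _ hx)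
    (hB' _ hx) (hC' _ hx), isBigO_sq_poly, sub_eq_zero, sub_sub]

theorem isDispersionlessSymmetry_iff {U : Set Pt} (hU : IsOpen U) (ha : AnalyticOnNhd ℝ a U)
    (hA : AnalyticOnNhd ℝ (jac a) U) (hB : AnalyticOnNhd ℝ B U) :
    IsDispersionlessSymmetry U (consLaw a B) W ↔ AnalyticOnNhd ℝ W U ∧
      ∀ u : ℝ → Pt, ContDiff ℝ ∞ u → ∀ x : ℝ, u x ∈ U →
        varV (jac a) u (mulV W u (deriv u)) x = varV W u (mulV (jac a) u (deriv u)) x := by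
  refine and_congr_right fun hW => forall_congr' fun u => forall_congr' fun hu =>
    forall_congr' fun x => forall_congr' fun hx => ?_
  have h0 : AnalyticOnNhd ℝ (0 : MatField) U := fun _ _ => analyticAt_const
  have h1 : AnalyticOnNhd ℝ (0 : QuadField) U := fun _ _ => analyticAt_const
  rw [hydro_eq_firstOrder W, evBracket_consLaw hU hu hx ha hB hW h0 h1,
    evBracket_firstOrder (x := x) hu.contDiffAt (hA _ hx) (hB _ hx) (hB _ hx).dMat (hW _ hx)
    (h0 _ hx) (h1 _ hx)]
  simp [sub_eq_zero]

theorem hasDerivAt_miura {q : ℝ → Pt} (ε : ℝ) (hu : SmoothAt u x) (hq : SmoothAt q x)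
    (hF : AnalyticAt ℝ F (u x)) (hN : AnalyticAt ℝ N (u x)) :
    HasDerivAt (fun s : ℝ => miura F N ε (u + s • q) x)
      (mulV (jac F) u q x + ε • varV N u q x) 0 := by
  have hf : (fun s : ℝ => miura F N ε (u + s • q) x) = fun s i =>
      F (u x + s • q x) i
        + ε * ∑ j, N (u x + s • q x) i j * (deriv u x j + s * deriv q x j) := by
    funext s i
    simp [miura, deriv_add_smul hu hq]
  rw [hf]
  refine hasDerivAt_pi.2 fun i => ?_
  have l0 := hasDerivAt_line (u x) (q x)
  have l1 := hasDerivAt_line_coord (deriv u x) (deriv q x)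
  have e0 : u x = u x + (0 : ℝ) • q x := by simp
  rw [e0] at hF hN
  have t1 := hasDerivAt_comp_pd (u := fun s : ℝ => u x + s • q x) (analyticAt_pi_iff.1 hF i) l0
  have t2 := HasDerivAt.fun_sum (u := Finset.univ) fun (j : Fin 2) _ =>
    (hasDerivAt_comp_pd (u := fun s : ℝ => u x + s • q x) (hN.entry i j) l0).mul (l1 j)
  refine (t1.add (t2.const_mul ε)).congr_deriv ?_
  simp only [varV, quadV, mulV, jac, Pi.add_apply, Pi.smul_apply, smul_eq_mul, dMat,
    Fin.sum_univ_two, zero_smul, add_zero, zero_mul]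
  ring

theorem firstOrder_along_line {w n : ℝ → Pt} (hw : SmoothAt w x) (hn : SmoothAt n x)
    (hW : AnalyticAt ℝ W (w x)) (hB : AnalyticAt ℝ B (w x)) (hC : AnalyticAt ℝ C (w x)) :
    AnalyticAt ℝ (fun ε : ℝ => firstOrder W B C ε (w + ε • n) x) 0 ∧
    HasDerivAt (fun ε : ℝ => firstOrder W B C ε (w + ε • n) x)
      (varV W w n x + corr B C w x) 0 := by
  have hf : (fun s : ℝ => firstOrder W B C s (w + s • n) x) = fun s i =>
      ∑ j, W (w x + s • n x) i j * (deriv w x j + s * deriv n x j)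
      + s * (∑ j, B (w x + s • n x) i j * (deriv (deriv w) x j + s * deriv (deriv n) x j)
        + ∑ j, ∑ k, C (w x + s • n x) i j k * (deriv w x j + s * deriv n x j)
          * (deriv w x k + s * deriv n x k)) := by
    funext s i
    simp [firstOrder, deriv_add_smul hw hn, deriv_deriv_add_smul hw hn]
  have e0 : w x = w x + (0 : ℝ) • n x := by simp
  rw [e0] at hW hB hC
  have hl : AnalyticAt ℝ (fun s : ℝ => w x + s • n x) 0 := by fun_prop
  rw [hf]
  constructor
  · refine analyticAt_pi_iff.2 fun i => AnalyticAt.fun_add ?_ (AnalyticAt.fun_mul analyticAt_id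
      (AnalyticAt.fun_add ?_ ?_))
    · refine Finset.analyticAt_fun_sum _ fun j _ => AnalyticAt.fun_mul ?_ (by fun_prop)
      exact (hW.entry i j).comp (g := fun w => W w i j) (f := fun s : ℝ => w x + s • n x) hl
    · refine Finset.analyticAt_fun_sum _ fun j _ => AnalyticAt.fun_mul ?_ (by fun_prop)
      exact (hB.entry i j).comp (g := fun w => B w i j) (f := fun s : ℝ => w x + s • n x) hl
    · refine Finset.analyticAt_fun_sum _ fun j _ => Finset.analyticAt_fun_sum _ fun k _ =>
        AnalyticAt.fun_mul (AnalyticAt.fun_mul ?_ (by fun_prop)) (by fun_prop)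
      exact (hC.entry₃ i j k).comp (g := fun w => C w i j k)
        (f := fun s : ℝ => w x + s • n x) hl
  · refine hasDerivAt_pi.2 fun i => ?_
    have l0 := hasDerivAt_line (w x) (n x)
    have l1 := hasDerivAt_line_coord (deriv w x) (deriv n x)
    have l2 := hasDerivAt_line_coord (deriv (deriv w) x) (deriv (deriv n) x)
    have t1 := HasDerivAt.fun_sum (u := Finset.univ) fun (j : Fin 2) _ =>
      (hasDerivAt_comp_pd (u := fun s : ℝ => w x + s • n x) (hW.entry i j) l0).mul (l1 j)
    have t2 := HasDerivAt.fun_sum (u := Finset.univ) fun (j : Fin 2) _ =>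
      (hasDerivAt_comp_pd (u := fun s : ℝ => w x + s • n x) (hB.entry i j) l0).mul (l2 j)
    have t3 := HasDerivAt.fun_sum (u := Finset.univ) fun (j : Fin 2) _ =>
      HasDerivAt.fun_sum (u := Finset.univ) fun (k : Fin 2) _ =>
      ((hasDerivAt_comp_pd (u := fun s : ℝ => w x + s • n x) (hC.entry₃ i j k) l0).mul
        (l1 j)).mul (l1 k)
    refine (t1.add ((hasDerivAt_id (0 : ℝ)).mul (t2.add t3))).congr_deriv ?_
    simp only [varV, corr, quadV, mulV, Pi.add_apply, Pi.mul_apply, dMat, id,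
      Fin.sum_univ_two, zero_smul, add_zero, zero_mul]
    ring

theorem miura_eq_line (F : Pt → Pt) (N : MatField) (ε : ℝ) (u : ℝ → Pt) :
    miura F N ε u = (fun y => F (u y)) + ε • mulV N u (deriv u) := by
  funext y i
  simp [miura, mulV]

/-- The transformed field is F ∘ u displaced by ε N u_x, so the target system is expanded along this
line. The two equations are the Taylor coefficients of orders 0 and 1 in ε. -/
theorem transform_iff {W' : MatField} (hu : SmoothAt u x)
    (hF : AnalyticAt ℝ F (u x)) (hN : AnalyticAt ℝ N (u x)) (hW : AnalyticAt ℝ W (u x))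
    (hB : AnalyticAt ℝ B (u x)) (hC : AnalyticAt ℝ C (u x)) (hW' : AnalyticAt ℝ W' (F (u x)))
    (hB' : AnalyticAt ℝ B' (F (u x))) (hC' : AnalyticAt ℝ C' (F (u x))) :
    (fun ε : ℝ => deriv (fun s : ℝ => miura F N ε (u + s • firstOrder W B C ε u) x) 0
      - firstOrder W' B' C' ε (miura F N ε u) x) =O[𝓝 0] (fun ε : ℝ => ε ^ 2) ↔
    mulV (jac F) u (mulV W u (deriv u)) x = mulV W' (F ∘ u) (deriv (F ∘ u)) x ∧
    mulV (jac F) u (corr B C u) x + varV N u (mulV W u (deriv u)) x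
      = varV W' (F ∘ u) (mulV N u (deriv u)) x + corr B' C' (F ∘ u) x := by
  have hw : SmoothAt (F ∘ u) x := hF.contDiffAt.comp x hu
  have hn := hu.mulV hN hu.derivAt
  obtain ⟨ha, hd⟩ := firstOrder_along_line hw hn hW' hB' hC'
  have s1 := hu.mulV hW hu.derivAt
  have s2 := hu.corr hB hC
  have e1 : (fun ε : ℝ => deriv (fun s : ℝ => miura F N ε (u + s • firstOrder W B C ε u) x) 0
      - firstOrder W' B' C' ε (miura F N ε u) x) = fun ε : ℝ =>
      (mulV (jac F) u (mulV W u (deriv u)) x + ε • (mulV (jac F) u (corr B C u) x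
        + varV N u (mulV W u (deriv u)) x) + ε ^ 2 • varV N u (corr B C u) x)
      - firstOrder W' B' C' ε (F ∘ u + ε • mulV N u (deriv u)) x := by
    funext ε
    rw [(hasDerivAt_miura ε hu (hu.firstOrder hW hB hC ε) hF hN).deriv, firstOrder_eq W B C,
      miura_eq_line F N ε u]
    change _ + ε • varV N u (_ + ε • corr B C u) x - _ = _
    rw [varV_line s1 s2]
    have : mulV (jac F) u (mulV W u (deriv u) + ε • corr B C u) x
        = mulV (jac F) u (mulV W u (deriv u)) x + ε • mulV (jac F) u (corr B C u) x := by
      funext i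
      simp only [mulV, Pi.add_apply, Pi.smul_apply, smul_eq_mul, Fin.sum_univ_two]
      ring
    change mulV (jac F) u (mulV W u (deriv u) + ε • corr B C u) x + _ - _ = _
    rw [this]
    congr 1
    module
  have hp : HasDerivAt (fun ε : ℝ =>
      mulV (jac F) u (mulV W u (deriv u)) x + ε • (mulV (jac F) u (corr B C u) x
        + varV N u (mulV W u (deriv u)) x) + ε ^ 2 • varV N u (corr B C u) x)
      (mulV (jac F) u (corr B C u) x + varV N u (mulV W u (deriv u)) x) 0 := by
    have := (hasDerivAt_line (mulV (jac F) u (mulV W u (deriv u)) x) (mulV (jac F) u (corr B C u) x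
        + varV N u (mulV W u (deriv u)) x)).add
        ((hasDerivAt_pow 2 (0 : ℝ)).smul_const (varV N u (corr B C u) x))
    exact this.congr_deriv (by simp)
  rw [e1, isBigO_sq_iff (AnalyticAt.fun_sub (by fun_prop) ha), (hp.fun_sub hd).deriv, sub_eq_zero,
    sub_eq_zero]
  simp [firstOrder_eq]
end

section
variable {V : Set Pt} {a F : Pt → Pt} {B N : MatField}

theorem transformsTo_consLaw_left (hV : IsOpen V) (ha : AnalyticOnNhd ℝ a V)
    (hB : AnalyticOnNhd ℝ B V) (Y : Evol) :
    TransformsTo V (miura F N) (consLaw a B) Y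
      ↔ TransformsTo V (miura F N) (firstOrder (jac a) B (dMat B)) Y := by
  refine forall_congr' fun u => forall_congr' fun hu => forall_congr' fun x =>
    forall_congr' fun hx => ?_
  have : ∀ ε s : ℝ, miura F N ε (u + s • consLaw a B ε u) x
      = miura F N ε (u + s • firstOrder (jac a) B (dMat B) ε u) x := by
    intro ε s
    refine miura_congr _ _ _ ?_
    filter_upwards [SmoothAt.eventually_mem (x := x) hu.contDiffAt hV hx] with y hy
    simp [consLaw_eq ε (x := y) hu.contDiffAt (ha _ hy) (hB _ hy)]
  simp only [this]

/-- The transformed field at x lies in V' only for small ε, so the two target systems are compared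
as germs at ε = 0. -/
theorem transformsTo_consLaw_right {V' : Set Pt} (hV' : IsOpen V') (hF : AnalyticOnNhd ℝ F V)
    (hN : AnalyticOnNhd ℝ N V) (hFV : Set.MapsTo F V V') (ha : AnalyticOnNhd ℝ a V')
    (hB : AnalyticOnNhd ℝ B V') (X : Evol) :
    TransformsTo V (miura F N) X (consLaw a B)
      ↔ TransformsTo V (miura F N) X (firstOrder (jac a) B (dMat B)) := by
  refine forall_congr' fun u => forall_congr' fun hu => forall_congr' fun x =>
    forall_congr' fun hx => ?_
  have hu' : SmoothAt u x := hu.contDiffAt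
  have hw : SmoothAt (fun y => F (u y)) x := (hF _ hx).contDiffAt.comp x hu'
  have hn := hu'.mulV (hN _ hx) hu'.derivAt
  refine isBigO_congr ?_ EventuallyEq.rfl
  have hc : ContinuousAt (fun ε : ℝ => F (u x) + ε • mulV N u (deriv u) x) 0 := by fun_prop
  filter_upwards [hc.preimage_mem_nhds (hV'.mem_nhds (by simpa using hFV hx))] with ε hε
  have := consLaw_eq (a := a) (B := B) (u := (fun y => F (u y)) + ε • mulV N u (deriv u)) ε
    (hw.add (hn.const_smul ε)) (ha _ hε) (hB _ hε)
  rw [miura_eq_line, this]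
end

/-! ### Systems of conservation laws -/

theorem mulV_apply (W : MatField) (u q : ℝ → Pt) (y : ℝ) (i : Fin 2) :
    mulV W u q y i = ∑ j, W (u y) i j * q y j := rfl

theorem quadV_apply (C : QuadField) (u p q : ℝ → Pt) (y : ℝ) (i : Fin 2) :
    quadV C u p q y i = ∑ j, ∑ k, C (u y) i j k * p y j * q y k := rfl

theorem cubV_apply (T : Pt → Fin 2 → Fin 2 → Fin 2 → Fin 2 → ℝ) (u p q r : ℝ → Pt) (y : ℝ)
    (i : Fin 2) : cubV T u p q r y i
      = ∑ j, ∑ k, ∑ l, T (u y) i j k l * p y j * q y k * r y l := rfl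

/-- The rows of `W` are closed on `U`. -/
def CurlFree (W : MatField) (U : Set Pt) : Prop :=
  ∀ z ∈ U, ∀ i j k, dMat W z i j k = dMat W z i k j

/-- The commutator of two matrix fields. -/
noncomputable def commMat (A W : MatField) : MatField := fun z i j =>
  ∑ l, (A z i l * W z l j - W z i l * A z l j)

/-- The coefficient of `u_xx` in the flux of the bracket of two deformed flows. -/
noncomputable def fluxK (A B W B' : MatField) : MatField := fun z i j =>
  ∑ l, (A z i l * B' z l j + B z i l * W z l j - W z i l * B z l j - B' z i l * A z l j)

/-- The coefficient of `u_x u_x` in the flux of the bracket of two deformed flows. -/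
noncomputable def fluxG (A B W B' : MatField) (C C' : QuadField) : QuadField := fun z i j k =>
  ∑ l, (A z i l * C' z l j k + dMat B z i j l * W z l k + B z i l * dMat W z l j k
    - W z i l * C z l j k - dMat B' z i j l * A z l k - B' z i l * dMat A z l j k)

theorem AnalyticAt.commMat {A W : MatField} {z : Pt} (hA : AnalyticAt ℝ A z)
    (hW : AnalyticAt ℝ W z) : AnalyticAt ℝ (commMat A W) z := by
  refine analyticAt_mat fun i j => Finset.analyticAt_fun_sum _ fun l _ => ?_
  exact ((hA.entry i l).fun_mul (hW.entry l j)).fun_sub ((hW.entry i l).fun_mul (hA.entry l j))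

section
variable {A B W B' : MatField} {C C' Q : QuadField} {z : Pt}

theorem AnalyticAt.fluxK (hA : AnalyticAt ℝ A z) (hB : AnalyticAt ℝ B z)
    (hW : AnalyticAt ℝ W z) (hB' : AnalyticAt ℝ B' z) : AnalyticAt ℝ (fluxK A B W B') z := by
  refine analyticAt_mat fun i j => Finset.analyticAt_fun_sum _ fun l _ => ?_
  exact ((((hA.entry i l).fun_mul (hB'.entry l j)).fun_add
    ((hB.entry i l).fun_mul (hW.entry l j))).fun_sub
    ((hW.entry i l).fun_mul (hB.entry l j))).fun_sub ((hB'.entry i l).fun_mul (hA.entry l j))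

theorem AnalyticAt.fluxG (hA : AnalyticAt ℝ A z) (hB : AnalyticAt ℝ B z)
    (hW : AnalyticAt ℝ W z) (hB' : AnalyticAt ℝ B' z) (hC : AnalyticAt ℝ C z)
    (hC' : AnalyticAt ℝ C' z) : AnalyticAt ℝ (fluxG A B W B' C C') z := by
  refine analyticAt_quad fun i j k => Finset.analyticAt_fun_sum _ fun l _ => ?_
  exact (((((((hA.entry i l).fun_mul (hC'.entry₃ l j k)).fun_add
    ((hB.dMat.entry₃ i j l).fun_mul (hW.entry l k))).fun_add
    ((hB.entry i l).fun_mul (hW.dMat.entry₃ l j k))).fun_sub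
    ((hW.entry i l).fun_mul (hC.entry₃ l j k))).fun_sub
    ((hB'.dMat.entry₃ i j l).fun_mul (hA.entry l k)))).fun_sub
    ((hB'.entry i l).fun_mul (hA.dMat.entry₃ l j k))

theorem dQuad_add (hC : AnalyticAt ℝ C z) (hQ : AnalyticAt ℝ Q z) :
    dQuad (C + Q) z = dQuad C z + dQuad Q z := by
  funext i j k l
  have := fderiv_fun_add (hC.entry₃ i j k).differentiableAt (hQ.entry₃ i j k).differentiableAt
  simp only [dQuad, pd, Pi.add_apply]
  rw [this]
  rfl

theorem dQuad_dMat_comm (hB : AnalyticAt ℝ B z) (i j k l : Fin 2) :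
    dQuad (dMat B) z i j k l = dQuad (dMat B) z i j l k :=
  pd_comm (hB.entry i j) l k

variable {U : Set Pt} {u q : ℝ → Pt} {x : ℝ}

/-- A matrix with closed rows is locally a Jacobian, and varying ∂_x of a flux gives ∂_x of the
varied flux. This turns brackets into total x-derivatives. -/
theorem varV_eq_deriv (hc : CurlFree W U) (hx : u x ∈ U) (hu : SmoothAt u x) (hq : SmoothAt q x)
    (hW : AnalyticAt ℝ W (u x)) : varV W u q x = deriv (mulV W u q) x := by
  rw [hu.deriv_mulV hW hq]
  funext i
  simp only [varV, quadV, Pi.add_apply, Fin.sum_univ_two, hc _ hx i 1 0]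
  ring

/-- With quadratic part dB the correction is ∂_x (B u_x), so its variation is again a total
x-derivative; the symmetry of second derivatives enters here. -/
theorem varV₂_dMat_eq_deriv (hu : SmoothAt u x) (hq : SmoothAt q x)
    (hB : AnalyticAt ℝ B (u x)) :
    varV₂ B (dMat B) u q x
      = deriv (quadV (dMat B) u (deriv u) q + mulV B u (deriv q)) x := by
  have h1 := hu.quadV hB.dMat hu.derivAt hq
  have h2 := hu.mulV hB hq.derivAt
  have h3 := (h1.hasDerivAt.add h2.hasDerivAt).deriv
  rw [h3, hu.deriv_mulV hB hq.derivAt, hu.deriv_quadV hB.dMat hu.derivAt hq]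
  funext i
  simp only [varV₂, quadV, cubV, Pi.add_apply, Fin.sum_univ_two,
    dQuad_dMat_comm hB _ _ 1 0]
  ring

theorem varV₂_eq (hB : AnalyticAt ℝ B (u x)) (hQ : AnalyticAt ℝ Q (u x)) :
    varV₂ B (dMat B + Q) u q x = varV₂ B (dMat B) u q x
      + (cubV (dQuad Q) u (deriv u) (deriv u) q x
        + quadV Q u (deriv q) (deriv u) x + quadV Q u (deriv u) (deriv q) x) := by
  funext i
  simp only [varV₂, quadV, cubV, Pi.add_apply, Fin.sum_univ_two, dQuad_add hB.dMat hQ]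
  ring

/-- W is not assumed closed: the last two terms measure the failure of closedness, tested on u_x and
A u_x. -/
theorem order_zero_eq (hA : AnalyticOnNhd ℝ A U) (hW : AnalyticOnNhd ℝ W U)
    (hc : CurlFree A U) (hu : ContDiff ℝ ∞ u) (hx : u x ∈ U) :
    varV A u (mulV W u (deriv u)) x - varV W u (mulV A u (deriv u)) x
      = deriv (mulV (commMat A W) u (deriv u)) x
        + quadV (dMat W) u (mulV A u (deriv u)) (deriv u) x
        - quadV (dMat W) u (deriv u) (mulV A u (deriv u)) x := by
  have hu' : SmoothAt u x := hu.contDiffAt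
  have s1 := hu'.mulV (hW _ hx) hu'.derivAt
  have s2 := hu'.mulV (hA _ hx) hu'.derivAt
  have e : mulV (commMat A W) u (deriv u)
      = mulV A u (mulV W u (deriv u)) - mulV W u (mulV A u (deriv u)) := by
    funext y i
    simp only [mulV, commMat, Pi.sub_apply, Fin.sum_univ_two]
    ring
  rw [e, ((hu'.mulV (hA _ hx) s1).hasDerivAt.sub (hu'.mulV (hW _ hx) s2).hasDerivAt).deriv,
    varV_eq_deriv hc hx hu' s1 (hA _ hx), hu'.deriv_mulV (hW _ hx) s2, varV]
  simp only [Pi.add_apply]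
  abel

/-- Q measures how far the symmetry is from conservation form at order ε. All other terms are
variations of x-derivatives and collect into the flux given by `fluxK` and `fluxG`. -/
theorem order_one_eq (hA : AnalyticOnNhd ℝ A U) (hB : AnalyticOnNhd ℝ B U)
    (hW : AnalyticOnNhd ℝ W U) (hB' : AnalyticOnNhd ℝ B' U) (hQ : AnalyticOnNhd ℝ Q U)
    (hcA : CurlFree A U) (hcW : CurlFree W U) (hU : IsOpen U) (hu : ContDiff ℝ ∞ u)
    (hx : u x ∈ U) :
    varV A u (corr B' (dMat B' + Q) u) x + varV₂ B (dMat B) u (mulV W u (deriv u)) x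
      - (varV W u (corr B (dMat B) u) x + varV₂ B' (dMat B' + Q) u (mulV A u (deriv u)) x)
      = deriv (mulV (fluxK A B W B') u (deriv (deriv u))
          + quadV (fluxG A B W B' (dMat B) (dMat B' + Q)) u (deriv u) (deriv u)) x
        - (cubV (dQuad Q) u (deriv u) (deriv u) (mulV A u (deriv u)) x
        + quadV Q u (deriv (mulV A u (deriv u))) (deriv u) x
        + quadV Q u (deriv u) (deriv (mulV A u (deriv u))) x) := by
  have hs : ∀ y, SmoothAt u y := fun y => hu.contDiffAt
  have hu' := hs x
  have q0 := hu'.mulV (hW _ hx) hu'.derivAt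
  have p0 := hu'.mulV (hA _ hx) hu'.derivAt
  have q1 := hu'.corr (hB' _ hx) ((hB' _ hx).dMat.add (hQ _ hx))
  have p1 := hu'.corr (hB _ hx) (hB _ hx).dMat
  have e : mulV (fluxK A B W B') u (deriv (deriv u))
      + quadV (fluxG A B W B' (dMat B) (dMat B' + Q)) u (deriv u) (deriv u) =ᶠ[𝓝 x]
      (mulV A u (corr B' (dMat B' + Q) u) + (quadV (dMat B) u (deriv u) (mulV W u (deriv u))
        + mulV B u (deriv (mulV W u (deriv u)))))
      - (mulV W u (corr B (dMat B) u) + (quadV (dMat B') u (deriv u) (mulV A u (deriv u))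
        + mulV B' u (deriv (mulV A u (deriv u))))) := by
    filter_upwards [hu'.eventually_mem hU hx] with y hy
    have d1 := (hs y).deriv_mulV (hW _ hy) (hs y).derivAt
    have d2 := (hs y).deriv_mulV (hA _ hy) (hs y).derivAt
    funext i
    simp only [mulV_apply, quadV_apply, corr, fluxK, fluxG, Pi.add_apply, Pi.sub_apply, d1, d2,
      Fin.sum_univ_two]
    ring
  have f1 := (hu'.mulV (hA _ hx) q1).hasDerivAt
  have f2 : SmoothAt (_ + _) x := (hu'.quadV (hB _ hx).dMat hu'.derivAt q0).add
    (hu'.mulV (hB _ hx) q0.derivAt)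
  have f3 := (hu'.mulV (hW _ hx) p1).hasDerivAt
  have f4 : SmoothAt (_ + _) x := (hu'.quadV (hB' _ hx).dMat hu'.derivAt p0).add
    (hu'.mulV (hB' _ hx) p0.derivAt)
  rw [e.deriv_eq, ((f1.add f2.hasDerivAt).sub (f3.add f4.hasDerivAt)).deriv, varV₂_eq (hB' _ hx) (hQ _ hx),
    varV_eq_deriv hcA hx hu' q1 (hA _ hx), varV_eq_deriv hcW hx hu' p1 (hW _ hx),
    varV₂_dMat_eq_deriv hu' q0 (hB _ hx), varV₂_dMat_eq_deriv hu' p0 (hB' _ hx)]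
  abel

end

/-! ### Extraction of the coefficients -/

/-- The curve with prescribed jet at `0`. -/
noncomputable def jetCurve (z a b c : Pt) : ℝ → Pt := fun y =>
  z + y • a + (y ^ 2 / 2) • b + (y ^ 3 / 6) • c

theorem jetCurve_contDiff (z a b c : Pt) : ContDiff ℝ ∞ (jetCurve z a b c) := by
  unfold jetCurve
  fun_prop

theorem jetCurve_deriv (z a b c : Pt) : deriv (jetCurve z a b c) = jetCurve a b c 0 := by
  funext y
  have h1 := ((((hasDerivAt_id y).smul_const a).const_add z).add
    (((hasDerivAt_pow 2 y).div_const 2).smul_const b)).add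
    (((hasDerivAt_pow 3 y).div_const 6).smul_const c)
  refine h1.deriv.trans ?_
  simp only [jetCurve]
  module

theorem jetCurve_zero (z a b c : Pt) : jetCurve z a b c 0 = z := by
  simp [jetCurve]

section
variable {A B W B' : MatField} {Q : QuadField} {U : Set Pt}

/-- The values of u_x, u_xx and u_xxx at a point can be prescribed freely by a cubic curve, so the
condition along curves becomes a polynomial identity in a, b, c. -/
theorem order_one_jet (hA : AnalyticOnNhd ℝ A U) (hB : AnalyticOnNhd ℝ B U)
    (hW : AnalyticOnNhd ℝ W U) (hB' : AnalyticOnNhd ℝ B' U) (hQ : AnalyticOnNhd ℝ Q U)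
    (hcA : CurlFree A U) (hcW : CurlFree W U) (hU : IsOpen U)
    (h : CommuteUpToFirstOrder U (firstOrder A B (dMat B)) (firstOrder W B' (dMat B' + Q)))
    {z : Pt} (hz : z ∈ U) (a b c : Pt) (i : Fin 2) :
    ∑ j, fluxK A B W B' z i j * c j
      + ∑ j, ∑ k, dMat (fluxK A B W B') z i j k * b j * a k
      + ∑ j, ∑ k, ∑ l, dQuad (fluxG A B W B' (dMat B) (dMat B' + Q)) z i j k l * a j * a k * a l
      + ∑ j, ∑ k, fluxG A B W B' (dMat B) (dMat B' + Q) z i j k * (b j * a k + a j * b k)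
      = ∑ j, ∑ k, ∑ l, dQuad Q z i j k l * a j * a k * ∑ m, A z l m * a m
      + ∑ j, ∑ k, Q z i j k * ((∑ m, ∑ n, dMat A z j m n * a m * a n + ∑ m, A z j m * b m) * a k
        + a j * (∑ m, ∑ n, dMat A z k m n * a m * a n + ∑ m, A z k m * b m)) := by
  have hu := jetCurve_contDiff z a b c
  set u := jetCurve z a b c with hudef
  have hu0 : u 0 = z := jetCurve_zero _ _ _ _
  have hx : u 0 ∈ U := by rwa [hu0]
  have hC' : AnalyticOnNhd ℝ (dMat B' + Q) U := fun w hw => (hB' w hw).dMat.add (hQ w hw)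
  have h1 := ((commute_firstOrder_iff hA hB (fun w hw => (hB w hw).dMat) hW hB' hC').1 h u hu 0
    hx).2
  rw [← sub_eq_zero, order_one_eq hA hB hW hB' hQ hcA hcW hU hu hx, sub_eq_zero] at h1
  have hs : SmoothAt u 0 := hu.contDiffAt
  have hK := (hA _ hx).fluxK (hB _ hx) (hW _ hx) (hB' _ hx)
  have hG := (hA _ hx).fluxG (hB _ hx) (hW _ hx) (hB' _ hx) (hB _ hx).dMat (hC' _ hx)
  rw [((hs.mulV hK hs.derivAt.derivAt).hasDerivAt.add
    (hs.quadV hG hs.derivAt hs.derivAt).hasDerivAt).deriv, hs.deriv_mulV hK hs.derivAt.derivAt,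
    hs.deriv_quadV hG hs.derivAt hs.derivAt] at h1
  have h2 := congrFun h1 i
  have d1 : deriv u 0 = a := by rw [hudef, jetCurve_deriv, jetCurve_zero]
  have d2 : deriv (deriv u) 0 = b := by
    rw [hudef, jetCurve_deriv, jetCurve_deriv, jetCurve_zero]
  have d3 : deriv (deriv (deriv u)) 0 = c := by
    rw [hudef, jetCurve_deriv, jetCurve_deriv, jetCurve_deriv, jetCurve_zero]
  have d4 := hs.deriv_mulV (hA _ hx) hs.derivAt
  simp only [Pi.add_apply, mulV_apply, quadV_apply, cubV_apply, d1, d2, d3, d4, hu0] at h2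
  simp only [Fin.sum_univ_two] at h2 ⊢
  linear_combination h2

/-- The necessary conditions for the existence of an extended symmetry. -/
theorem commute_necessary (hA : AnalyticOnNhd ℝ A U) (hB : AnalyticOnNhd ℝ B U)
    (hW : AnalyticOnNhd ℝ W U) (hB' : AnalyticOnNhd ℝ B' U) (hQ : AnalyticOnNhd ℝ Q U)
    (hcA : CurlFree A U) (hcW : CurlFree W U) (hU : IsOpen U)
    (h : CommuteUpToFirstOrder U (firstOrder A B (dMat B)) (firstOrder W B' (dMat B' + Q)))
    {z : Pt} (hz : z ∈ U) (i : Fin 2) :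
    (∀ j, fluxK A B W B' z i j = 0) ∧
    (∀ a b : Pt, ∑ j, ∑ k, fluxG A B W B' (dMat B) (dMat B' + Q) z i j k
        * (b j * a k + a j * b k)
      = ∑ j, ∑ k, Q z i j k * ((∑ m, A z j m * b m) * a k + a j * ∑ m, A z k m * b m)) ∧
    ∀ a : Pt,
      ∑ j, ∑ k, ∑ l, dQuad (fluxG A B W B' (dMat B) (dMat B' + Q)) z i j k l * a j * a k * a l
      = ∑ j, ∑ k, ∑ l, dQuad Q z i j k l * a j * a k * (∑ m, A z l m * a m)
      + ∑ j, ∑ k, Q z i j k * ((∑ m, ∑ n, dMat A z j m n * a m * a n) * a k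
        + a j * ∑ m, ∑ n, dMat A z k m n * a m * a n) := by
  have main := fun w (hw : w ∈ U) =>
    order_one_jet hA hB hW hB' hQ hcA hcW hU h hw
  have hK : ∀ w ∈ U, ∀ i j, fluxK A B W B' w i j = 0 := by
    intro w hw i j
    have := main w hw 0 0 (Pi.single j 1) i
    simpa [Pi.single_apply] using this
  -- The coefficient of u_xxx vanishes on the whole open set, so its derivatives drop out of the
  -- remaining identities.
  have hdK : ∀ i j k, dMat (fluxK A B W B') z i j k = 0 := by
    intro i j k
    have : (fun w => fluxK A B W B' w i j) =ᶠ[𝓝 z] fun _ => 0 := by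
      filter_upwards [hU.mem_nhds hz] with w hw
      exact hK w hw i j
    rw [dMat, pd_congr this]
    simp [pd]
  -- Setting b = 0 isolates the part cubic in u_x; subtracting it leaves the part linear in u_xx.
  have h3 := fun a => main z hz a 0 0 i
  have h2 := fun a b => main z hz a b 0 i
  simp only [hdK] at h2 h3
  refine ⟨hK z hz i, fun a b => ?_, fun a => ?_⟩
  · have e2 := h2 a b
    have e3 := h3 a
    simp only [Fin.sum_univ_two, Pi.zero_apply] at e2 e3 ⊢
    linear_combination e2 - e3
  · have e3 := h3 a
    simp only [Fin.sum_univ_two, Pi.zero_apply] at e3 ⊢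
    linear_combination e3
end

/-! ### The two basic flows -/

/-- The matrix of the flow `(1,0)`; its eigenvalues are `k u` and `(k - 1) u`. -/
noncomputable def mA (k : ℝ) : MatField := fun z =>
  ![![(2 * k - 1) * z 0, 1], ![k * (1 - k) * z 0 ^ 2, 0]]

/-- The matrix of the flow `(2,1)`. -/
noncomputable def mT (k : ℝ) : MatField := fun z =>
  ![![(2 * k - 1) * z 0 ^ 2 + z 1, z 0], ![k * (1 - k) * z 0 ^ 3, z 1]]

/-- The differential with given partial derivatives. -/
noncomputable def lin2 (a b : ℝ) : Pt →L[ℝ] ℝ :=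
  a • (ContinuousLinearMap.proj 0 : Pt →L[ℝ] ℝ) + b • (ContinuousLinearMap.proj 1 : Pt →L[ℝ] ℝ)

theorem pd_of_hasFDerivAt {f : Pt → ℝ} {z : Pt} {a b : ℝ} (h : HasFDerivAt f (lin2 a b) z)
    (k : Fin 2) : pd k f z = ![a, b] k := by
  have := pd_eq h
  fin_cases k
  · exact this.1
  · exact this.2

theorem dMat_mA (k : ℝ) (z : Pt) (i j l : Fin 2) : dMat (mA k) z i j l
    = ![![![2 * k - 1, 0], ![0, 0]], ![![2 * k * (1 - k) * z 0, 0], ![0, 0]]] i j l := by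
  have h0 := hasFDerivAt_coord 0 z
  fin_cases i <;> fin_cases j
  · refine pd_of_hasFDerivAt (f := fun w => (2 * k - 1) * w 0) ((h0.const_mul _).congr_fderiv ?_) l
    ext v; simp [lin2]
  · refine pd_of_hasFDerivAt (f := fun w => 1) ((hasFDerivAt_const _ z).congr_fderiv ?_) l
    ext v; simp [lin2]
  · refine pd_of_hasFDerivAt (f := fun w => k * (1 - k) * w 0 ^ 2)
      (((h0.pow 2).const_mul _).congr_fderiv ?_) l
    ext v; simp [lin2]; ring
  · refine pd_of_hasFDerivAt (f := fun w => 0) ((hasFDerivAt_const _ z).congr_fderiv ?_) l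
    ext v; simp [lin2]

theorem dMat_mT (k : ℝ) (z : Pt) (i j l : Fin 2) : dMat (mT k) z i j l
    = ![![![2 * (2 * k - 1) * z 0, 1], ![1, 0]], ![![3 * k * (1 - k) * z 0 ^ 2, 0], ![0, 1]]]
      i j l := by
  have h0 := hasFDerivAt_coord 0 z
  have h1 := hasFDerivAt_coord 1 z
  fin_cases i <;> fin_cases j
  · refine pd_of_hasFDerivAt (f := fun w => (2 * k - 1) * w 0 ^ 2 + w 1)
      ((((h0.pow 2).const_mul _).add h1).congr_fderiv ?_) l
    ext v; simp [lin2]; ring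
  · refine pd_of_hasFDerivAt (f := fun w => w 0) (h0.congr_fderiv ?_) l
    ext v; simp [lin2]
  · refine pd_of_hasFDerivAt (f := fun w => k * (1 - k) * w 0 ^ 3)
      (((h0.pow 3).const_mul _).congr_fderiv ?_) l
    ext v; simp [lin2]; ring
  · refine pd_of_hasFDerivAt (f := fun w => w 1) (h1.congr_fderiv ?_) l
    ext v; simp [lin2]

theorem analyticAt_coord (i : Fin 2) (z : Pt) : AnalyticAt ℝ (fun w : Pt => w i) z :=
  (ContinuousLinearMap.proj i : Pt →L[ℝ] ℝ).analyticAt z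

theorem mA_analyticAt (k : ℝ) (z : Pt) : AnalyticAt ℝ (mA k) z := by
  have h0 := analyticAt_coord 0 z
  refine analyticAt_mat fun i j => ?_
  fin_cases i <;> fin_cases j
  · exact analyticAt_const.fun_mul h0
  · exact analyticAt_const
  · exact analyticAt_const.fun_mul (h0.fun_pow 2)
  · exact analyticAt_const

theorem mT_analyticAt (k : ℝ) (z : Pt) : AnalyticAt ℝ (mT k) z := by
  have h0 := analyticAt_coord 0 z
  have h1 := analyticAt_coord 1 z
  refine analyticAt_mat fun i j => ?_
  fin_cases i <;> fin_cases j
  · exact (analyticAt_const.fun_mul (h0.fun_pow 2)).fun_add h1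
  · exact h0
  · exact analyticAt_const.fun_mul (h0.fun_pow 3)
  · exact h1

theorem mA_curlFree (k : ℝ) (U : Set Pt) : CurlFree (mA k) U := by
  intro z _ i j l
  simp only [dMat_mA]
  fin_cases i <;> fin_cases j <;> fin_cases l <;> rfl

theorem mT_curlFree (k : ℝ) (U : Set Pt) : CurlFree (mT k) U := by
  intro z _ i j l
  simp only [dMat_mT]
  fin_cases i <;> fin_cases j <;> fin_cases l <;> rfl

/-! ### The extended symmetries are conservation laws -/

section
variable {A B W B' : MatField} {Q : QuadField} {U : Set Pt}

theorem pd_mul_mat {f g : Pt → ℝ} {z : Pt} (hf : AnalyticAt ℝ f z) (hg : AnalyticAt ℝ g z)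
    (l : Fin 2) : pd l (fun w => f w * g w) z = pd l f z * g z + f z * pd l g z := by
  simp only [pd]
  rw [fderiv_fun_mul hf.differentiableAt hg.differentiableAt]
  simp only [add_apply, smul_apply, smul_eq_mul]
  ring

theorem pd_add {f g : Pt → ℝ} {z : Pt} (hf : AnalyticAt ℝ f z) (hg : AnalyticAt ℝ g z)
    (l : Fin 2) : pd l (fun w => f w + g w) z = pd l f z + pd l g z := by
  simp only [pd]
  rw [fderiv_fun_add hf.differentiableAt hg.differentiableAt]
  rfl

theorem pd_sub {f g : Pt → ℝ} {z : Pt} (hf : AnalyticAt ℝ f z) (hg : AnalyticAt ℝ g z)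
    (l : Fin 2) : pd l (fun w => f w - g w) z = pd l f z - pd l g z := by
  simp only [pd]
  rw [fderiv_fun_sub hf.differentiableAt hg.differentiableAt]
  rfl

/-- The quadratic remainder of an extended symmetry is degenerate along the eigenvectors. -/
theorem remainder_eigenvector (hA : AnalyticOnNhd ℝ A U) (hB : AnalyticOnNhd ℝ B U)
    (hW : AnalyticOnNhd ℝ W U) (hB' : AnalyticOnNhd ℝ B' U) (hQ : AnalyticOnNhd ℝ Q U)
    (hcA : CurlFree A U) (hcW : CurlFree W U) (hU : IsOpen U)
    (h : CommuteUpToFirstOrder U (firstOrder A B (dMat B)) (firstOrder W B' (dMat B' + Q)))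
    {z : Pt} (hz : z ∈ U) (i : Fin 2) {e : Pt} {lam : ℝ}
    (he : ∀ m, ∑ j, A z m j * e j = lam * e m) :
    ∑ j, ∑ k, (Q z i j k + Q z i k j) * (∑ m, ∑ n, dMat A z j m n * e m * e n) * e k = 0 := by
  have hG : ∀ w ∈ U, AnalyticAt ℝ (fluxG A B W B' (dMat B) (dMat B' + Q)) w := fun w hw =>
    (hA _ hw).fluxG (hB _ hw) (hW _ hw) (hB' _ hw) (hB _ hw).dMat ((hB' _ hw).dMat.add (hQ _ hw))
  have key := fun w (hw : w ∈ U) => commute_necessary hA hB hW hB' hQ hcA hcW hU h hw i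
  -- Polarisation of the u_xx-condition: the symmetrised G is the symmetrised Q composed with A. It
  -- holds throughout U and may therefore be differentiated.
  have hs : ∀ w ∈ U, ∀ j k, fluxG A B W B' (dMat B) (dMat B' + Q) w i j k
      + fluxG A B W B' (dMat B) (dMat B' + Q) w i k j
      = ((Q w i 0 k + Q w i k 0) * A w 0 j) + ((Q w i 1 k + Q w i k 1) * A w 1 j) := by
    intro w hw j k
    have := (key w hw).2.1 (Pi.single k 1) (Pi.single j 1)
    simp only [Fin.sum_univ_two] at this
    fin_cases j <;> fin_cases k <;> simp at this ⊢ <;> linear_combination this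
  have hd : ∀ j k l, dQuad (fluxG A B W B' (dMat B) (dMat B' + Q)) z i j k l
      + dQuad (fluxG A B W B' (dMat B) (dMat B' + Q)) z i k j l
      = ((dQuad Q z i 0 k l + dQuad Q z i k 0 l) * A z 0 j
          + (Q z i 0 k + Q z i k 0) * dMat A z 0 j l)
        + ((dQuad Q z i 1 k l + dQuad Q z i k 1 l) * A z 1 j
          + (Q z i 1 k + Q z i k 1) * dMat A z 1 j l) := by
    intro j k l
    have e1 : (fun w => fluxG A B W B' (dMat B) (dMat B' + Q) w i j k
      + fluxG A B W B' (dMat B) (dMat B' + Q) w i k j) =ᶠ[𝓝 z] fun w =>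
      ((Q w i 0 k + Q w i k 0) * A w 0 j) + ((Q w i 1 k + Q w i k 1) * A w 1 j) := by
      filter_upwards [hU.mem_nhds hz] with w hw
      exact hs w hw j k
    have e2 := pd_congr e1 l
    have q := fun a b => (hQ z hz).entry₃ i a b
    have a := fun m => (hA z hz).entry m j
    rw [pd_add ((hG z hz).entry₃ i j k) ((hG z hz).entry₃ i k j),
      pd_add (((q 0 k).fun_add (q k 0)).fun_mul (a 0)) (((q 1 k).fun_add (q k 1)).fun_mul (a 1)),
      pd_mul_mat ((q 0 k).fun_add (q k 0)) (a 0), pd_mul_mat ((q 1 k).fun_add (q k 1)) (a 1),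
      pd_add (q 0 k) (q k 0), pd_add (q 1 k) (q k 1)] at e2
    exact e2
  -- On an eigenvector the derivatives of Q enter the cubic condition and the differentiated
  -- relation `hd` only with the factor λ. Twice the former against the latter cancels them and
  -- leaves Q paired with ∂A(e,e) and e.
  have h3 := (key z hz).2.2 e
  simp only [he] at h3
  simp only [Fin.sum_univ_two] at h3 he ⊢
  have s000 := hd 0 0 0
  have s001 := hd 0 0 1
  have s010 := hd 0 1 0
  have s011 := hd 0 1 1
  have s100 := hd 1 0 0
  have s101 := hd 1 0 1
  have s110 := hd 1 1 0
  have s111 := hd 1 1 1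
  have he0 := he 0
  have he1 := he 1
  linear_combination e 0 * e 0 * e 0 * s000 + e 0 * e 0 * e 1 * s001 + e 0 * e 1 * e 0 * s010
    + e 0 * e 1 * e 1 * s011 + e 1 * e 0 * e 0 * s100 + e 1 * e 0 * e 1 * s101
    + e 1 * e 1 * e 0 * s110 + e 1 * e 1 * e 1 * s111 - 2 * h3
    + (2 * dQuad Q z i 0 0 0 * e 0 * e 0 + 2 * dQuad Q z i 0 0 1 * e 0 * e 1
      + (dQuad Q z i 0 1 0 + dQuad Q z i 1 0 0) * e 1 * e 0
      + (dQuad Q z i 0 1 1 + dQuad Q z i 1 0 1) * e 1 * e 1) * he0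
    + ((dQuad Q z i 0 1 0 + dQuad Q z i 1 0 0) * e 0 * e 0
      + (dQuad Q z i 0 1 1 + dQuad Q z i 1 0 1) * e 0 * e 1
      + 2 * dQuad Q z i 1 1 0 * e 1 * e 0 + 2 * dQuad Q z i 1 1 1 * e 1 * e 1) * he1
end

section
variable {A B W B' : MatField} {Q : QuadField} {U : Set Pt}

/-- The flux coefficient is symmetric in its two arguments, so the two mixed choices of a and b can
be compared. The outcome is that A is self-adjoint for the symmetrised remainder, hence distinct
eigenvectors are orthogonal for it. -/
theorem remainder_sym (hA : AnalyticOnNhd ℝ A U) (hB : AnalyticOnNhd ℝ B U)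
    (hW : AnalyticOnNhd ℝ W U) (hB' : AnalyticOnNhd ℝ B' U) (hQ : AnalyticOnNhd ℝ Q U)
    (hcA : CurlFree A U) (hcW : CurlFree W U) (hU : IsOpen U)
    (h : CommuteUpToFirstOrder U (firstOrder A B (dMat B)) (firstOrder W B' (dMat B' + Q)))
    {z : Pt} (hz : z ∈ U) (i : Fin 2) :
    2 * Q z i 0 0 * A z 0 1 + (Q z i 0 1 + Q z i 1 0) * A z 1 1
      = (Q z i 0 1 + Q z i 1 0) * A z 0 0 + 2 * Q z i 1 1 * A z 1 0 := by
  have key := (commute_necessary hA hB hW hB' hQ hcA hcW hU h hz i).2.1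
  have h1 := key (Pi.single 0 1) (Pi.single 1 1)
  have h2 := key (Pi.single 1 1) (Pi.single 0 1)
  simp [Fin.sum_univ_two] at h1 h2
  linear_combination h2 - h1

/-- Once the remainder vanishes, so does the flux of the bracket. -/
theorem flux_sym_zero (hA : AnalyticOnNhd ℝ A U) (hB : AnalyticOnNhd ℝ B U)
    (hW : AnalyticOnNhd ℝ W U) (hB' : AnalyticOnNhd ℝ B' U) (hQ : AnalyticOnNhd ℝ Q U)
    (hcA : CurlFree A U) (hcW : CurlFree W U) (hU : IsOpen U)
    (h : CommuteUpToFirstOrder U (firstOrder A B (dMat B)) (firstOrder W B' (dMat B' + Q)))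
    {z : Pt} (hz : z ∈ U) (hQ0 : ∀ i j k, Q z i j k + Q z i k j = 0) (i : Fin 2) (a : Pt) :
    ∑ j, ∑ k, fluxG A B W B' (dMat B) (dMat B') z i j k * a j * a k = 0 := by
  have h1 := (commute_necessary hA hB hW hB' hQ hcA hcW hU h hz i).2.1 a a
  simp only [fluxG, Pi.add_apply, Fin.sum_univ_two] at h1 ⊢
  have q1 : ∀ i, Q z i 0 0 = 0 := fun i => by linarith [hQ0 i 0 0]
  have q2 : ∀ i, Q z i 1 1 = 0 := fun i => by linarith [hQ0 i 1 1]
  have q3 : ∀ i, Q z i 1 0 = - Q z i 0 1 := fun i => by linarith [hQ0 i 0 1]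
  simp only [q1, q2, q3] at h1
  linear_combination h1 / 2

/-- The hypothesis `h` is self-adjointness. As e₁ - e₂ = u ∂_v and e₁, e₂ are orthogonal, the
brackets in `h1` and `h2`, which pair ∂_v with e₁ and e₂, amount to the values of the form on e₁ and
e₂ up to sign and the factor u. -/
theorem sym_form_zero {s00 s01 s11 u k c d : ℝ} (hu : u ≠ 0) (hc : c ≠ 0) (hd : d ≠ 0)
    (h : s00 = (2 * k - 1) * u * s01 + k * (1 - k) * u ^ 2 * s11)
    (h1 : c * (s01 + (1 - k) * u * s11) = 0) (h2 : d * (s01 - k * u * s11) = 0) :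
    s00 = 0 ∧ s01 = 0 ∧ s11 = 0 := by
  have e1 := (mul_eq_zero.1 h1).resolve_left hc
  have e2 := (mul_eq_zero.1 h2).resolve_left hd
  have e3 : u * s11 = 0 := by linear_combination e1 - e2
  have e4 := (mul_eq_zero.1 e3).resolve_left hu
  have e5 : s01 = 0 := by linear_combination e1 - (1 - k) * e3
  exact ⟨by rw [h, e4, e5]; ring, e5, e4⟩

theorem sym_zero_of {q : Fin 2 → Fin 2 → ℝ} (h : 2 * q 0 0 = 0 ∧ q 0 1 + q 1 0 = 0
    ∧ 2 * q 1 1 = 0) (j k : Fin 2) : q j k + q k j = 0 := by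
  obtain ⟨h1, h2, h3⟩ := h
  fin_cases j <;> fin_cases k
  · change q 0 0 + q 0 0 = 0; linarith
  · exact h2
  · change q 1 0 + q 0 1 = 0; linarith
  · change q 1 1 + q 1 1 = 0; linarith

/-- Genuine nonlinearity: the eigenvalues ku and (k-1)u have derivatives k and k-1 along their
eigenvectors. Up to sign and the factor u these are the constants passed to `sym_form_zero`. -/
theorem remainder_zero_mA {k : ℝ} (hk : k ≠ 0) (hk' : k ≠ 1) (hB : AnalyticOnNhd ℝ B U)
    (hW : AnalyticOnNhd ℝ W U) (hB' : AnalyticOnNhd ℝ B' U) (hQ : AnalyticOnNhd ℝ Q U)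
    (hcW : CurlFree W U) (hU : IsOpen U)
    (h : CommuteUpToFirstOrder U (firstOrder (mA k) B (dMat B))
      (firstOrder W B' (dMat B' + Q)))
    {z : Pt} (hz : z ∈ U) (hz0 : z 0 ≠ 0) (i j l : Fin 2) : Q z i j l + Q z i l j = 0 := by
  have hA : AnalyticOnNhd ℝ (mA k) U := fun w _ => mA_analyticAt k w
  have hcA := mA_curlFree k U
  have e0 := remainder_sym hA hB hW hB' hQ hcA hcW hU h hz i
  have e1 := remainder_eigenvector hA hB hW hB' hQ hcA hcW hU h hz i
    (e := ![1, (1 - k) * z 0]) (lam := k * z 0) (by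
      intro m; fin_cases m <;> simp [mA] <;> ring)
  have e2 := remainder_eigenvector hA hB hW hB' hQ hcA hcW hU h hz i
    (e := ![1, -k * z 0]) (lam := (k - 1) * z 0) (by
      intro m; fin_cases m <;> simp [mA] <;> ring)
  simp only [dMat_mA, Fin.sum_univ_two] at e1 e2
  simp [mA] at e0 e1 e2
  refine sym_zero_of (q := Q z i) (sym_form_zero (u := z 0) (k := k) (c := k * z 0)
    (d := (1 - k) * z 0) hz0 (mul_ne_zero hk hz0)
    (mul_ne_zero (sub_ne_zero.2 hk'.symm) hz0) ?_ ?_ ?_) j l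
  · linear_combination e0
  · linear_combination e1 - (2 * k - 1) * e0
  · linear_combination e2 - (2 * k - 1) * e0

/-- The eigenvalues v + ku² and v + (k-1)u² have derivatives (k+1)u and (k-2)u along their
eigenvectors. These do not vanish for k = 0, 1 off u = 0, so the flow (2,1) is usable in the
exceptional cases, where one eigenvalue of `mA` is linearly degenerate. -/
theorem remainder_zero_mT {k : ℝ} (hk : k + 1 ≠ 0) (hk' : k - 2 ≠ 0) (hB : AnalyticOnNhd ℝ B U)
    (hW : AnalyticOnNhd ℝ W U) (hB' : AnalyticOnNhd ℝ B' U) (hQ : AnalyticOnNhd ℝ Q U)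
    (hcW : CurlFree W U) (hU : IsOpen U)
    (h : CommuteUpToFirstOrder U (firstOrder (mT k) B (dMat B))
      (firstOrder W B' (dMat B' + Q)))
    {z : Pt} (hz : z ∈ U) (hz0 : z 0 ≠ 0) (i j l : Fin 2) : Q z i j l + Q z i l j = 0 := by
  have hA : AnalyticOnNhd ℝ (mT k) U := fun w _ => mT_analyticAt k w
  have hcA := mT_curlFree k U
  have e0 := remainder_sym hA hB hW hB' hQ hcA hcW hU h hz i
  have e1 := remainder_eigenvector hA hB hW hB' hQ hcA hcW hU h hz i
    (e := ![1, (1 - k) * z 0]) (lam := z 1 + k * z 0 ^ 2) (by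
      intro m; fin_cases m <;> simp [mT] <;> ring)
  have e2 := remainder_eigenvector hA hB hW hB' hQ hcA hcW hU h hz i
    (e := ![1, -k * z 0]) (lam := z 1 + (k - 1) * z 0 ^ 2) (by
      intro m; fin_cases m <;> simp [mT] <;> ring)
  simp only [dMat_mT, Fin.sum_univ_two] at e1 e2
  simp [mT] at e0 e1 e2
  have e0' : 2 * Q z i 0 0 = (2 * k - 1) * z 0 * (Q z i 0 1 + Q z i 1 0)
      + k * (1 - k) * z 0 ^ 2 * (2 * Q z i 1 1) := by
    refine mul_left_cancel₀ hz0 ?_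
    linear_combination e0
  have hc : (k + 1) * z 0 ^ 2 ≠ 0 := mul_ne_zero hk (pow_ne_zero 2 hz0)
  have hd : (k - 2) * z 0 ^ 2 ≠ 0 := mul_ne_zero hk' (pow_ne_zero 2 hz0)
  refine sym_zero_of (q := Q z i) (sym_form_zero (u := z 0) (k := k) hz0 hc hd e0' ?_ ?_) j l
  · linear_combination e1 - 2 * k * z 0 * e0'
  · linear_combination -e2 + 2 * (k - 1) * z 0 * e0'
end

/-! ### The first integrability conditions for the pair of basic flows -/

theorem fluxK_swap (A B W B' : MatField) (z : Pt) (i j : Fin 2) :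
    fluxK W B' A B z i j = -fluxK A B W B' z i j := by
  simp only [fluxK, Fin.sum_univ_two]
  ring

theorem fluxG_swap (A B W B' : MatField) (C C' : QuadField) (z : Pt) (i j k : Fin 2) :
    fluxG W B' A B C' C z i j k = -fluxG A B W B' C C' z i j k := by
  simp only [fluxG, Fin.sum_univ_two]
  ring

/-- A pair of deformations of the two basic flows that satisfies the integrability conditions. -/
structure IsPair (k : ℝ) (B B' : MatField) (U : Set Pt) : Prop where
  analytic : AnalyticOnNhd ℝ B U
  analytic' : AnalyticOnNhd ℝ B' U
  fluxK : ∀ z ∈ U, ∀ i j, fluxK (mA k) B (mT k) B' z i j = 0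
  fluxG : ∀ z ∈ U, ∀ i, ∀ a : Pt,
    ∑ j, ∑ l, fluxG (mA k) B (mT k) B' (dMat B) (dMat B') z i j l * a j * a l = 0

namespace IsPair
variable {k : ℝ} {B B' : MatField} {U : Set Pt}

/-- Since `mT k` = v + u `mA k`, the condition on `fluxK` says that B' - uB commutes with `mA k`. It
is therefore γ + δ `mA k`, with γ and δ read off from its entries (1,1) and (0,1). -/
theorem entry_eq (h : IsPair k B B' U) {z : Pt} (hz : z ∈ U) :
    B' z 0 0 = z 0 * B z 0 0 + (B' z 1 1 - z 0 * B z 1 1)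
        + (2 * k - 1) * (z 0 * (B' z 0 1 - z 0 * B z 0 1)) ∧
    B' z 1 0 = z 0 * B z 1 0 + k * (1 - k) * (z 0 * (z 0 * (B' z 0 1 - z 0 * B z 0 1))) := by
  have h00 := h.fluxK z hz 0 0
  have h01 := h.fluxK z hz 0 1
  simp [_root_.fluxK, mA, mT, Fin.sum_univ_two] at h00 h01
  constructor
  · linear_combination -h01
  · linear_combination h00

theorem pd_entry_eq (h : IsPair k B B' U) (hU : IsOpen U) {z : Pt} (hz : z ∈ U) :
    (∀ l, dMat B' z 0 0 l = (![1, 0] l * B z 0 0 + z 0 * dMat B z 0 0 l)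
      + (dMat B' z 1 1 l - (![1, 0] l * B z 1 1 + z 0 * dMat B z 1 1 l))
      + (2 * k - 1) * (![1, 0] l * (B' z 0 1 - z 0 * B z 0 1)
        + z 0 * (dMat B' z 0 1 l - (![1, 0] l * B z 0 1 + z 0 * dMat B z 0 1 l)))) ∧
    (∀ l, dMat B' z 1 0 l = (![1, 0] l * B z 1 0 + z 0 * dMat B z 1 0 l)
      + k * (1 - k) * (![1, 0] l * (z 0 * (B' z 0 1 - z 0 * B z 0 1))
        + z 0 * (![1, 0] l * (B' z 0 1 - z 0 * B z 0 1)
        + z 0 * (dMat B' z 0 1 l - (![1, 0] l * B z 0 1 + z 0 * dMat B z 0 1 l))))) := by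
  have c0 := analyticAt_coord 0 z
  have b := fun i j => (h.analytic z hz).entry i j
  have b' := fun i j => (h.analytic' z hz).entry i j
  have hp : ∀ l, pd l (fun w => w 0) z = ![1, 0] l := fun l =>
    pd_of_hasFDerivAt ((hasFDerivAt_coord 0 z).congr_fderiv (by ext v; simp [lin2])) l
  have hc : ∀ (f : Pt → ℝ), AnalyticAt ℝ f z → ∀ l,
      pd l (fun w => w 0 * f w) z = ![1, 0] l * f z + z 0 * pd l f z := by
    intro f hf l
    rw [pd_mul_mat c0 hf, hp]
  have hcc : ∀ (r : ℝ) (f : Pt → ℝ), AnalyticAt ℝ f z → ∀ l,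
      pd l (fun w => r * f w) z = r * pd l f z := by
    intro r f hf l
    rw [pd_mul_mat analyticAt_const hf]
    simp [pd]
  have d01 := (b' 0 1).fun_sub (c0.fun_mul (b 0 1))
  constructor <;> intro l
  · have e : (fun w => B' w 0 0) =ᶠ[𝓝 z] fun w => w 0 * B w 0 0 + (B' w 1 1 - w 0 * B w 1 1)
        + (2 * k - 1) * (w 0 * (B' w 0 1 - w 0 * B w 0 1)) := by
      filter_upwards [hU.mem_nhds hz] with w hw
      exact (h.entry_eq hw).1
    refine (pd_congr e l).trans ?_
    rw [pd_add ((c0.fun_mul (b 0 0)).fun_add ((b' 1 1).fun_sub (c0.fun_mul (b 1 1))))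
      (analyticAt_const.fun_mul (c0.fun_mul d01)),
      pd_add (c0.fun_mul (b 0 0)) ((b' 1 1).fun_sub (c0.fun_mul (b 1 1))),
      pd_sub (b' 1 1) (c0.fun_mul (b 1 1)), hcc _ _ (c0.fun_mul d01), hc _ d01,
      pd_sub (b' 0 1) (c0.fun_mul (b 0 1)), hc _ (b 0 0), hc _ (b 1 1), hc _ (b 0 1)]
    rfl
  · have e : (fun w => B' w 1 0) =ᶠ[𝓝 z] fun w => w 0 * B w 1 0
        + k * (1 - k) * (w 0 * (w 0 * (B' w 0 1 - w 0 * B w 0 1))) := by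
      filter_upwards [hU.mem_nhds hz] with w hw
      exact (h.entry_eq hw).2
    refine (pd_congr e l).trans ?_
    rw [pd_add (c0.fun_mul (b 1 0)) (analyticAt_const.fun_mul (c0.fun_mul (c0.fun_mul d01))),
      hcc _ _ (c0.fun_mul (c0.fun_mul d01)), hc _ (c0.fun_mul d01), hc _ d01,
      pd_sub (b' 0 1) (c0.fun_mul (b 0 1)), hc _ (b 1 0), hc _ (b 0 1)]
    rfl

/-- The conditions along the first eigenvector. -/
theorem eigenvector_one (h : IsPair k B B' U) (hU : IsOpen U) {z : Pt} (hz : z ∈ U) :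
    k * z 0 * (B z 0 0 + (1 - k) * z 0 * B z 0 1) + (B z 1 0 + (1 - k) * z 0 * B z 1 1)
      = ((B' z 1 1 - z 0 * B z 1 1) + k * z 0 * (B' z 0 1 - z 0 * B z 0 1)) * (2 * k - 1) ∧
    k * (1 - k) * z 0 ^ 2 * (B z 0 0 + (1 - k) * z 0 * B z 0 1)
        + (1 - k) * z 0 * (B z 1 0 + (1 - k) * z 0 * B z 1 1)
      = ((B' z 1 1 - z 0 * B z 1 1) + k * z 0 * (B' z 0 1 - z 0 * B z 0 1))
        * (2 * k * (1 - k) * z 0) := by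
  -- The argument is the eigenvector e for ku. Together the two components say ℓ(Be) e = μ ∂A(e,e),
  -- where ℓ = (ku, 1) is a left eigenvector and μ = γ + kuδ is the eigenvalue of B' - uB.
  have e0 := h.fluxG z hz 0 ![1, (1 - k) * z 0]
  have e1 := h.fluxG z hz 1 ![1, (1 - k) * z 0]
  obtain ⟨d0, d1⟩ := h.pd_entry_eq hU hz
  obtain ⟨b0, b1⟩ := h.entry_eq hz
  simp only [_root_.fluxG, dMat_mA, dMat_mT, Fin.sum_univ_two, d0, d1] at e0 e1
  simp [mA, mT] at e0 e1
  rw [b0] at e0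
  rw [b1] at e1
  constructor
  · linear_combination e0
  · linear_combination e1

/-- The conditions along the second eigenvector. -/
theorem eigenvector_two (h : IsPair k B B' U) (hU : IsOpen U) {z : Pt} (hz : z ∈ U) :
    (k - 1) * z 0 * (B z 0 0 - k * z 0 * B z 0 1) + (B z 1 0 - k * z 0 * B z 1 1)
      = ((B' z 1 1 - z 0 * B z 1 1) + (k - 1) * z 0 * (B' z 0 1 - z 0 * B z 0 1)) * (2 * k - 1) ∧
    k * (1 - k) * z 0 ^ 2 * (B z 0 0 - k * z 0 * B z 0 1)
        - k * z 0 * (B z 1 0 - k * z 0 * B z 1 1)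
      = ((B' z 1 1 - z 0 * B z 1 1) + (k - 1) * z 0 * (B' z 0 1 - z 0 * B z 0 1))
        * (2 * k * (1 - k) * z 0) := by
  -- The same for the eigenvalue (k-1)u, with ℓ = ((k-1)u, 1) and μ = γ + (k-1)uδ.
  have e0 := h.fluxG z hz 0 ![1, -k * z 0]
  have e1 := h.fluxG z hz 1 ![1, -k * z 0]
  obtain ⟨d0, d1⟩ := h.pd_entry_eq hU hz
  obtain ⟨b0, b1⟩ := h.entry_eq hz
  simp only [_root_.fluxG, dMat_mA, dMat_mT, Fin.sum_univ_two, d0, d1] at e0 e1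
  simp [mA, mT] at e0 e1
  rw [b0] at e0
  rw [b1] at e1
  constructor
  · linear_combination e0
  · linear_combination e1

/-- The condition along pairs of different eigenvectors. -/
theorem mixed (h : IsPair k B B' U) (hU : IsOpen U) {z : Pt} (hz : z ∈ U) (hz0 : z 0 ≠ 0)
    {g d : Fin 2 → ℝ} (hg : ∀ l, g l = dMat B' z 1 1 l - (![1, 0] l * B z 1 1 + z 0 * dMat B z 1 1 l))
    (hd : ∀ l, d l = dMat B' z 0 1 l - (![1, 0] l * B z 0 1 + z 0 * dMat B z 0 1 l)) :
    g 0 - k * z 0 * g 1 + k * z 0 * (d 0 - k * z 0 * d 1) = 0 ∧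
    g 0 + (1 - k) * z 0 * g 1 + (k - 1) * z 0 * (d 0 + (1 - k) * z 0 * d 1) = 0 := by
  -- The argument is e₁ + e₂; removing the conditions along e₁ and e₂ leaves the cross term. The
  -- resulting pair of equations expresses that γ + δ `mA k` has closed rows, by closedness of `mA
  -- k`.
  have e0 := h.fluxG z hz 0 ![2, (1 - 2 * k) * z 0]
  have e1 := h.fluxG z hz 1 ![2, (1 - 2 * k) * z 0]
  have f1 := h.eigenvector_one hU hz
  have f2 := h.eigenvector_two hU hz
  obtain ⟨d0, d1⟩ := h.pd_entry_eq hU hz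
  obtain ⟨b0, b1⟩ := h.entry_eq hz
  simp only [← hg, ← hd] at d0 d1
  have d2 : ∀ l, dMat B' z 1 1 l = g l + (![1, 0] l * B z 1 1 + z 0 * dMat B z 1 1 l) := by
    intro l; rw [hg]; ring
  have d3 : ∀ l, dMat B' z 0 1 l = d l + (![1, 0] l * B z 0 1 + z 0 * dMat B z 0 1 l) := by
    intro l; rw [hd]; ring
  simp only [_root_.fluxG, dMat_mA, dMat_mT, Fin.sum_univ_two, d0, d1, d2, d3] at e0 e1
  simp [mA, mT] at e0 e1
  rw [b0] at e0
  rw [b1] at e1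
  have r0 : z 0 * (g 0 - k * z 0 * g 1 + k * z 0 * (d 0 - k * z 0 * d 1))
      - z 0 * (g 0 + (1 - k) * z 0 * g 1 + (k - 1) * z 0 * (d 0 + (1 - k) * z 0 * d 1)) = 0 := by
    linear_combination e0 - 2 * f1.1 - 2 * f2.1
  have r1 : (1 - k) * z 0 ^ 2 * (g 0 - k * z 0 * g 1 + k * z 0 * (d 0 - k * z 0 * d 1))
      + k * z 0 ^ 2 * (g 0 + (1 - k) * z 0 * g 1
        + (k - 1) * z 0 * (d 0 + (1 - k) * z 0 * d 1)) = 0 := by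
    linear_combination e1 - 2 * f1.2 - 2 * f2.2
  have hz2 : z 0 ^ 2 ≠ 0 := pow_ne_zero 2 hz0
  constructor
  · refine (mul_eq_zero.1 ?_).resolve_left hz2
    linear_combination r1 + k * z 0 * r0
  · refine (mul_eq_zero.1 ?_).resolve_left hz2
    linear_combination r1 - (1 - k) * z 0 * r0

/-- One side of the relation along e₁ is parallel to e₁, while ∂A(e₁,e₁) = (2k-1, 2k(1-k)u) is not
unless (1-k)u = 0. The combination used eliminates B and leaves (1-k)u times the eigenvalue. -/
theorem eigenvalue_one (h : IsPair k B B' U) (hU : IsOpen U) {z : Pt} (hz : z ∈ U)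
    (hz0 : z 0 ≠ 0) (hk : k ≠ 1) :
    (B' z 1 1 - z 0 * B z 1 1) + k * z 0 * (B' z 0 1 - z 0 * B z 0 1) = 0 := by
  obtain ⟨r0, r1⟩ := h.eigenvector_one hU hz
  refine (mul_eq_zero.1 ?_).resolve_right (mul_ne_zero (sub_ne_zero.2 hk.symm) hz0)
  linear_combination (1 - k) * z 0 * r0 - r1

theorem eigenvalue_two (h : IsPair k B B' U) (hU : IsOpen U) {z : Pt} (hz : z ∈ U)
    (hz0 : z 0 ≠ 0) (hk : k ≠ 0) :
    (B' z 1 1 - z 0 * B z 1 1) + (k - 1) * z 0 * (B' z 0 1 - z 0 * B z 0 1) = 0 := by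
  obtain ⟨r0, r1⟩ := h.eigenvector_two hU hz
  refine (mul_eq_zero.1 ?_).resolve_right (mul_ne_zero hk hz0)
  linear_combination -k * z 0 * r0 - r1

/-- In the generic case the deformation lies in the range of the commutator with `mA`. -/
theorem traces_zero (h : IsPair k B B' U) (hU : IsOpen U) {z : Pt} (hz : z ∈ U)
    (hz0 : z 0 ≠ 0) (hk : k ≠ 0) (hk' : k ≠ 1) :
    B z 0 0 + B z 1 1 = 0 ∧
      (2 * k - 1) * z 0 * B z 0 0 + B z 1 0 + k * (1 - k) * z 0 ^ 2 * B z 0 1 = 0 := by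
  have r1 := (h.eigenvector_one hU hz).1
  have r2 := (h.eigenvector_two hU hz).1
  rw [h.eigenvalue_one hU hz hz0 hk'] at r1
  rw [h.eigenvalue_two hU hz hz0 hk] at r2
  -- With both eigenvalues of B' - uB zero, B has zero diagonal in the eigenbasis; this is restated
  -- as vanishing of tr B and of tr (`mA k` B).
  have t : B z 0 0 + B z 1 1 = 0 := by
    refine (mul_eq_zero.1 ?_).resolve_left hz0
    linear_combination r1 - r2
  exact ⟨t, by linear_combination r1 - (1 - k) * z 0 * t⟩
end IsPair

/-! ### Double power series and a linear Cauchy problem -/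

/-- The homogeneous part of degree `n` of the double power series with coefficients `a`. -/
noncomputable def homPart (a : ℕ → ℕ → ℝ) (n : ℕ) (z : Pt) : ℝ :=
  ∑ m ∈ Finset.HasAntidiagonal.antidiagonal n, a m.1 m.2 * z 0 ^ m.1 * z 1 ^ m.2

/-- The sum of a double power series. -/
noncomputable def dSum (a : ℕ → ℕ → ℝ) (z : Pt) : ℝ := ∑' n, homPart a n z

/-- Geometric growth of the coefficients. -/
def GeoBound (C ρ : ℝ) (a : ℕ → ℕ → ℝ) : Prop := ∀ i j, |a i j| ≤ C * ρ ^ (i + j)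

/-- The coefficients of the partial derivatives. -/
def coeffD (k : Fin 2) (a : ℕ → ℕ → ℝ) : ℕ → ℕ → ℝ := fun i j =>
  ![(i + 1) * a (i + 1) j, (j + 1) * a i (j + 1)] k

/-- The coefficients of the product with the first variable. -/
def coeffX (a : ℕ → ℕ → ℝ) : ℕ → ℕ → ℝ
  | 0, _ => 0
  | i + 1, j => a i j

theorem coord_abs_le (z : Pt) (i : Fin 2) : |z i| ≤ ‖z‖ := norm_le_pi_norm z i

theorem succ_le_two_pow (n : ℕ) : (n + 1 : ℝ) ≤ 2 ^ n := by
  exact_mod_cast Nat.lt_two_pow_self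

section
variable {a b : ℕ → ℕ → ℝ} {C ρ : ℝ}

/-- There are n + 1 monomials of degree n; the bound n + 1 ≤ 2ⁿ absorbs their number into the
doubled rate 2ρ. -/
theorem homPart_le (h : GeoBound C ρ a) (hC : 0 ≤ C) (hρ : 0 < ρ) (n : ℕ) (z : Pt) :
    |homPart a n z| ≤ C * (2 * ρ * ‖z‖) ^ n := by
  have : |homPart a n z| ≤ ∑ m ∈ Finset.HasAntidiagonal.antidiagonal n, C * ρ ^ n * ‖z‖ ^ n := by
    refine (Finset.abs_sum_le_sum_abs _ _).trans (Finset.sum_le_sum fun m hm => ?_)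
    have hm' : m.1 + m.2 = n := Finset.HasAntidiagonal.mem_antidiagonal.1 hm
    rw [abs_mul, abs_mul, abs_pow, abs_pow]
    have h1 := h m.1 m.2
    rw [hm'] at h1
    have h2 : |z 0| ^ m.1 * |z 1| ^ m.2 ≤ ‖z‖ ^ n := by
      rw [← hm', pow_add]
      gcongr <;> exact coord_abs_le z _
    rw [mul_assoc]
    gcongr
  refine this.trans ?_
  rw [Finset.sum_const, Finset.Nat.card_antidiagonal, nsmul_eq_mul, mul_pow, mul_pow]
  have h3 := succ_le_two_pow n
  have h4 : 0 ≤ C * ρ ^ n * ‖z‖ ^ n := by positivity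
  push_cast
  nlinarith

theorem homPart_le_half (h : GeoBound C ρ a) (hC : 0 ≤ C) (hρ : 0 < ρ) (n : ℕ) {z : Pt}
    (hz : ‖z‖ ≤ (4 * ρ)⁻¹) : |homPart a n z| ≤ C * (1 / 2) ^ n := by
  refine (homPart_le h hC hρ n z).trans ?_
  have : 2 * ρ * ‖z‖ ≤ 1 / 2 := by
    calc 2 * ρ * ‖z‖ ≤ 2 * ρ * (4 * ρ)⁻¹ := by gcongr
      _ = 1 / 2 := by field_simp; norm_num
  gcongr

theorem summable_homPart (h : GeoBound C ρ a) (hC : 0 ≤ C) (hρ : 0 < ρ) {z : Pt}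
    (hz : ‖z‖ ≤ (4 * ρ)⁻¹) : Summable fun n => homPart a n z :=
  Summable.of_norm_bounded ((summable_geometric_two).mul_left C)
    fun n => homPart_le_half h hC hρ n hz

/-- The index factor produced by differentiation is at most 2ⁿ, so doubling the rate pays for it. -/
theorem GeoBound.deriv (h : GeoBound C ρ a) (k : Fin 2) :
    GeoBound (C * ρ) (2 * ρ) (coeffD k a) := by
  have key : ∀ m n : ℕ, m ≤ n → ∀ r : ℝ, |r| ≤ C * ρ ^ (n + 1) →
      |((m : ℝ) + 1) * r| ≤ C * ρ * (2 * ρ) ^ n := by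
    intro m n hmn r hr
    rw [abs_mul, abs_of_nonneg (by positivity : (0 : ℝ) ≤ m + 1)]
    have h1 : (m : ℝ) + 1 ≤ 2 ^ n := by
      refine le_trans ?_ (succ_le_two_pow n)
      have : (m : ℝ) ≤ n := by exact_mod_cast hmn
      linarith
    calc ((m : ℝ) + 1) * |r| ≤ 2 ^ n * (C * ρ ^ (n + 1)) := by gcongr
      _ = _ := by rw [mul_pow]; ring
  intro i j
  fin_cases k
  · refine key i (i + j) (by omega) _ ?_
    rw [show i + j + 1 = i + 1 + j by ring]
    exact h _ _
  · exact key j (i + j) (by omega) _ (h i (j + 1))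

theorem hasFDerivAt_homPart (a : ℕ → ℕ → ℝ) (n : ℕ) (z : Pt) :
    HasFDerivAt (homPart a (n + 1)) (homPart (coeffD 0 a) n z
      • (ContinuousLinearMap.proj 0 : Pt →L[ℝ] ℝ) + homPart (coeffD 1 a) n z
      • (ContinuousLinearMap.proj 1 : Pt →L[ℝ] ℝ)) z := by
  have h0 := hasFDerivAt_coord 0 z
  have h1 := hasFDerivAt_coord 1 z
  have := HasFDerivAt.fun_sum (u := Finset.HasAntidiagonal.antidiagonal (n + 1)) fun m _ =>
    ((h0.pow m.1).const_mul (a m.1 m.2)).mul (h1.pow m.2)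
  refine this.congr_fderiv ?_
  ext v
  simp only [sum_apply, add_apply, smul_apply, ContinuousLinearMap.proj_apply, smul_eq_mul,
    Finset.sum_add_distrib]
  rw [Finset.Nat.sum_antidiagonal_succ', Finset.Nat.sum_antidiagonal_succ]
  simp only [homPart, coeffD, Finset.sum_mul]
  rw [add_comm]
  simp
  congr 1
  · refine Finset.sum_congr rfl fun m _ => ?_
    ring
  · refine Finset.sum_congr rfl fun m _ => ?_
    ring

theorem norm_proj_combination_le (α β : ℝ) :
    ‖α • (ContinuousLinearMap.proj 0 : Pt →L[ℝ] ℝ) + β • (ContinuousLinearMap.proj 1 : Pt →L[ℝ] ℝ)‖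
      ≤ |α| + |β| := by
  refine ContinuousLinearMap.opNorm_le_bound _ (by positivity) fun v => ?_
  simp only [add_apply, smul_apply, ContinuousLinearMap.proj_apply, smul_eq_mul, Real.norm_eq_abs]
  refine (abs_add_le _ _).trans ?_
  rw [abs_mul, abs_mul, add_mul]
  gcongr <;> exact coord_abs_le v _

theorem GeoBound.norm_fderiv_le (h : GeoBound C ρ a) (hC : 0 ≤ C) (hρ : 0 < ρ) (n : ℕ) {y : Pt}
    (hy : ‖y‖ ≤ (4 * (2 * ρ))⁻¹) :
    ‖homPart (coeffD 0 a) n y • (ContinuousLinearMap.proj 0 : Pt →L[ℝ] ℝ)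
        + homPart (coeffD 1 a) n y • (ContinuousLinearMap.proj 1 : Pt →L[ℝ] ℝ)‖
      ≤ 2 * (C * ρ) * (1 / 2 : ℝ) ^ n := by
  have b0 := homPart_le_half (h.deriv 0) (by positivity) (by positivity) n hy
  have b1 := homPart_le_half (h.deriv 1) (by positivity) (by positivity) n hy
  refine (norm_proj_combination_le _ _).trans ((add_le_add b0 b1).trans (le_of_eq ?_))
  ring

/-- Termwise differentiation. The derivative coefficients grow at rate 2ρ, so on the ball of radius
1/(4·2ρ) = 1/(8ρ) the differentiated terms are dominated by a geometric series of ratio 1/2. -/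
theorem hasFDerivAt_dSum (h : GeoBound C ρ a) (hC : 0 ≤ C) (hρ : 0 < ρ) {z : Pt}
    (hz : ‖z‖ < (8 * ρ)⁻¹) :
    HasFDerivAt (dSum a) (dSum (coeffD 0 a) z
      • (ContinuousLinearMap.proj 0 : Pt →L[ℝ] ℝ) + dSum (coeffD 1 a) z
      • (ContinuousLinearMap.proj 1 : Pt →L[ℝ] ℝ)) z := by
  have hρ2 : 0 < 2 * ρ := by positivity
  have hCρ : 0 ≤ C * ρ := by positivity
  have hle : ∀ y : Pt, ‖y‖ < (8 * ρ)⁻¹ → ‖y‖ ≤ (4 * (2 * ρ))⁻¹ := fun y hy => by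
    rw [show 4 * (2 * ρ) = 8 * ρ by ring]; exact hy.le
  have hle' : ∀ y : Pt, ‖y‖ < (8 * ρ)⁻¹ → ‖y‖ ≤ (4 * ρ)⁻¹ := fun y hy =>
    hy.le.trans (by gcongr; norm_num)
  have hd := fun k => h.deriv k
  have hmem : ∀ y : Pt, y ∈ Metric.ball (0 : Pt) (8 * ρ)⁻¹ ↔ ‖y‖ < (8 * ρ)⁻¹ := fun y => by simp
  have hb : ∀ (n : ℕ) (y : Pt), y ∈ Metric.ball (0 : Pt) (8 * ρ)⁻¹ → _ := fun n y hy =>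
    h.norm_fderiv_le hC hρ n (hle y ((hmem y).1 hy))
  have h0z : (0 : Pt) ∈ Metric.ball (0 : Pt) (8 * ρ)⁻¹ := Metric.mem_ball_self (by positivity)
  have hs0 : Summable fun n => homPart a (n + 1) 0 :=
    (summable_nat_add_iff (f := fun n => homPart a n 0) 1).2
      (summable_homPart h hC hρ (hle' 0 ((hmem 0).1 h0z)))
  have hu : Summable fun n : ℕ => 2 * (C * ρ) * (1 / 2 : ℝ) ^ n :=
    summable_geometric_two.mul_left _
  have key := hasFDerivAt_tsum_of_isPreconnected hu Metric.isOpen_ball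
    (convex_ball (0 : Pt) (8 * ρ)⁻¹).isPreconnected
    (fun n y _ => hasFDerivAt_homPart a n y) hb h0z hs0 ((hmem z).2 hz)
  have e : dSum a =ᶠ[𝓝 z] fun y => a 0 0 + ∑' n, homPart a (n + 1) y := by
    filter_upwards [Metric.isOpen_ball.mem_nhds ((hmem z).2 hz)] with y hy
    have := (summable_homPart h hC hρ (hle' y ((hmem y).1 hy))).tsum_eq_zero_add
    rw [dSum, this]
    simp [homPart]
  have s := fun k => summable_homPart (hd k) hCρ hρ2 (hle z hz)
  refine ((key.const_add (a 0 0)).congr_of_eventuallyEq e).congr_fderiv ?_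
  rw [((s 0).smul_const _).tsum_add ((s 1).smul_const _), (s 0).tsum_smul_const,
    (s 1).tsum_smul_const]
  rfl

/-- The homogeneous part as a multilinear map. -/
noncomputable def homForm (a : ℕ → ℕ → ℝ) : FormalMultilinearSeries ℝ Pt ℝ := fun n =>
  ∑ m ∈ Finset.HasAntidiagonal.antidiagonal n, a m.1 m.2 •
    (ContinuousMultilinearMap.mkPiAlgebra ℝ (Fin n) ℝ).compContinuousLinearMap
      fun i => (ContinuousLinearMap.proj (if i.1 < m.1 then 0 else 1) : Pt →L[ℝ] ℝ)

theorem homForm_apply (a : ℕ → ℕ → ℝ) (n : ℕ) (z : Pt) :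
    homForm a n (fun _ => z) = homPart a n z := by
  simp only [homForm, homPart, _root_.sum_apply, _root_.smul_apply, smul_eq_mul,
    ContinuousMultilinearMap.compContinuousLinearMap_apply,
    ContinuousMultilinearMap.mkPiAlgebra_apply, ContinuousLinearMap.proj_apply]
  refine Finset.sum_congr rfl fun m hm => ?_
  have hm' : m.1 + m.2 = n := Finset.HasAntidiagonal.mem_antidiagonal.1 hm
  subst hm'
  rw [Fin.prod_univ_add, mul_assoc]
  simp

theorem homForm_norm_le (h : GeoBound C ρ a) (hC : 0 ≤ C) (hρ : 0 < ρ) (n : ℕ) :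
    ‖homForm a n‖ ≤ C * (2 * ρ) ^ n := by
  have hproj : ∀ i : Fin 2, ‖(ContinuousLinearMap.proj i : Pt →L[ℝ] ℝ)‖ ≤ 1 := fun i =>
    ContinuousLinearMap.opNorm_le_bound _ zero_le_one fun v => by
      simpa using norm_le_pi_norm v i
  have : ‖homForm a n‖ ≤ ∑ m ∈ Finset.HasAntidiagonal.antidiagonal n, C * ρ ^ n := by
    refine (norm_sum_le _ _).trans (Finset.sum_le_sum fun m hm => ?_)
    have hm' : m.1 + m.2 = n := Finset.HasAntidiagonal.mem_antidiagonal.1 hm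
    rw [norm_smul, Real.norm_eq_abs]
    have h1 := h m.1 m.2
    rw [hm'] at h1
    have h2 : ‖(ContinuousMultilinearMap.mkPiAlgebra ℝ (Fin n) ℝ).compContinuousLinearMap
      fun i => (ContinuousLinearMap.proj (if i.1 < m.1 then 0 else 1) : Pt →L[ℝ] ℝ)‖ ≤ 1 := by
      refine (ContinuousMultilinearMap.norm_compContinuousLinearMap_le _ _).trans ?_
      rw [ContinuousMultilinearMap.norm_mkPiAlgebra, one_mul]
      exact Finset.prod_le_one (fun _ _ => norm_nonneg _) fun i _ => hproj _
    calc _ ≤ C * ρ ^ n * 1 := by gcongr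
      _ = _ := mul_one _
  refine this.trans ?_
  rw [Finset.sum_const, Finset.Nat.card_antidiagonal, nsmul_eq_mul, mul_pow]
  have h3 := succ_le_two_pow n
  have h4 : 0 ≤ C * ρ ^ n := by positivity
  push_cast
  nlinarith

theorem analyticAt_dSum (h : GeoBound C ρ a) (hC : 0 ≤ C) (hρ : 0 < ρ) :
    AnalyticAt ℝ (dSum a) 0 := by
  obtain ⟨r, hr0⟩ : ∃ r : NNReal, (r : ℝ) = (2 * ρ)⁻¹ := ⟨⟨(2 * ρ)⁻¹, by positivity⟩, rfl⟩
  have hr : (r : ENNReal) ≤ (homForm a).radius := by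
    refine FormalMultilinearSeries.le_radius_of_bound _ C fun n => ?_
    have := homForm_norm_le h hC hρ n
    rw [hr0]
    have e : (2 * ρ) ^ n * ((2 * ρ)⁻¹) ^ n = 1 := by
      rw [← mul_pow, mul_inv_cancel₀ (by positivity), one_pow]
    calc ‖homForm a n‖ * ((2 * ρ)⁻¹) ^ n ≤ C * (2 * ρ) ^ n * ((2 * ρ)⁻¹) ^ n := by gcongr
      _ = C := by rw [mul_assoc, e, mul_one]
  have hpos : 0 < (homForm a).radius := lt_of_lt_of_le (by
    rw [ENNReal.coe_pos, ← NNReal.coe_pos, hr0]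
    positivity) hr
  have := ((homForm a).hasFPowerSeriesOnBall hpos).analyticAt
  have e : dSum a = (homForm a).sum := by
    funext z
    simp only [dSum, FormalMultilinearSeries.sum, homForm_apply]
  rwa [e]

/-- Every analytic function is the sum of a double power series. -/
theorem exists_dSum_eq {g : Pt → ℝ} {p : Pt} (hg : AnalyticAt ℝ g p) :
    ∃ (a : ℕ → ℕ → ℝ) (C ρ : ℝ), 0 ≤ C ∧ 0 < ρ ∧ GeoBound C ρ a ∧
      ∀ᶠ y in 𝓝 (0 : Pt), g (p + y) = dSum a y := by
  obtain ⟨q, hq⟩ := hg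
  obtain ⟨r, hr⟩ := hq
  obtain ⟨C, hC, ρ', hρ', hb⟩ : ∃ C : ℝ, 0 ≤ C ∧ ∃ ρ : ℝ, 0 < ρ ∧ ∀ n, ‖q n‖ ≤ C * ρ ^ n := by
    obtain ⟨s, hs0, hs⟩ := ENNReal.lt_iff_exists_nnreal_btwn.1 (hr.r_pos.trans_le hr.r_le)
    obtain ⟨C, hC, hb⟩ := q.norm_mul_pow_le_of_lt_radius hs
    have hs0' : 0 < (s : ℝ) := by exact_mod_cast hs0
    refine ⟨C, hC.le, (s : ℝ)⁻¹, by positivity, fun n => ?_⟩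
    rw [inv_pow, ← div_eq_mul_inv, le_div_iff₀ (by positivity)]
    exact hb n
  set e0 : Pt := Pi.single 0 1
  set e1 : Pt := Pi.single 1 1
  have hn0 : ‖e0‖ ≤ 1 := (pi_norm_le_iff_of_nonneg zero_le_one).2 fun i => by
    fin_cases i <;> simp [e0]
  have hn1 : ‖e1‖ ≤ 1 := (pi_norm_le_iff_of_nonneg zero_le_one).2 fun i => by
    fin_cases i <;> simp [e1]
  -- Expanding the n-th multilinear term at y₀e₀ + y₁e₁, this is the coefficient of y₀ⁱ y₁ⁿ⁻ⁱ: the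
  -- sum over the slots that receive e₀. Their number is a binomial coefficient, hence at most 2ⁿ.
  set c : ℕ → ℕ → ℝ := fun n i => ∑ s ∈ Finset.powersetCard i (Finset.univ : Finset (Fin n)),
    q n (s.piecewise (fun _ => e0) fun _ => e1) with hc
  have hcb : ∀ n i, |c n i| ≤ C * (2 * ρ') ^ n := by
    intro n i
    have h1 : |c n i| ≤ ∑ s ∈ Finset.powersetCard i (Finset.univ : Finset (Fin n)), ‖q n‖ := by
      refine (Finset.abs_sum_le_sum_abs _ _).trans (Finset.sum_le_sum fun s _ => ?_)
      refine ((q n).le_opNorm _).trans (mul_le_of_le_one_right (norm_nonneg _)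
        (Finset.prod_le_one (fun _ _ => norm_nonneg _) fun k _ => ?_))
      by_cases hk : k ∈ s <;> simp [hk, hn0, hn1]
    have h2 : ((n.choose i : ℕ) : ℝ) ≤ 2 ^ n := by
      exact_mod_cast Nat.choose_le_two_pow n i
    rw [Finset.sum_const, Finset.card_powersetCard, Finset.card_univ, Fintype.card_fin,
      nsmul_eq_mul] at h1
    calc |c n i| ≤ (n.choose i : ℝ) * ‖q n‖ := h1
      _ ≤ 2 ^ n * (C * ρ' ^ n) := by
        gcongr
        exact hb n
      _ = _ := by rw [mul_pow]; ring
  refine ⟨fun i j => c (i + j) i, C, 2 * ρ', hC, by positivity, fun i j => hcb _ _, ?_⟩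
  have hball : ∀ᶠ y in 𝓝 (0 : Pt), y ∈ Metric.eball (0 : Pt) r := Metric.eball_mem_nhds _ hr.r_pos
  filter_upwards [hball] with y hy
  rw [← (hr.hasSum hy).tsum_eq, dSum]
  congr 1
  funext n
  have hy' : (fun _ : Fin n => y) = (fun _ => y 0 • e0) + fun _ => y 1 • e1 := by
    funext k i
    fin_cases i <;> simp [e0, e1]
  have hpw : ∀ s : Finset (Fin n), q n (s.piecewise (fun _ => y 0 • e0) fun _ => y 1 • e1)
      = y 0 ^ s.card * y 1 ^ (n - s.card) * q n (s.piecewise (fun _ => e0) fun _ => e1) := by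
    intro s
    have h1 := (q n).toMultilinearMap.map_smul_univ (s.piecewise (fun _ => y 0) fun _ => y 1)
      (s.piecewise (fun _ => e0) fun _ => e1)
    have h2 : (fun i => s.piecewise (fun _ => y 0) (fun _ => y 1) i •
        s.piecewise (fun _ => e0) (fun _ => e1) i)
        = s.piecewise (fun _ => y 0 • e0) fun _ => y 1 • e1 := by
      funext i
      by_cases hi : i ∈ s <;> simp [hi]
    have h3 : ∏ i, s.piecewise (fun _ => y 0) (fun _ => y 1) i
        = y 0 ^ s.card * y 1 ^ (n - s.card) := by
      rw [Finset.prod_piecewise]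
      simp [← Finset.compl_eq_univ_sdiff, Finset.card_compl]
    rw [h2, h3] at h1
    exact h1
  have hadd := (q n).toMultilinearMap.map_add_univ (fun _ => y 0 • e0) fun _ => y 1 • e1
  rw [hy']
  refine hadd.trans ?_
  rw [← Finset.powerset_univ, Finset.sum_powerset, homPart,
    Finset.Nat.sum_antidiagonal_eq_sum_range_succ
      (fun i j => c (i + j) i * y 0 ^ i * y 1 ^ j), Finset.card_univ, Fintype.card_fin]
  refine Finset.sum_congr rfl fun i hi => ?_
  have hi' : i ≤ n := by simpa [Nat.lt_succ_iff] using hi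
  rw [Nat.add_sub_cancel' hi', hc, Finset.sum_mul, Finset.sum_mul]
  refine Finset.sum_congr rfl fun s hs => ?_
  have hs' : s.card = i := (Finset.mem_powersetCard.1 hs).2
  refine (hpw s).trans ?_
  rw [hs']
  ring
end

/-! ### The linear Cauchy problem: recursion for the coefficients and majorants. -/

section
variable {a b : ℕ → ℕ → ℝ} {C ρ : ℝ}

theorem homPart_coeffX (a : ℕ → ℕ → ℝ) (n : ℕ) (z : Pt) :
    homPart (coeffX a) (n + 1) z = z 0 * homPart a n z := by
  rw [homPart, Finset.Nat.sum_antidiagonal_succ, homPart, Finset.mul_sum]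
  simp only [coeffX, zero_mul, zero_add]
  refine Finset.sum_congr rfl fun m _ => ?_
  ring

theorem hasSum_coeffX {z : Pt} {s : ℝ} (h : HasSum (fun n => homPart a n z) s) :
    HasSum (fun n => homPart (coeffX a) n z) (z 0 * s) := by
  have h1 : HasSum (fun n => homPart (coeffX a) (n + 1) z) (z 0 * s) := by
    simpa only [homPart_coeffX] using h.mul_left (z 0)
  have h2 := (hasSum_nat_add_iff (f := fun n => homPart (coeffX a) n z) 1).1 h1
  simpa [homPart, coeffX] using h2

theorem homPart_add (a b : ℕ → ℕ → ℝ) (n : ℕ) (z : Pt) :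
    homPart (a + b) n z = homPart a n z + homPart b n z := by
  simp only [homPart, Pi.add_apply, add_mul, Finset.sum_add_distrib]

theorem homPart_smul (r : ℝ) (a : ℕ → ℕ → ℝ) (n : ℕ) (z : Pt) :
    homPart (r • a) n z = r * homPart a n z := by
  simp only [homPart, Pi.smul_apply, smul_eq_mul, Finset.mul_sum]
  refine Finset.sum_congr rfl fun m _ => ?_
  ring

/-- A row `m_i` of the coefficients of a pair of double power series. -/
abbrev RowPair : Type := (ℕ → ℝ) × (ℕ → ℝ)

/-- The coefficients of the linear Cauchy problem
`∂_x m⁰ = (p₀ + p₁ x) ∂_y m⁰ + ∂_y m¹ + g`, `∂_x m¹ = (q₀ + q₁ x + q₂ x²) ∂_y m⁰ + h`. -/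
structure CauchyData where
  p₀ : ℝ
  p₁ : ℝ
  q₀ : ℝ
  q₁ : ℝ
  q₂ : ℝ
  g : ℕ → ℕ → ℝ
  h : ℕ → ℕ → ℝ

namespace CauchyData
variable (D : CauchyData)

/-- The next row of coefficients in terms of the three preceding ones. -/
noncomputable def next (i : ℕ) (r s t : RowPair) : RowPair :=
  (fun j => ((j + 1) * (D.p₀ * r.1 (j + 1) + D.p₁ * s.1 (j + 1) + r.2 (j + 1)) + D.g i j) / (i + 1),
   fun j => ((j + 1) * (D.q₀ * r.1 (j + 1) + D.q₁ * s.1 (j + 1) + D.q₂ * t.1 (j + 1)) + D.h i j)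
    / (i + 1))

/-- Three successive rows of coefficients. -/
noncomputable def state : ℕ → RowPair × RowPair × RowPair
  | 0 => (0, 0, 0)
  | i + 1 => (D.next i (state i).1 (state i).2.1 (state i).2.2, (state i).1, (state i).2.1)

/-- The first component of the solution. -/
noncomputable def sol₀ (i j : ℕ) : ℝ := (D.state i).1.1 j

/-- The second component of the solution. -/
noncomputable def sol₁ (i j : ℕ) : ℝ := (D.state i).1.2 j

/-- Multiplication by x shifts the row index, and the coefficients of the problem have degree at
most two in x; this is why three rows are carried. The zero rows in the initial state match the
convention in `coeffX`. -/
theorem state_prev (i j : ℕ) : (D.state i).2.1.1 j = coeffX D.sol₀ i j ∧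
    (D.state i).2.2.1 j = coeffX (coeffX D.sol₀) i j := by
  cases i with
  | zero => simp [state, coeffX]
  | succ i =>
    refine ⟨rfl, ?_⟩
    cases i with
    | zero => simp [state, coeffX]
    | succ i => rfl

theorem coeffX_coeffD_one (a : ℕ → ℕ → ℝ) (i j : ℕ) :
    coeffX (coeffD 1 a) i j = (j + 1) * coeffX a i (j + 1) := by
  cases i with
  | zero => simp [coeffX]
  | succ i => simp [coeffX, coeffD]

theorem sol₀_eq : coeffD 0 D.sol₀ = D.p₀ • coeffD 1 D.sol₀ + D.p₁ • coeffX (coeffD 1 D.sol₀)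
    + coeffD 1 D.sol₁ + D.g := by
  funext i j
  have hi : ((i : ℝ) + 1) ≠ 0 := by positivity
  have e : D.sol₀ (i + 1) j = ((j + 1) * (D.p₀ * D.sol₀ i (j + 1)
      + D.p₁ * (D.state i).2.1.1 (j + 1) + D.sol₁ i (j + 1)) + D.g i j) / (i + 1) := rfl
  rw [(D.state_prev i (j + 1)).1] at e
  simp only [Pi.add_apply, Pi.smul_apply, smul_eq_mul, coeffX_coeffD_one]
  simp only [coeffD, Matrix.cons_val_zero, Matrix.cons_val_one, e]
  field_simp

theorem sol₁_eq : coeffD 0 D.sol₁ = D.q₀ • coeffD 1 D.sol₀ + D.q₁ • coeffX (coeffD 1 D.sol₀)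
    + D.q₂ • coeffX (coeffX (coeffD 1 D.sol₀)) + D.h := by
  funext i j
  have hi : ((i : ℝ) + 1) ≠ 0 := by positivity
  have e : D.sol₁ (i + 1) j = ((j + 1) * (D.q₀ * D.sol₀ i (j + 1)
      + D.q₁ * (D.state i).2.1.1 (j + 1) + D.q₂ * (D.state i).2.2.1 (j + 1)) + D.h i j)
      / (i + 1) := rfl
  rw [(D.state_prev i (j + 1)).1, (D.state_prev i (j + 1)).2] at e
  have e2 : coeffX (coeffX (coeffD 1 D.sol₀)) i j
      = (j + 1) * coeffX (coeffX D.sol₀) i (j + 1) := by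
    cases i with
    | zero => simp [coeffX]
    | succ i => exact coeffX_coeffD_one _ _ _
  simp only [Pi.add_apply, Pi.smul_apply, smul_eq_mul, coeffX_coeffD_one, e2]
  simp only [coeffD, Matrix.cons_val_zero, e]
  field_simp
  simp
  ring

/-- The majorant of the coefficients of the solution. -/
noncomputable def maj (C ρ R : ℝ) (i j : ℕ) : ℝ := C * R ^ i * ρ ^ j * ((i + j).choose i : ℝ)

/-- The binomial coefficient is chosen for this identity: the factor j+1 produced by ∂_y turns into
the factor i+1 that integration in x divides out. -/
theorem maj_succ (C ρ R : ℝ) (i j : ℕ) :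
    ((j : ℝ) + 1) * maj C ρ R i (j + 1)
      = (i + 1) * (C * R ^ i * ρ ^ (j + 1) * ((i + 1 + j).choose (i + 1) : ℝ)) := by
  have h := Nat.choose_succ_right_eq (i + 1 + j) i
  have h' : i + 1 + j - i = j + 1 := by omega
  rw [h'] at h
  have h2 : (((i + 1 + j).choose (i + 1) : ℕ) : ℝ) * (i + 1)
      = ((i + 1 + j).choose i : ℕ) * (j + 1) := by exact_mod_cast h
  rw [maj, show i + (j + 1) = i + 1 + j by ring]
  linear_combination -(C * R ^ i * ρ ^ (j + 1)) * h2

theorem maj_mono {C ρ R : ℝ} (hC : 0 ≤ C) (hρ : 0 ≤ ρ) (hR : 1 ≤ R) (i j : ℕ) :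
    maj C ρ R i j ≤ maj C ρ R (i + 1) j := by
  have h1 : (((i + j).choose i : ℕ) : ℝ) ≤ ((i + 1 + j).choose (i + 1) : ℕ) := by
    have : i + 1 + j = (i + j) + 1 := by ring
    rw [this, Nat.choose_succ_succ]
    exact_mod_cast Nat.le_add_right _ _
  have h2 : R ^ i ≤ R ^ (i + 1) := pow_le_pow_right₀ hR (Nat.le_succ i)
  have hR0 : 0 ≤ R := by linarith
  unfold maj
  gcongr

theorem maj_nonneg {C ρ R : ℝ} (hC : 0 ≤ C) (hρ : 0 ≤ ρ) (hR : 0 ≤ R) (i j : ℕ) :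
    0 ≤ maj C ρ R i j := by
  unfold maj
  positivity

/-- In R ≥ Kρ + 1 + ρ the term Kρ pays for the y-derivatives, the 1 for the source, and the final ρ
gives ρ ≤ R, so that the geometric bound on the source lies below the majorant. -/
theorem row_bound {C ρ K R x y w α β γ g : ℝ} (hC : 0 ≤ C) (hρ : 0 < ρ)
    (hR : K * ρ + 1 + ρ ≤ R) (hK : |α| + |β| + |γ| ≤ K) (i j : ℕ)
    (hx : |x| ≤ maj C ρ R i (j + 1)) (hy : |y| ≤ maj C ρ R i (j + 1))
    (hw : |w| ≤ maj C ρ R i (j + 1)) (hg : |g| ≤ C * ρ ^ (i + j)) :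
    |((j + 1) * (α * x + β * y + γ * w) + g) / (i + 1)| ≤ maj C ρ R (i + 1) j := by
  have hK0 : 0 ≤ K := le_trans (by positivity) hK
  have hKρ : 0 ≤ K * ρ := by positivity
  have hR1 : ρ ≤ R := by linarith
  have hR0 : 0 ≤ R := by linarith
  set T := maj C ρ R i (j + 1) with hT
  have hT0 : 0 ≤ T := maj_nonneg hC hρ.le hR0 _ _
  have h1 : |α * x + β * y + γ * w| ≤ K * T := by
    calc |α * x + β * y + γ * w| ≤ |α| * |x| + |β| * |y| + |γ| * |w| := by
          refine (abs_add_le _ _).trans (add_le_add ((abs_add_le _ _).trans ?_) (abs_mul _ _).le)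
          rw [abs_mul, abs_mul]
      _ ≤ |α| * T + |β| * T + |γ| * T := by gcongr
      _ = (|α| + |β| + |γ|) * T := by ring
      _ ≤ K * T := by gcongr
  set b : ℝ := ((i + 1 + j).choose (i + 1) : ℝ) with hb
  have hb1 : 1 ≤ b := by
    have : 0 < (i + 1 + j).choose (i + 1) := Nat.choose_pos (by omega)
    rw [hb]
    exact_mod_cast this
  have hi : (0 : ℝ) < i + 1 := by positivity
  rw [abs_div, abs_of_pos hi, div_le_iff₀ hi]
  have h2 := maj_succ C ρ R i j
  have h3 : |g| ≤ (i + 1) * (C * R ^ i * ρ ^ j * b) := by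
    have h4 : C * ρ ^ (i + j) ≤ C * R ^ i * ρ ^ j := by
      rw [pow_add, ← mul_assoc]
      gcongr
    have h5 : C * R ^ i * ρ ^ j ≤ C * R ^ i * ρ ^ j * b :=
      le_mul_of_one_le_right (by positivity) hb1
    have h6 : C * R ^ i * ρ ^ j * b ≤ (i + 1) * (C * R ^ i * ρ ^ j * b) :=
      le_mul_of_one_le_left (by positivity) (by
        have : (0 : ℝ) ≤ i := by positivity
        linarith)
    linarith
  calc |(j + 1) * (α * x + β * y + γ * w) + g|
      ≤ (j + 1) * |α * x + β * y + γ * w| + |g| := by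
        refine (abs_add_le _ _).trans ?_
        rw [abs_mul, abs_of_nonneg (by positivity : (0 : ℝ) ≤ j + 1)]
    _ ≤ (j + 1) * (K * T) + (i + 1) * (C * R ^ i * ρ ^ j * b) := by gcongr
    _ = K * ((j + 1) * T) + (i + 1) * (C * R ^ i * ρ ^ j * b) := by ring
    _ = (K * ρ + 1) * ((i + 1) * (C * R ^ i * ρ ^ j * b)) := by rw [h2]; ring
    _ ≤ R * ((i + 1) * (C * R ^ i * ρ ^ j * b)) := by
        have : 0 ≤ (i + 1) * (C * R ^ i * ρ ^ j * b) := by positivity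
        gcongr
        linarith
    _ = maj C ρ R (i + 1) j * (i + 1) := by rw [maj, ← hb]; ring

/-- Induction on the row. The two delayed rows obey the bound of the current one because the
majorant increases with i (`maj_mono`). -/
theorem state_bound {C ρ K R : ℝ} (hC : 0 ≤ C) (hρ : 0 < ρ) (hR : K * ρ + 1 + ρ ≤ R)
    (hK : |D.p₀| + |D.p₁| + 1 ≤ K) (hK' : |D.q₀| + |D.q₁| + |D.q₂| ≤ K)
    (hg : GeoBound C ρ D.g) (hh : GeoBound C ρ D.h) (i : ℕ) : ∀ j,
    |(D.state i).1.1 j| ≤ maj C ρ R i j ∧ |(D.state i).1.2 j| ≤ maj C ρ R i j ∧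
    |(D.state i).2.1.1 j| ≤ maj C ρ R i j ∧ |(D.state i).2.2.1 j| ≤ maj C ρ R i j := by
  have hK0 : 0 ≤ K := le_trans (by positivity) hK
  have hKρ : 0 ≤ K * ρ := by positivity
  have hR1 : 1 ≤ R := by linarith
  have hR0 : 0 ≤ R := by linarith
  induction i with
  | zero =>
    intro j
    have := maj_nonneg hC hρ.le hR0 0 j
    simp [state, this]
  | succ i ih =>
    intro j
    obtain ⟨h1, h2, h3, h4⟩ := ih (j + 1)
    obtain ⟨k1, -, k3, -⟩ := ih j
    have hm := maj_mono hC hρ.le hR1 i j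
    refine ⟨?_, row_bound hC hρ hR hK' i j h1 h3 h4 (hh i j), k1.trans hm, k3.trans hm⟩
    have := row_bound (γ := 1) hC hρ hR (by simpa using hK) i j h1 h3 h2 (hg i j)
    rw [one_mul] at this
    exact this

theorem exists_bound {C ρ : ℝ} (hC : 0 ≤ C) (hρ : 0 < ρ)
    (hg : GeoBound C ρ D.g) (hh : GeoBound C ρ D.h) :
    ∃ ρ' : ℝ, 0 < ρ' ∧ GeoBound C ρ' D.sol₀ ∧ GeoBound C ρ' D.sol₁ := by
  set K := |D.p₀| + |D.p₁| + 1 + (|D.q₀| + |D.q₁| + |D.q₂|) with hK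
  set R := K * ρ + 1 + ρ with hR
  have hq : 0 ≤ |D.q₀| + |D.q₁| + |D.q₂| := by positivity
  have hp : 0 ≤ |D.p₀| + |D.p₁| + 1 := by positivity
  have hK0 : 0 ≤ K := by positivity
  have hKρ : 0 ≤ K * ρ := by positivity
  have hρR : ρ ≤ R := by linarith
  have hR0 : 0 < R := by linarith
  have key := D.state_bound hC hρ (K := K) (R := R) le_rfl (by linarith) (by linarith) hg hh
  have hm : ∀ i j, maj C ρ R i j ≤ C * (2 * R) ^ (i + j) := by
    intro i j
    have h2 : (((i + j).choose i : ℕ) : ℝ) ≤ 2 ^ (i + j) := by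
      exact_mod_cast Nat.choose_le_two_pow (i + j) i
    calc maj C ρ R i j ≤ C * R ^ i * R ^ j * 2 ^ (i + j) := by
          unfold maj; gcongr
      _ = C * (2 * R) ^ (i + j) := by rw [mul_pow, pow_add R]; ring
  exact ⟨2 * R, by positivity, fun i j => (key i j).1.trans (hm i j),
    fun i j => (key i j).2.1.trans (hm i j)⟩

end CauchyData
end

theorem GeoBound.mono {a : ℕ → ℕ → ℝ} {C ρ C' ρ' : ℝ} (h : GeoBound C ρ a) (hρ : 0 ≤ ρ)
    (hC : C ≤ C') (hC' : 0 ≤ C') (hρ' : ρ ≤ ρ') : GeoBound C' ρ' a := fun i j => by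
  refine (h i j).trans ?_
  gcongr

/-- A linear Cauchy problem with analytic data whose coefficients are polynomials in the first
variable. -/
theorem exists_cauchy_solution (κ κ' : ℝ) {g h : Pt → ℝ} {p : Pt} (hg : AnalyticAt ℝ g p)
    (hh : AnalyticAt ℝ h p) :
    ∃ m₀ m₁ : Pt → ℝ, AnalyticAt ℝ m₀ p ∧ AnalyticAt ℝ m₁ p ∧ ∀ᶠ z in 𝓝 p,
      pd 0 m₀ z = κ * z 0 * pd 1 m₀ z + pd 1 m₁ z + g z ∧
      pd 0 m₁ z = κ' * z 0 ^ 2 * pd 1 m₀ z + h z := by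
  obtain ⟨a, C₁, ρ₁, hC₁, hρ₁, ha, hga⟩ := exists_dSum_eq hg
  obtain ⟨b, C₂, ρ₂, hC₂, hρ₂, hb, hhb⟩ := exists_dSum_eq hh
  -- Taylor coefficients at p of κu and κ'u², written in the shifted variable x = u - p₀.
  set D : CauchyData := ⟨κ * p 0, κ, κ' * p 0 ^ 2, 2 * κ' * p 0, κ', a, b⟩ with hD
  have hC : 0 ≤ C₁ + C₂ := by positivity
  have hρ : 0 < ρ₁ + ρ₂ := by positivity
  have ha' := ha.mono hρ₁.le (C' := C₁ + C₂) (ρ' := ρ₁ + ρ₂) (by linarith) hC (by linarith)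
  have hb' := hb.mono hρ₂.le (C' := C₁ + C₂) (ρ' := ρ₁ + ρ₂) (by linarith) hC (by linarith)
  obtain ⟨ρ₀, hρ₀, hs₀, hs₁⟩ := D.exists_bound hC hρ ha' hb'
  set C := C₁ + C₂
  set ρ := ρ₀ + (ρ₁ + ρ₂) with hρdef
  have hρpos : 0 < ρ := by positivity
  have s₀ := hs₀.mono hρ₀.le le_rfl hC (show ρ₀ ≤ ρ by linarith)
  have s₁ := hs₁.mono hρ₀.le le_rfl hC (show ρ₀ ≤ ρ by linarith)
  have sa := ha'.mono hρ.le le_rfl hC (show ρ₁ + ρ₂ ≤ ρ by linarith)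
  have sb := hb'.mono hρ.le le_rfl hC (show ρ₁ + ρ₂ ≤ ρ by linarith)
  have hsub : AnalyticAt ℝ (fun z : Pt => z - p) p := analyticAt_id.sub analyticAt_const
  have hz0 : p - p = 0 := sub_self p
  have an : ∀ c : ℕ → ℕ → ℝ, GeoBound C ρ c → AnalyticAt ℝ (fun z => dSum c (z - p)) p :=
    fun c hc => (analyticAt_dSum hc hC hρpos).comp_of_eq hsub hz0
  have ht : Tendsto (fun z : Pt => z - p) (𝓝 p) (𝓝 0) := by
    have := hsub.continuousAt.tendsto
    rwa [hz0] at this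
  refine ⟨fun z => dSum D.sol₀ (z - p), fun z => dSum D.sol₁ (z - p), an _ s₀, an _ s₁, ?_⟩
  have hball : ∀ᶠ y in 𝓝 (0 : Pt), ‖y‖ < (8 * ρ)⁻¹ := by
    have := Metric.ball_mem_nhds (0 : Pt) (show 0 < (8 * ρ)⁻¹ by positivity)
    filter_upwards [this] with y hy
    simpa using hy
  filter_upwards [ht.eventually hball, ht.eventually hga, ht.eventually hhb] with z hz hgz hhz
  have hpz : p + (z - p) = z := by abel
  rw [hpz] at hgz hhz
  have der : ∀ c : ℕ → ℕ → ℝ, GeoBound C ρ c → pd 0 (fun z => dSum c (z - p)) z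
      = dSum (coeffD 0 c) (z - p) ∧ pd 1 (fun z => dSum c (z - p)) z
      = dSum (coeffD 1 c) (z - p) := fun c hc => by
    have h1 := hasFDerivAt_dSum hc hC hρpos hz
    have h2 : HasFDerivAt (fun z : Pt => z - p) (ContinuousLinearMap.id ℝ Pt) z :=
      (hasFDerivAt_id z).sub_const p
    have h3 : HasFDerivAt (fun z => dSum c (z - p)) _ z :=
      HasFDerivAt.comp (g := dSum c) (f := fun z : Pt => z - p) z h1 h2
    exact pd_eq h3
  rw [(der _ s₀).1, (der _ s₀).2, (der _ s₁).1, (der _ s₁).2]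
  have hz' : ‖z - p‖ ≤ (4 * (2 * ρ))⁻¹ := by
    rw [show 4 * (2 * ρ) = 8 * ρ by ring]; exact hz.le
  have hz'' : ‖z - p‖ ≤ (4 * ρ)⁻¹ := hz.le.trans (by gcongr; norm_num)
  have hCρ : 0 ≤ C * ρ := by positivity
  have h2ρ : 0 < 2 * ρ := by positivity
  have t₀ := (summable_homPart (s₀.deriv 1) hCρ h2ρ hz').hasSum
  have t₁ := (summable_homPart (s₁.deriv 1) hCρ h2ρ hz').hasSum
  have ta := (summable_homPart sa hC hρpos hz'').hasSum
  have tb := (summable_homPart sb hC hρpos hz'').hasSum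
  have x₁ := hasSum_coeffX t₀
  have x₂ := hasSum_coeffX x₁
  have f₀ := (((t₀.mul_left D.p₀).add (x₁.mul_left D.p₁)).add t₁).add ta
  have f₁ := (((t₀.mul_left D.q₀).add (x₁.mul_left D.q₁)).add (x₂.mul_left D.q₂)).add tb
  have e₀ : dSum (coeffD 0 D.sol₀) (z - p) = D.p₀ * dSum (coeffD 1 D.sol₀) (z - p)
      + D.p₁ * ((z - p) 0 * dSum (coeffD 1 D.sol₀) (z - p)) + dSum (coeffD 1 D.sol₁) (z - p)
      + dSum a (z - p) := by
    rw [dSum, D.sol₀_eq]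
    simp only [homPart_add, homPart_smul]
    exact f₀.tsum_eq
  have e₁ : dSum (coeffD 0 D.sol₁) (z - p) = D.q₀ * dSum (coeffD 1 D.sol₀) (z - p)
      + D.q₁ * ((z - p) 0 * dSum (coeffD 1 D.sol₀) (z - p))
      + D.q₂ * ((z - p) 0 * ((z - p) 0 * dSum (coeffD 1 D.sol₀) (z - p)))
      + dSum b (z - p) := by
    rw [dSum, D.sol₁_eq]
    simp only [homPart_add, homPart_smul]
    exact f₁.tsum_eq
  rw [e₀, e₁, hgz, hhz]
  simp only [hD, Pi.sub_apply]
  constructor <;> ring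

/-! ### Commuting flows and Miura transformations of systems of conservation laws -/

theorem AnalyticAt.jac {M : Pt → Pt} {z : Pt} (h : AnalyticAt ℝ M z) : AnalyticAt ℝ (jac M) z :=
  analyticAt_mat fun i j => (analyticAt_pi_iff.1 h i).pd j

theorem jac_curlFree {M : Pt → Pt} {U : Set Pt} (h : AnalyticOnNhd ℝ M U) :
    CurlFree (jac M) U := fun z hz i j k =>
  pd_comm (analyticAt_pi_iff.1 (h z hz) i) k j

theorem jac_id (z : Pt) (i j : Fin 2) : jac id z i j = if i = j then 1 else 0 := by
  have h0 := pd_eq ((hasFDerivAt_coord 0 z).congr_fderiv (g' := (1 : ℝ) • _ + (0 : ℝ) • _)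
    (by simp))
  have h1 := pd_eq ((hasFDerivAt_coord 1 z).congr_fderiv (g' := (0 : ℝ) • _ + (1 : ℝ) • _)
    (by simp))
  fin_cases i <;> fin_cases j
  · exact h0.1
  · exact h0.2
  · exact h1.1
  · exact h1.2

theorem dMat_zero : dMat 0 = 0 := by
  funext z i j k
  simp [dMat, pd]

section
variable {A W B B' B₂ : MatField} {Q C : QuadField} {M : Pt → Pt} {U V : Set Pt}

/-- The range of the commutator with `mA k`, in terms of Jacobian matrices. -/
theorem exists_potential (k : ℝ) (hU : IsOpen U) (hB : AnalyticOnNhd ℝ B U)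
    (ht : ∀ z ∈ U, B z 0 0 + B z 1 1 = 0)
    (hA : ∀ z ∈ U, (2 * k - 1) * z 0 * B z 0 0 + B z 1 0 + k * (1 - k) * z 0 ^ 2 * B z 0 1 = 0)
    {p : Pt} (hp : p ∈ U) :
    ∃ V : Set Pt, IsOpen V ∧ p ∈ V ∧ V ⊆ U ∧ ∃ M : Pt → Pt, AnalyticOnNhd ℝ M V ∧
      ∀ z ∈ V, ∀ i j, B z i j = commMat (mA k) (jac M) z i j := by
  -- The entries (0,1) and (0,0) of B = [A, jac M] can be solved for the u-derivatives of M⁰ and M¹;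
  -- this is the Cauchy problem used here.
  obtain ⟨m₀, m₁, h₀, h₁, h⟩ := exists_cauchy_solution (2 * k - 1) (k * (1 - k))
    (((hB p hp).entry 0 1).fun_neg) ((hB p hp).entry 0 0)
  obtain ⟨V, hV, hVo, hpV⟩ := eventually_nhds_iff.1
    (((h.and h₀.eventually_analyticAt).and h₁.eventually_analyticAt).and (hU.mem_nhds hp))
  refine ⟨V, hVo, hpV, fun z hz => (hV z hz).2, fun z => ![m₀ z, m₁ z], fun z hz => ?_,
    fun z hz i j => ?_⟩
  · refine analyticAt_pi_iff.2 fun i => ?_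
    fin_cases i
    · exact (hV z hz).1.1.2
    · exact (hV z hz).1.2
  · obtain ⟨⟨⟨⟨e₀, e₁⟩, -⟩, -⟩, hzU⟩ := hV z hz
    have j0 : ∀ l, jac (fun z => ![m₀ z, m₁ z]) z 0 l = pd l m₀ z := fun l => rfl
    have j1 : ∀ l, jac (fun z => ![m₀ z, m₁ z]) z 1 l = pd l m₁ z := fun l => rfl
    -- A commutator with A satisfies the same two trace identities, so the two entries not used in
    -- the Cauchy problem follow from them.
    have t := ht z hzU
    have a := hA z hzU
    have c : ∀ i j, commMat (mA k) (jac fun z => ![m₀ z, m₁ z]) z i j =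
        B z i j := by
      intro i j
      fin_cases i <;> fin_cases j
      · simp [commMat, Fin.sum_univ_two, j0, j1, mA, e₀, e₁]
        ring
      · simp [commMat, Fin.sum_univ_two, j0, j1, mA, e₀]
      · simp [commMat, Fin.sum_univ_two, j0, j1, mA, e₀, e₁]
        linear_combination -a
      · simp [commMat, Fin.sum_univ_two, j0, j1, mA, e₁]
        linear_combination -t
    exact (c i j).symm

theorem corr_dMat_eq_deriv {u : ℝ → Pt} {x : ℝ} (hu : SmoothAt u x)
    (hB : AnalyticAt ℝ B (u x)) : corr B (dMat B) u x = deriv (mulV B u (deriv u)) x := by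
  rw [hu.deriv_mulV hB hu.derivAt, corr, add_comm]
  rfl

theorem quadV_eq_zero {u : ℝ → Pt} {x : ℝ} (h : ∀ i j k, Q (u x) i j k + Q (u x) i k j = 0)
    (q : ℝ → Pt) : quadV Q u q q x = 0 := by
  funext i
  have q0 : Q (u x) i 0 0 = 0 := by linarith [h i 0 0]
  have q1 : Q (u x) i 1 1 = 0 := by linarith [h i 1 1]
  simp only [quadV_apply, Fin.sum_univ_two, q0, q1, Pi.zero_apply]
  linear_combination q x 0 * q x 1 * h i 0 1

/-- A Miura transformation generated by `M` changes a deformation by a commutator. -/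
theorem transformsTo_of_comm (hV : IsOpen V) (hW : AnalyticOnNhd ℝ W V)
    (hB : AnalyticOnNhd ℝ B V) (hC : AnalyticOnNhd ℝ C V) (hB₂ : AnalyticOnNhd ℝ B₂ V)
    (hM : AnalyticOnNhd ℝ M V) (hcW : CurlFree W V)
    (hCB : ∀ z ∈ V, ∀ i j k, C z i j k + C z i k j = dMat B z i j k + dMat B z i k j)
    (h : ∀ z ∈ V, ∀ i j, B z i j = B₂ z i j + commMat W (jac M) z i j) :
    TransformsTo V (miura id (jac M)) (firstOrder W B C) (firstOrder W B₂ (dMat B₂)) := by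
  intro u hu x hx
  have hu' : SmoothAt u x := hu.contDiffAt
  have hJ := (hM _ hx).jac
  rw [transform_iff hu' analyticAt_id hJ (hW _ hx) (hB _ hx) (hC _ hx) (hW _ hx) (hB₂ _ hx)
    (hB₂ _ hx).dMat]
  have hid : ∀ q : ℝ → Pt, mulV (jac id) u q x = q x := by
    intro q
    funext i
    simp [mulV_apply, jac_id]
  have s1 := hu'.mulV (hW _ hx) hu'.derivAt
  have s2 := hu'.mulV hJ hu'.derivAt
  -- Only the symmetric part of C acts on u_x u_x, so the correction may be replaced by ∂_x (B u_x).
  have e1 : corr B C u x = deriv (mulV B u (deriv u)) x := by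
    rw [← corr_dMat_eq_deriv hu' (hB _ hx)]
    have := quadV_eq_zero (Q := C - dMat B) (u := u) (x := x) (fun i j k => by
      have := hCB _ hx i j k
      simp only [Pi.sub_apply]
      linarith) (deriv u)
    simp only [corr, Pi.add_apply]
    congr 1
    rw [← sub_eq_zero, ← this]
    funext i
    simp only [quadV_apply, Pi.sub_apply, Fin.sum_univ_two]
    ring
  rw [hid, hid, Function.id_comp]
  refine ⟨rfl, ?_⟩
  -- Closedness makes all four terms x-derivatives. With N = jac M the condition reduces to B + NW =
  -- B₂ + WN, which is the hypothesis.
  rw [e1, corr_dMat_eq_deriv hu' (hB₂ _ hx), varV_eq_deriv (jac_curlFree hM) hx hu' s1 hJ,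
    varV_eq_deriv hcW hx hu' s2 (hW _ hx),
    ← ((hu'.mulV (hB _ hx) hu'.derivAt).hasDerivAt.add (hu'.mulV hJ s1).hasDerivAt).deriv,
    ← ((hu'.mulV (hW _ hx) s2).hasDerivAt.add (hu'.mulV (hB₂ _ hx) hu'.derivAt).hasDerivAt).deriv]
  refine EventuallyEq.deriv_eq ?_
  filter_upwards [hu'.eventually_mem hV hx] with y hy
  funext i
  simp only [mulV_apply, Pi.add_apply, h _ hy, commMat, Fin.sum_univ_two]
  ring

/-- Commutation of the dispersionless limits. -/
def CommuteZero (A W : MatField) (U : Set Pt) : Prop :=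
  ∀ u : ℝ → Pt, ContDiff ℝ ∞ u → ∀ x : ℝ, u x ∈ U →
    varV A u (mulV W u (deriv u)) x = varV W u (mulV A u (deriv u)) x

theorem commuteZero_of (hA : AnalyticOnNhd ℝ A U) (hW : AnalyticOnNhd ℝ W U)
    (hcA : CurlFree A U) (hcW : CurlFree W U) (hU : IsOpen U)
    (h : ∀ z ∈ U, ∀ i j, commMat A W z i j = 0) : CommuteZero A W U := by
  intro u hu x hx
  have hu' : SmoothAt u x := hu.contDiffAt
  rw [← sub_eq_zero, order_zero_eq hA hW hcA hu hx]
  have e : mulV (commMat A W) u (deriv u) =ᶠ[𝓝 x] fun _ => 0 := by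
    filter_upwards [hu'.eventually_mem hU hx] with y hy
    funext i
    simp [mulV_apply, h _ hy]
  rw [e.deriv_eq, deriv_const]
  funext i
  simp only [quadV_apply, Pi.add_apply, Pi.sub_apply, Pi.zero_apply, Fin.sum_univ_two,
    hcW _ hx i 1 0]
  ring

/-- The u_xx-coefficient gives [A,W] = 0 on an open set, so its derivatives vanish as well. Testing
the rest on u_x = ∂_v leaves the curl of each row of W times the entry (0,1) of A. -/
theorem CommuteZero.comm_and_curlFree (h : CommuteZero A W U) (hA : AnalyticOnNhd ℝ A U)
    (hW : AnalyticOnNhd ℝ W U) (hcA : CurlFree A U) (hU : IsOpen U)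
    (hA01 : ∀ z ∈ U, A z 0 1 ≠ 0) :
    (∀ z ∈ U, ∀ i j, commMat A W z i j = 0) ∧ CurlFree W U := by
  have main : ∀ z ∈ U, ∀ (a b : Pt) (i : Fin 2), ∑ j, commMat A W z i j * b j
      + ∑ j, ∑ k, dMat (commMat A W) z i j k * a j * a k
      + ∑ j, ∑ k, dMat W z i j k * ((∑ l, A z j l * a l) * a k - a j * ∑ l, A z k l * a l)
      = 0 := by
    intro z hz a b i
    have hu := jetCurve_contDiff z a b 0
    set u := jetCurve z a b 0 with hudef
    have hu0 : u 0 = z := jetCurve_zero _ _ _ _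
    have hx : u 0 ∈ U := by rwa [hu0]
    have hs : SmoothAt u 0 := hu.contDiffAt
    have h1 := h u hu 0 hx
    rw [← sub_eq_zero, order_zero_eq hA hW hcA hu hx,
      hs.deriv_mulV ((hA _ hx).commMat (hW _ hx)) hs.derivAt] at h1
    have h2 := congrFun h1 i
    have d1 : deriv u 0 = a := by rw [hudef, jetCurve_deriv, jetCurve_zero]
    have d2 : deriv (deriv u) 0 = b := by
      rw [hudef, jetCurve_deriv, jetCurve_deriv, jetCurve_zero]
    simp only [Pi.add_apply, Pi.sub_apply, Pi.zero_apply, mulV_apply, quadV_apply, d1, d2, hu0]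
      at h2
    simp only [Fin.sum_univ_two] at h2 ⊢
    linear_combination h2
  have hc : ∀ z ∈ U, ∀ i j, commMat A W z i j = 0 := by
    intro z hz i j
    have := main z hz 0 (Pi.single j 1) i
    simpa [Pi.single_apply] using this
  refine ⟨hc, fun z hz i => ?_⟩
  have hd : ∀ i j k, dMat (commMat A W) z i j k = 0 := by
    intro i j k
    have : (fun w => commMat A W w i j) =ᶠ[𝓝 z] fun _ => 0 := by
      filter_upwards [hU.mem_nhds hz] with w hw
      exact hc w hw i j
    rw [dMat, pd_congr this]
    simp [pd]
  have h1 := main z hz (Pi.single 1 1) 0 i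
  simp [Fin.sum_univ_two, hd] at h1
  have h2 : dMat W z i 0 1 = dMat W z i 1 0 := by
    refine mul_right_cancel₀ (hA01 z hz) ?_
    linear_combination h1
  intro j k
  fin_cases j <;> fin_cases k
  · rfl
  · exact h2
  · exact h2.symm
  · rfl

/-- Sufficient conditions for two deformed flows to commute. -/
theorem commute_of (hA : AnalyticOnNhd ℝ A U) (hB : AnalyticOnNhd ℝ B U)
    (hW : AnalyticOnNhd ℝ W U) (hB' : AnalyticOnNhd ℝ B' U) (hcA : CurlFree A U)
    (hcW : CurlFree W U) (hU : IsOpen U) (h : ∀ z ∈ U, ∀ i j, commMat A W z i j = 0)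
    (hK : ∀ z ∈ U, ∀ i j, fluxK A B W B' z i j = 0)
    (hG : ∀ z ∈ U, ∀ i, ∀ a : Pt,
      ∑ j, ∑ l, fluxG A B W B' (dMat B) (dMat B') z i j l * a j * a l = 0) :
    CommuteUpToFirstOrder U (firstOrder A B (dMat B)) (firstOrder W B' (dMat B')) := by
  rw [commute_firstOrder_iff hA hB (fun z hz => (hB z hz).dMat) hW hB'
    (fun z hz => (hB' z hz).dMat)]
  intro u hu x hx
  refine ⟨commuteZero_of hA hW hcA hcW hU h u hu x hx, ?_⟩
  have hu' : SmoothAt u x := hu.contDiffAt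
  have h0 : AnalyticOnNhd ℝ (0 : QuadField) U := fun _ _ => analyticAt_const
  have key := order_one_eq hA hB hW hB' h0 hcA hcW hU hu hx
  rw [add_zero] at key
  rw [← sub_eq_zero, key]
  have e : mulV (fluxK A B W B') u (deriv (deriv u))
      + quadV (fluxG A B W B' (dMat B) (dMat B')) u (deriv u) (deriv u) =ᶠ[𝓝 x] fun _ => 0 := by
    filter_upwards [hu'.eventually_mem hU hx] with y hy
    funext i
    rw [Pi.add_apply, Pi.add_apply, mulV_apply, quadV_apply, hG _ hy]
    simp [hK _ hy]
  rw [e.deriv_eq, deriv_const]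
  funext i
  simp [cubV_apply, quadV_apply, dQuad, pd]
end

/-! ### The fluxes of the basic flows -/

section
variable {c : ℝ} {X : Fin 2 → ℕ → Pt → Pt}

theorem IsPrincipalHierarchy.jac_zero_one (h : IsPrincipalHierarchy c X) :
    jac (X 0 1) = mA (-(2 * c + 1)) := by
  funext z i j
  refine (h.recursion 0 0 z i j).trans ?_
  simp only [h.flat, Fin.sum_univ_two]
  fin_cases i <;> fin_cases j <;>
    simp [(structConst_eq c z).1, (structConst_eq c z).2, mA] <;> ring

theorem IsPrincipalHierarchy.jac_one_two (h : IsPrincipalHierarchy c X) :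
    jac (X 1 2) = mT (-(2 * c + 1)) := by
  funext z i j
  refine (h.recursion 1 1 z i j).trans ?_
  simp only [h.flux_one_one, Fin.sum_univ_two]
  fin_cases i <;> fin_cases j <;>
    simp [(structConst_eq c z).1, (structConst_eq c z).2, mT] <;> ring

theorem IsPrincipalHierarchy.analyticAt_zero_one (h : IsPrincipalHierarchy c X) (z : Pt) :
    AnalyticAt ℝ (X 0 1) z := by
  have h0 := analyticAt_coord 0 z
  have h1 := analyticAt_coord 1 z
  rw [funext h.flux_zero_one]
  refine analyticAt_pi_iff.2 fun i => ?_
  fin_cases i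
  · exact h1.fun_sub (analyticAt_const.fun_mul (h0.fun_pow 2))
  · exact analyticAt_const.fun_mul (h0.fun_pow 3)

theorem IsPrincipalHierarchy.analyticAt_one_two (h : IsPrincipalHierarchy c X) (z : Pt) :
    AnalyticAt ℝ (X 1 2) z := by
  have h0 := analyticAt_coord 0 z
  have h1 := analyticAt_coord 1 z
  rw [funext h.flux_one_two]
  refine analyticAt_pi_iff.2 fun i => ?_
  fin_cases i
  · exact (analyticAt_const.fun_mul (h0.fun_pow 3)).fun_add (h0.fun_mul h1)
  · exact (analyticAt_const.fun_mul (h0.fun_pow 4)).fun_add ((h1.fun_pow 2).fun_div analyticAt_const two_ne_zero)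
end

/-! ### The generic case -/

/-- The line u = 0, where the eigenvalues of the basic flows coincide, has empty interior;
identities proved off it extend by continuity along the u-direction. -/
theorem eq_zero_of_coord_ne_zero {f : Pt → ℝ} {U : Set Pt} (hf : ∀ z ∈ U, ContinuousAt f z)
    (hU : IsOpen U) (h : ∀ z ∈ U, z 0 ≠ 0 → f z = 0) {z : Pt} (hz : z ∈ U) : f z = 0 := by
  by_cases hz0 : z 0 ≠ 0
  · exact h z hz hz0
  push Not at hz0
  have hc : Tendsto (fun s : ℝ => z + s • (Pi.single 0 1 : Pt)) (𝓝[≠] 0) (𝓝 z) := by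
    have : ContinuousAt (fun s : ℝ => z + s • (Pi.single 0 1 : Pt)) 0 := by fun_prop
    have h2 := this.tendsto
    simp only [zero_smul, add_zero] at h2
    exact h2.mono_left nhdsWithin_le_nhds
  refine tendsto_nhds_unique ((hf z hz).tendsto.comp hc) (tendsto_const_nhds.congr' ?_)
  filter_upwards [hc (hU.mem_nhds hz), self_mem_nhdsWithin] with s hs hs0
  refine (h _ hs ?_).symm
  simpa [hz0] using hs0

section
variable {A B W B' J Z : MatField} {C' : QuadField} {U V : Set Pt} {z : Pt} {k : ℝ}

theorem dMat_commMat (hA : AnalyticAt ℝ A z) (hW : AnalyticAt ℝ W z) (i j l : Fin 2) :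
    dMat (commMat A W) z i j l = ∑ m, (dMat A z i m l * W z m j + A z i m * dMat W z m j l
      - (dMat W z i m l * A z m j + W z i m * dMat A z m j l)) := by
  have a := fun i j => hA.entry i j
  have w := fun i j => hW.entry i j
  have e : (fun y => commMat A W y i j) = fun y => (A y i 0 * W y 0 j - W y i 0 * A y 0 j)
      + (A y i 1 * W y 1 j - W y i 1 * A y 1 j) := by
    funext y
    simp only [commMat, Fin.sum_univ_two]
  rw [dMat, e, pd_add (((a i 0).fun_mul (w 0 j)).fun_sub ((w i 0).fun_mul (a 0 j)))
    (((a i 1).fun_mul (w 1 j)).fun_sub ((w i 1).fun_mul (a 1 j))),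
    pd_sub ((a i 0).fun_mul (w 0 j)) ((w i 0).fun_mul (a 0 j)),
    pd_sub ((a i 1).fun_mul (w 1 j)) ((w i 1).fun_mul (a 1 j)), pd_mul_mat (a i 0) (w 0 j),
    pd_mul_mat (a i 1) (w 1 j), pd_mul_mat (w i 0) (a 0 j), pd_mul_mat (w i 1) (a 1 j),
    Fin.sum_univ_two]
  rfl

theorem dMat_eq_zero (hU : IsOpen U) (h : ∀ w ∈ U, ∀ i j, W w i j = 0) (hz : z ∈ U)
    (i j l : Fin 2) : dMat W z i j l = 0 := by
  have : (fun w => W w i j) =ᶠ[𝓝 z] fun _ => 0 := by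
    filter_upwards [hU.mem_nhds hz] with w hw
    exact h w hw i j
  rw [dMat, pd_congr this]
  simp [pd]

/-- The Jacobi identity for three systems of conservation laws, two of which commute. -/
theorem fluxG_commMat (hA : AnalyticAt ℝ A z) (hW : AnalyticAt ℝ W z) (hJ : AnalyticAt ℝ J z)
    (hcA : ∀ i j l, dMat A z i j l = dMat A z i l j)
    (hcW : ∀ i j l, dMat W z i j l = dMat W z i l j)
    (hcJ : ∀ i j l, dMat J z i j l = dMat J z i l j)
    (h : ∀ i j, commMat A W z i j = 0) (hd : ∀ i j l, dMat (commMat A W) z i j l = 0)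
    (i : Fin 2) (a : Pt) :
    ∑ j, ∑ l, fluxG A (commMat A J) W (commMat W J) (dMat (commMat A J)) (dMat (commMat W J))
      z i j l * a j * a l = 0 := by
  -- After the product rule and closedness of all three matrices, every surviving term contains the
  -- commutator of A and W or one of its derivatives.
  have key : ∑ j, ∑ l, fluxG A (commMat A J) W (commMat W J) (dMat (commMat A J))
      (dMat (commMat W J)) z i j l * a j * a l = ∑ j, ∑ l, ∑ m,
        (dMat (commMat A W) z i j m * J z m l + commMat A W z i m * dMat J z m j l
          - J z i m * dMat (commMat A W) z m j l) * a j * a l := by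
    simp only [fluxG, dMat_commMat hA hJ, dMat_commMat hW hJ, dMat_commMat hA hW, commMat,
      Fin.sum_univ_two, hcA _ 1 0, hcW _ 1 0, hcJ _ 1 0]
    ring
  rw [key]
  simp [h, hd]

theorem commMat_mA_mT (k : ℝ) (z : Pt) (i j : Fin 2) : commMat (mA k) (mT k) z i j = 0 := by
  fin_cases i <;> fin_cases j <;> simp [commMat, mA, mT, Fin.sum_univ_two] <;> ring

theorem CommuteUpToFirstOrder.commuteZero {C : QuadField} (hA : AnalyticOnNhd ℝ A U)
    (hB : AnalyticOnNhd ℝ B U) (hC : AnalyticOnNhd ℝ C U) (hW : AnalyticOnNhd ℝ W U)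
    (hB' : AnalyticOnNhd ℝ B' U) (hC' : AnalyticOnNhd ℝ C' U)
    (h : CommuteUpToFirstOrder U (firstOrder A B C) (firstOrder W B' C')) : CommuteZero A W U :=
  fun u hu x hx => ((commute_firstOrder_iff hA hB hC hW hB' hC').1 h u hu x hx).1

/-- The conditions on an extended symmetry, once its quadratic remainder is known to vanish. -/
theorem conditions_of_remainder (hA : AnalyticOnNhd ℝ A U) (hB : AnalyticOnNhd ℝ B U)
    (hW : AnalyticOnNhd ℝ W U) (hB' : AnalyticOnNhd ℝ B' U) (hC' : AnalyticOnNhd ℝ C' U)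
    (hcA : CurlFree A U) (hcW : CurlFree W U) (hU : IsOpen U)
    (h : CommuteUpToFirstOrder U (firstOrder A B (dMat B)) (firstOrder W B' C'))
    (hr : ∀ Q : QuadField, AnalyticOnNhd ℝ Q U →
      CommuteUpToFirstOrder U (firstOrder A B (dMat B)) (firstOrder W B' (dMat B' + Q)) →
      ∀ z ∈ U, z 0 ≠ 0 → ∀ i j l, Q z i j l + Q z i l j = 0) :
    (∀ z ∈ U, ∀ i j, fluxK A B W B' z i j = 0) ∧
    (∀ z ∈ U, ∀ i, ∀ a : Pt,
      ∑ j, ∑ l, fluxG A B W B' (dMat B) (dMat B') z i j l * a j * a l = 0) ∧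
    ∀ z ∈ U, ∀ i j l, C' z i j l + C' z i l j = dMat B' z i j l + dMat B' z i l j := by
  have e : C' = dMat B' + (C' - dMat B') := by abel
  have hQ : AnalyticOnNhd ℝ (C' - dMat B') U := fun z hz => (hC' z hz).sub (hB' z hz).dMat
  rw [e] at h
  have hQ0 : ∀ z ∈ U, ∀ i j l, (C' - dMat B') z i j l + (C' - dMat B') z i l j = 0 := by
    intro z hz i j l
    refine eq_zero_of_coord_ne_zero
      (f := fun w => (C' - dMat B') w i j l + (C' - dMat B') w i l j)
      (fun w hw => (((hQ w hw).entry₃ i j l).fun_add ((hQ w hw).entry₃ i l j)).continuousAt)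
      hU (fun w hw hw0 => hr _ hQ h w hw hw0 i j l) hz
  refine ⟨fun z hz i => (commute_necessary hA hB hW hB' hQ hcA hcW hU h hz i).1,
    fun z hz i a => flux_sym_zero hA hB hW hB' hQ hcA hcW hU h hz (hQ0 z hz) i a,
    fun z hz i j l => ?_⟩
  have := hQ0 z hz i j l
  simp only [Pi.sub_apply] at this
  linarith

/-- A deformation that admits an extension of the flow `(2,1)` is locally a commutator. -/
theorem exists_potential_of_commute (hk : k ≠ 0) (hk' : k ≠ 1) (hU : IsOpen U)
    (hB : AnalyticOnNhd ℝ B U) (hB' : AnalyticOnNhd ℝ B' U) (hC' : AnalyticOnNhd ℝ C' U)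
    (h : CommuteUpToFirstOrder U (firstOrder (mA k) B (dMat B)) (firstOrder (mT k) B' C'))
    {p : Pt} (hp : p ∈ U) :
    ∃ V : Set Pt, IsOpen V ∧ p ∈ V ∧ V ⊆ U ∧ ∃ M : Pt → Pt, AnalyticOnNhd ℝ M V ∧
      ∀ z ∈ V, ∀ i j, B z i j = commMat (mA k) (jac M) z i j := by
  have hA : AnalyticOnNhd ℝ (mA k) U := fun w _ => mA_analyticAt k w
  have hT : AnalyticOnNhd ℝ (mT k) U := fun w _ => mT_analyticAt k w
  obtain ⟨hK, hG, -⟩ := conditions_of_remainder hA hB hT hB' hC' (mA_curlFree k U)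
    (mT_curlFree k U) hU h fun Q hQ h z hz hz0 =>
      remainder_zero_mA hk hk' hB hT hB' hQ (mT_curlFree k U) hU h hz hz0
  have hP : IsPair k B B' U := ⟨hB, hB', hK, hG⟩
  refine exists_potential k hU hB (fun z hz => ?_) (fun z hz => ?_) hp
  · refine eq_zero_of_coord_ne_zero (f := fun z => B z 0 0 + B z 1 1)
      (fun w hw => AnalyticAt.continuousAt (𝕜 := ℝ) ?_) hU
      (fun w hw hw0 => (hP.traces_zero hU hw hw0 hk hk').1) hz
    exact ((hB w hw).entry 0 0).fun_add ((hB w hw).entry 1 1)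
  · refine eq_zero_of_coord_ne_zero
      (f := fun z => (2 * k - 1) * z 0 * B z 0 0 + B z 1 0 + k * (1 - k) * z 0 ^ 2 * B z 0 1)
      (fun w hw => AnalyticAt.continuousAt (𝕜 := ℝ) ?_) hU
      (fun w hw hw0 => (hP.traces_zero hU hw hw0 hk hk').2) hz
    have c := analyticAt_coord 0 w
    exact (((analyticAt_const.fun_mul c).fun_mul ((hB w hw).entry 0 0)).fun_add
      ((hB w hw).entry 1 0)).fun_add
      ((analyticAt_const.fun_mul (c.fun_pow 2)).fun_mul ((hB w hw).entry 0 1))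

theorem dMat_congr (hU : IsOpen U) (h : ∀ w ∈ U, ∀ i j, W w i j = Z w i j) (hz : z ∈ U)
    (i j l : Fin 2) : dMat W z i j l = dMat Z z i j l := by
  refine pd_congr ?_ l
  filter_upwards [hU.mem_nhds hz] with w hw
  exact h w hw i j

/-- An extended symmetry of a commutator deformation is given by the same potential. -/
theorem extension_eq_commMat (hk : k ≠ 0) (hk' : k ≠ 1) (hU : IsOpen U)
    (hW : AnalyticOnNhd ℝ W U) (hB' : AnalyticOnNhd ℝ B' U)
    (hJ : AnalyticOnNhd ℝ J U) (hcW : CurlFree W U) (hcJ : CurlFree J U)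
    (hc : ∀ z ∈ U, ∀ i j, commMat (mA k) W z i j = 0)
    (hBJ : ∀ z ∈ U, ∀ i j, B z i j = commMat (mA k) J z i j)
    (hK : ∀ z ∈ U, ∀ i j, fluxK (mA k) B W B' z i j = 0)
    (hG : ∀ z ∈ U, ∀ i, ∀ a : Pt,
      ∑ j, ∑ l, fluxG (mA k) B W B' (dMat B) (dMat B') z i j l * a j * a l = 0)
    (hz : z ∈ U) (i j : Fin 2) : B' z i j = commMat W J z i j := by
  have hA : AnalyticOnNhd ℝ (mA k) U := fun w _ => mA_analyticAt k w
  -- The commutator of W with J already solves the conditions by `fluxG_commMat`; the difference Z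
  -- solves the homogeneous ones, and it remains to show that these have only the zero solution.
  obtain ⟨Z, hZ⟩ : ∃ Z : MatField, Z = fun z i j => B' z i j - commMat W J z i j := ⟨_, rfl⟩
  have hZa : AnalyticOnNhd ℝ Z U := fun w hw => by
    rw [hZ]
    exact (hB' w hw).sub ((hW w hw).commMat (hJ w hw))
  have hZ' : ∀ w i j, B' w i j = commMat W J w i j + Z w i j := fun w i j => by rw [hZ]; ring
  have hdZ : ∀ w ∈ U, ∀ i j l, dMat B' w i j l = dMat (commMat W J) w i j l + dMat Z w i j l := by
    intro w hw i j l
    rw [dMat, funext fun y => hZ' y i j,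
      pd_add (((hW w hw).commMat (hJ w hw)).entry i j) ((hZa w hw).entry i j)]
    rfl
  -- By the Jacobi identity for matrices, as `mA k` commutes with W.
  have hcZ : ∀ w ∈ U, ∀ i j, commMat (mA k) Z w i j = 0 := by
    intro w hw i j
    have h1 := hK w hw i j
    have h2 := hc w hw
    have e : commMat (mA k) Z w i j = fluxK (mA k) B W B' w i j
        - ∑ m, (commMat (mA k) W w i m * J w m j - J w i m * commMat (mA k) W w m j) := by
      simp only [fluxK, hZ', hBJ w hw, commMat, Fin.sum_univ_two]
      ring
    rw [e, h1]
    simp [h2]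
  suffices h : ∀ w ∈ U, w 0 ≠ 0 → Z w 0 0 = 0 ∧ Z w 0 1 = 0 ∧ Z w 1 0 = 0 ∧ Z w 1 1 = 0 by
    rw [hZ']
    have : Z z i j = 0 := by
      refine eq_zero_of_coord_ne_zero (f := fun w => Z w i j)
        (fun w hw => ((hZa w hw).entry i j).continuousAt) hU (fun w hw hw0 => ?_) hz
      obtain ⟨h0, h1, h2, h3⟩ := h w hw hw0
      fin_cases i <;> fin_cases j <;> assumption
    rw [this, add_zero]
  intro w hw hw0
  have z00 : Z w 0 0 = Z w 1 1 + (2 * k - 1) * (w 0 * Z w 0 1) := by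
    have := hcZ w hw 0 1
    simp [commMat, mA, Fin.sum_univ_two] at this
    linear_combination -this
  have z10 : Z w 1 0 = k * (1 - k) * w 0 ^ 2 * Z w 0 1 := by
    have := hcZ w hw 0 0
    simp [commMat, mA, Fin.sum_univ_two] at this
    linear_combination this
  have hdc : ∀ i j l, dMat (commMat (mA k) Z) w i j l = 0 := dMat_eq_zero hU hcZ hw
  have hGZ : ∀ i (a : Pt), ∑ j, ∑ l, (∑ m, (mA k w i m * dMat Z w m j l - dMat Z w i j m
      * mA k w m l - Z w i m * dMat (mA k) w m j l)) * a j * a l = 0 := by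
    intro i a
    have h1 := hG w hw i a
    have h2 := fluxG_commMat (hA w hw) (hW w hw) (hJ w hw) (mA_curlFree k U w hw) (hcW w hw)
      (hcJ w hw) (hc w hw) (dMat_eq_zero hU hc hw) i a
    have hdB := dMat_congr hU hBJ hw
    simp only [fluxG, hdZ w hw, hZ', hdB, hBJ w hw, Fin.sum_univ_two] at h1 h2 ⊢
    linear_combination h1 - h2
  have dz10 : ∀ l, dMat Z w 1 0 l = k * (1 - k) * w 0 ^ 2 * dMat Z w 0 1 l
      + 2 * k * (1 - k) * w 0 * ![1, 0] l * Z w 0 1 := by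
    intro l
    have := hdc 0 0 l
    rw [dMat_commMat (hA w hw) (hZa w hw)] at this
    simp only [dMat_mA, Fin.sum_univ_two] at this
    fin_cases l <;> simp [mA] at this ⊢ <;> linear_combination this
  have dz00 : ∀ l, dMat Z w 0 0 l = dMat Z w 1 1 l + (2 * k - 1) * w 0 * dMat Z w 0 1 l
      + (2 * k - 1) * ![1, 0] l * Z w 0 1 := by
    intro l
    have := hdc 0 1 l
    rw [dMat_commMat (hA w hw) (hZa w hw)] at this
    simp only [dMat_mA, Fin.sum_univ_two] at this
    fin_cases l <;> simp [mA] at this ⊢ <;> linear_combination -this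
  -- On an eigenvector the homogeneous condition is μ ∂A(e,e) = 0, with μ the eigenvalue of Z. The
  -- second component of ∂A(e,e) is 2k(1-k)u for both eigenvectors, so both eigenvalues of Z vanish,
  -- and Z with them.
  have e1 := hGZ 1 ![1, (1 - k) * w 0]
  have e2 := hGZ 1 ![1, -k * w 0]
  simp only [dMat_mA, Fin.sum_univ_two, dz10, dz00] at e1 e2
  simp [mA, z10] at e1 e2
  have hc : 2 * k * (1 - k) * w 0 ≠ 0 :=
    mul_ne_zero (mul_ne_zero (mul_ne_zero two_ne_zero hk) (sub_ne_zero.2 hk'.symm)) hw0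
  have f1 : Z w 1 1 + k * w 0 * Z w 0 1 = 0 := by
    refine (mul_eq_zero.1 ?_).resolve_left hc
    linear_combination -e1
  have f2 : Z w 1 1 + (k - 1) * w 0 * Z w 0 1 = 0 := by
    refine (mul_eq_zero.1 ?_).resolve_left hc
    linear_combination -e2
  have f3 : Z w 0 1 = 0 := by
    refine (mul_eq_zero.1 ?_).resolve_left hw0
    linear_combination f1 - f2
  rw [f3] at f1 z00 z10
  have f4 : Z w 1 1 = 0 := by linear_combination f1
  rw [f4] at z00
  exact ⟨by linear_combination z00, f3, by linear_combination z10, f4⟩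

end

section
variable {B B₂ W : MatField} {a M : Pt → Pt} {U V : Set Pt} {k : ℝ}

theorem isDispersionlessSymmetry_iff_commuteZero (hU : IsOpen U) (ha : AnalyticOnNhd ℝ a U)
    (hB : AnalyticOnNhd ℝ B U) : IsDispersionlessSymmetry U (consLaw a B) W ↔
      AnalyticOnNhd ℝ W U ∧ CommuteZero (jac a) W U :=
  isDispersionlessSymmetry_iff hU ha (fun z hz => (ha z hz).jac) hB

theorem transformsTo_consLaw_of_comm (hV : IsOpen V) (ha : AnalyticOnNhd ℝ a V)
    (hB : AnalyticOnNhd ℝ B V) (hB₂ : AnalyticOnNhd ℝ B₂ V) (hM : AnalyticOnNhd ℝ M V)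
    (h : ∀ z ∈ V, ∀ i j, B z i j = B₂ z i j + commMat (jac a) (jac M) z i j) :
    TransformsTo V (miura id (jac M)) (consLaw a B) (consLaw a B₂) := by
  rw [transformsTo_consLaw_left hV ha hB, transformsTo_consLaw_right hV
    (fun z _ => analyticAt_id) (fun z hz => (hM z hz).jac) (Set.mapsTo_id V) ha hB₂]
  exact transformsTo_of_comm hV (fun z hz => (ha z hz).jac) hB (fun z hz => (hB z hz).dMat) hB₂ hM
    (jac_curlFree ha) (fun z _ i j l => rfl) h

theorem bijective_fderiv_id (z : Pt) : Function.Bijective (fderiv ℝ (id : Pt → Pt) z) := by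
  rw [fderiv_id]
  exact Function.bijective_id

theorem isMiuraTrivial_of_transformsTo {X : Evol} {N : MatField} (hV : IsOpen V)
    (ha : AnalyticOnNhd ℝ a V) (hN : AnalyticOnNhd ℝ N V)
    (h : TransformsTo V (miura id N) X (consLaw a 0)) : IsMiuraTrivial V X := by
  refine ⟨id, N, jac a, fun z _ => analyticAt_id, fun z _ => bijective_fderiv_id z, hN,
    fun z hz => ?_, ?_⟩
  · rw [Set.image_id] at hz
    exact (ha z hz).jac
  · rw [transformsTo_consLaw_right hV (fun z _ => analyticAt_id) hN (Set.mapsTo_id V) ha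
      (B := 0) (fun _ _ => analyticAt_const), dMat_zero] at h
    rwa [hydro_eq_firstOrder]

/-- Deformations of the flow `(1,0)` in the generic case. -/
theorem generic_trivial (hk : k ≠ 0) (hk' : k ≠ 1) (ha : ∀ z, AnalyticAt ℝ a z)
    (hja : jac a = mA k) (hU : IsOpen U) (hB : AnalyticOnNhd ℝ B U)
    (hI : IsIntegrable U (consLaw a B)) {p : Pt} (hp : p ∈ U) :
    ∃ V : Set Pt, IsOpen V ∧ p ∈ V ∧ V ⊆ U ∧ IsMiuraTrivial V (consLaw a B) ∧
      ∃ M : Pt → Pt, AnalyticOnNhd ℝ M V ∧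
        TransformsTo V (miura id (jac M)) (consLaw a B) (consLaw a 0) ∧
        ∀ (W B' : MatField) (C' : QuadField),
          AnalyticOnNhd ℝ W V → AnalyticOnNhd ℝ B' V → AnalyticOnNhd ℝ C' V →
          CommuteUpToFirstOrder V (consLaw a B) (firstOrder W B' C') →
          TransformsTo V (miura id (jac M)) (firstOrder W B' C') (hydro W) := by
  have hA : ∀ U : Set Pt, AnalyticOnNhd ℝ (mA k) U := fun U w _ => mA_analyticAt k w
  have hT : AnalyticOnNhd ℝ (mT k) U := fun w _ => mT_analyticAt k w
  -- Integrability is needed only for this one symmetry, the flow (2,1).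
  obtain ⟨B', C', hB', hC', h⟩ := hI (mT k) (by
    rw [isDispersionlessSymmetry_iff_commuteZero hU (fun z _ => ha z) hB, hja]
    exact ⟨hT, commuteZero_of (hA U) hT (mA_curlFree k U) (mT_curlFree k U) hU
      fun z _ => commMat_mA_mT k z⟩)
  rw [commute_iff hU (fun z _ => ha z) hB hT hB' hC', hja] at h
  obtain ⟨V, hV, hpV, hVU, M, hM, hBM⟩ := exists_potential_of_commute hk hk' hU hB hB' hC' h hp
  have hBV : AnalyticOnNhd ℝ B V := fun z hz => hB z (hVU hz)
  have h0 : AnalyticOnNhd ℝ (0 : MatField) V := fun _ _ => analyticAt_const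
  have t0 : TransformsTo V (miura id (jac M)) (consLaw a B) (consLaw a 0) :=
    transformsTo_consLaw_of_comm hV (fun z _ => ha z) hBV h0 hM fun z hz i j => by
      rw [hja, hBM z hz]
      simp
  have hJ : AnalyticOnNhd ℝ (jac M) V := fun z hz => (hM z hz).jac
  refine ⟨V, hV, hpV, hVU, isMiuraTrivial_of_transformsTo hV (fun z _ => ha z) hJ t0, M, hM, t0,
    fun W B' C' hW hB' hC' hc => ?_⟩
  rw [commute_iff hV (fun z _ => ha z) hBV hW hB' hC', hja] at hc
  obtain ⟨hAW, hcW⟩ := (hc.commuteZero (hA V) hBV (fun z hz => (hBV z hz).dMat) hW hB'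
    hC').comm_and_curlFree (hA V) hW (mA_curlFree k V) hV (fun z _ => by simp [mA])
  obtain ⟨hK, hG, hQ⟩ := conditions_of_remainder (hA V) hBV hW hB' hC' (mA_curlFree k V) hcW hV hc
    fun Q hQ h z hz hz0 => remainder_zero_mA hk hk' hBV hW hB' hQ hcW hV h hz hz0
  have := transformsTo_of_comm (B₂ := 0) hV hW hB' hC' h0 hM hcW hQ fun z hz i j => by
    rw [extension_eq_commMat hk hk' hV hW hB' hJ hcW (jac_curlFree hM) hAW hBM hK hG hz]
    simp
  rwa [dMat_zero, ← hydro_eq_firstOrder] at this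
end

/-! ### Invariance of the trace of a deformation -/

section
variable {W B N W' B' : MatField} {C C' : QuadField} {F a : Pt → Pt} {V : Set Pt} {z : Pt}

theorem deriv_comp_eq_mulV {u : ℝ → Pt} {x : ℝ} (hu : SmoothAt u x)
    (hF : AnalyticAt ℝ F (u x)) : deriv (F ∘ u) x = mulV (jac F) u (deriv u) x := by
  refine HasDerivAt.deriv (hasDerivAt_pi.2 fun i => ?_)
  exact hasDerivAt_comp_pd (analyticAt_pi_iff.1 hF i) hu.hasDerivAt

/-- Curves with u_xx = 0 give the intertwining of W and W' at order zero; curves with u_x = 0 kill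
every quadratic term and leave the u_xx-coefficient at order one. -/
theorem transformsTo_jet (hF : AnalyticOnNhd ℝ F V) (hN : AnalyticOnNhd ℝ N V)
    (hW : AnalyticOnNhd ℝ W V) (hB : AnalyticOnNhd ℝ B V) (hC : AnalyticOnNhd ℝ C V)
    (hW' : AnalyticOnNhd ℝ W' (F '' V)) (hB' : AnalyticOnNhd ℝ B' (F '' V))
    (hC' : AnalyticOnNhd ℝ C' (F '' V))
    (h : TransformsTo V (miura F N) (firstOrder W B C) (firstOrder W' B' C')) (hz : z ∈ V) :
    (∀ i j, ∑ l, jac F z i l * W z l j = ∑ l, W' (F z) i l * jac F z l j) ∧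
    ∀ i j, ∑ l, (jac F z i l * B z l j + N z i l * W z l j)
      = ∑ l, (W' (F z) i l * N z l j + B' (F z) i l * jac F z l j) := by
  have main : ∀ a b : Pt, _ := fun a b => by
    have hx : jetCurve z a b 0 0 ∈ V := by rwa [jetCurve_zero]
    have hu := jetCurve_contDiff z a b 0
    have hm := Set.mem_image_of_mem F hx
    exact (transform_iff hu.contDiffAt (hF _ hx) (hN _ hx) (hW _ hx) (hB _ hx) (hC _ hx)
      (hW' _ hm) (hB' _ hm) (hC' _ hm)).1 (h _ hu 0 hx)
  have d1 : ∀ a b, deriv (jetCurve z a b 0) 0 = a := fun a b => by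
    rw [jetCurve_deriv, jetCurve_zero]
  have d2 : ∀ a b, deriv (deriv (jetCurve z a b 0)) 0 = b := fun a b => by
    rw [jetCurve_deriv, jetCurve_deriv, jetCurve_zero]
  have hs : ∀ a b, SmoothAt (jetCurve z a b 0) 0 := fun a b => (jetCurve_contDiff z a b 0).contDiffAt
  have m : ∀ a b, jetCurve z a b 0 0 ∈ V := fun a b => by rwa [jetCurve_zero]
  have f1 : ∀ a b, deriv (F ∘ jetCurve z a b 0) 0 = mulV (jac F) (jetCurve z a b 0)
      (deriv (jetCurve z a b 0)) 0 := fun a b => deriv_comp_eq_mulV (hs a b) (hF _ (m a b))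
  have f2 : ∀ a b, deriv (deriv (F ∘ jetCurve z a b 0)) 0 = deriv (mulV (jac F) (jetCurve z a b 0)
      (deriv (jetCurve z a b 0))) 0 := fun a b => by
    refine EventuallyEq.deriv_eq ?_
    filter_upwards [(hs a b).continuousAt.eventually (hF _ (m a b)).eventually_analyticAt]
      with y hy
    exact deriv_comp_eq_mulV (jetCurve_contDiff z a b 0).contDiffAt hy
  constructor
  · intro i j
    have := congrFun (main (Pi.single j 1) 0).1 i
    simp only [mulV_apply, f1, Function.comp_apply, jetCurve_zero, d1] at this
    fin_cases j <;> simpa [Fin.sum_univ_two] using this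
  · intro i j
    have := congrFun (main 0 (Pi.single j 1)).2 i
    simp only [corr, varV, Pi.add_apply, mulV_apply, quadV_apply, f2,
      (hs _ _).deriv_mulV (hF _ (m _ _)).jac (hs _ _).derivAt,
      (hs _ _).deriv_mulV (hW _ (m _ _)) (hs _ _).derivAt,
      (hs _ _).deriv_mulV (hN _ (m _ _)) (hs _ _).derivAt, f1, Function.comp_apply,
      jetCurve_zero, d1, d2] at this
    fin_cases j <;> simp [Fin.sum_univ_two] at this ⊢ <;> linear_combination this

theorem jac_mulVec (hF : AnalyticAt ℝ F z) (v : Pt) :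
    (Matrix.of (jac F z)).mulVec v = fderiv ℝ F z v := by
  funext i
  have h1 : fderiv ℝ F z v i = fderiv ℝ (fun w => F w i) z v := by
    have := hasFDerivAt_pi'.1 hF.differentiableAt.hasFDerivAt i
    rw [this.fderiv]
    rfl
  rw [h1, fderiv_eq_sum_pd]
  rfl

/-- With P = jac F, the two jet identities give B = P⁻¹B'P + [W, P⁻¹N], and the trace of a
commutator is zero. -/
theorem TransformsTo.trace_eq (hF : AnalyticOnNhd ℝ F V) (hN : AnalyticOnNhd ℝ N V)
    (hW : AnalyticOnNhd ℝ W V) (hB : AnalyticOnNhd ℝ B V) (hC : AnalyticOnNhd ℝ C V)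
    (hW' : AnalyticOnNhd ℝ W' (F '' V)) (hB' : AnalyticOnNhd ℝ B' (F '' V))
    (hC' : AnalyticOnNhd ℝ C' (F '' V))
    (h : TransformsTo V (miura F N) (firstOrder W B C) (firstOrder W' B' C')) (hz : z ∈ V)
    (hFz : Function.Bijective (fderiv ℝ F z)) :
    B z 0 0 + B z 1 1 = B' (F z) 0 0 + B' (F z) 1 1 := by
  obtain ⟨h0, h1⟩ := transformsTo_jet hF hN hW hB hC hW' hB' hC' h hz
  obtain ⟨P, hP⟩ : ∃ P : Matrix (Fin 2) (Fin 2) ℝ, P = Matrix.of (jac F z) := ⟨_, rfl⟩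
  have hu : IsUnit P := by
    rw [← Matrix.mulVec_surjective_iff_isUnit, hP]
    intro w
    obtain ⟨v, hv⟩ := hFz.2 w
    exact ⟨v, (jac_mulVec (hF z hz) v).trans hv⟩
  have hd : IsUnit P.det := (Matrix.isUnit_iff_isUnit_det P).1 hu
  have m0 : P * Matrix.of (W z) = Matrix.of (W' (F z)) * P := by
    ext i j
    rw [hP]
    exact h0 i j
  have m1 : P * Matrix.of (B z) + Matrix.of (N z) * Matrix.of (W z)
      = Matrix.of (W' (F z)) * Matrix.of (N z) + Matrix.of (B' (F z)) * P := by
    ext i j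
    rw [hP]
    simpa [Matrix.mul_apply, Finset.sum_add_distrib] using h1 i j
  have m2 : Matrix.of (W z) * P⁻¹ = P⁻¹ * Matrix.of (W' (F z)) := by
    calc Matrix.of (W z) * P⁻¹ = P⁻¹ * (P * Matrix.of (W z)) * P⁻¹ := by
          rw [← mul_assoc, Matrix.nonsing_inv_mul P hd, one_mul]
      _ = P⁻¹ * Matrix.of (W' (F z)) := by
          rw [m0, mul_assoc, mul_assoc, Matrix.mul_nonsing_inv P hd, mul_one]
  have m3 : Matrix.of (B z) = Matrix.of (W z) * (P⁻¹ * Matrix.of (N z))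
      - (P⁻¹ * Matrix.of (N z)) * Matrix.of (W z) + P⁻¹ * (Matrix.of (B' (F z)) * P) := by
    calc Matrix.of (B z) = P⁻¹ * (P * Matrix.of (B z)) := by
          rw [← mul_assoc, Matrix.nonsing_inv_mul P hd, one_mul]
      _ = _ := by
          rw [eq_sub_of_add_eq m1, mul_sub, mul_add, ← mul_assoc, ← m2]
          noncomm_ring
  have m4 := congrArg Matrix.trace m3
  rw [Matrix.trace_add, Matrix.trace_sub, Matrix.trace_mul_comm (Matrix.of (W z)), sub_self,
    zero_add, Matrix.trace_mul_comm P⁻¹, mul_assoc, Matrix.mul_nonsing_inv P hd, mul_one,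
    Matrix.trace_fin_two, Matrix.trace_fin_two] at m4
  exact m4

theorem trace_eq_of_transformsTo_consLaw {B₂ : MatField} (hV : IsOpen V)
    (ha : AnalyticOnNhd ℝ a V) (hB : AnalyticOnNhd ℝ B V) (hB₂ : AnalyticOnNhd ℝ B₂ V)
    (hN : AnalyticOnNhd ℝ N V)
    (h : TransformsTo V (miura id N) (consLaw a B) (consLaw a B₂)) (hz : z ∈ V) :
    B z 0 0 + B z 1 1 = B₂ z 0 0 + B₂ z 1 1 := by
  have hid : AnalyticOnNhd ℝ (id : Pt → Pt) V := fun z _ => analyticAt_id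
  have hA : AnalyticOnNhd ℝ (jac a) V := fun z hz => (ha z hz).jac
  rw [transformsTo_consLaw_left hV ha hB, transformsTo_consLaw_right hV hid hN
    (Set.mapsTo_id V) ha hB₂] at h
  refine h.trace_eq hid hN hA hB (fun z hz => (hB z hz).dMat) ?_ ?_ ?_ hz (bijective_fderiv_id z)
  · rwa [Set.image_id]
  · rwa [Set.image_id]
  · rw [Set.image_id]
    exact fun z hz => (hB₂ z hz).dMat

theorem trace_eq_zero_of_isMiuraTrivial (hV : IsOpen V) (ha : AnalyticOnNhd ℝ a V)
    (hB : AnalyticOnNhd ℝ B V) (h : IsMiuraTrivial V (consLaw a B)) (hz : z ∈ V) :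
    B z 0 0 + B z 1 1 = 0 := by
  obtain ⟨F, N, A, hF, hFb, hN, hA, h⟩ := h
  rw [transformsTo_consLaw_left hV ha hB, hydro_eq_firstOrder] at h
  have := h.trace_eq hF hN (fun z hz => (ha z hz).jac) hB (fun z hz => (hB z hz).dMat) hA
    (fun _ _ => analyticAt_const) (fun _ _ => analyticAt_const) hz (hFb z hz)
  simpa using this

theorem isMiuraTrivial_of_eq_zero (hV : IsOpen V) (ha : AnalyticOnNhd ℝ a V)
    (hB : AnalyticOnNhd ℝ B V) (h : ∀ z ∈ V, ∀ i j, B z i j = 0) :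
    IsMiuraTrivial V (consLaw a B) := by
  have h0 : AnalyticOnNhd ℝ (0 : MatField) V := fun _ _ => analyticAt_const
  have hM : AnalyticOnNhd ℝ (0 : Pt → Pt) V := fun _ _ => analyticAt_const
  have hj : jac (0 : Pt → Pt) = 0 := by
    funext z i j
    simp [jac, pd]
  refine isMiuraTrivial_of_transformsTo hV ha (fun z hz => (hM z hz).jac)
    (transformsTo_consLaw_of_comm hV ha hB h0 hM fun z hz i j => ?_)
  rw [h z hz, hj]
  simp [commMat]
end

/-! ### Normal forms in the exceptional cases -/

section
variable {B B' B₁ B₂ : MatField} {a : Pt → Pt} {F : ℝ → ℝ} {f : Pt → ℝ} {U V : Set Pt} {z p : Pt}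
  {k s : ℝ}

/-- A function that is constant along the curves `s u² / 2 + v = const` depends on `s u² / 2 + v`
only. -/
theorem exists_eq_comp (hU : IsOpen U) (hf : AnalyticOnNhd ℝ f U)
    (h : ∀ z ∈ U, pd 0 f z = s * z 0 * pd 1 f z) (hp : p ∈ U) :
    ∃ V : Set Pt, IsOpen V ∧ p ∈ V ∧ V ⊆ U ∧ ∃ F : ℝ → ℝ,
      (∀ z ∈ V, AnalyticAt ℝ F (s * z 0 ^ 2 / 2 + z 1)) ∧
      ∀ z ∈ V, f z = F (s * z 0 ^ 2 / 2 + z 1) := by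
  -- Φ moves z along its curve s u²/2 + v = const to the abscissa σ. Since f is constant along it, F
  -- may be read off on the vertical line u = p₀.
  let Φ : ℝ → Pt → Pt := fun σ z => ![σ, s * z 0 ^ 2 / 2 + z 1 - s * σ ^ 2 / 2]
  have hself : ∀ z, Φ (z 0) z = z := by
    intro z
    funext i
    fin_cases i <;> simp [Φ]
  have hc : Continuous fun q : ℝ × Pt => Φ q.1 q.2 := by
    refine continuous_pi fun i => ?_
    fin_cases i <;> simp [Φ] <;> fun_prop
  have hn : ∀ᶠ q in 𝓝 ((p 0, p) : ℝ × Pt), Φ q.1 q.2 ∈ U :=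
    hc.continuousAt.eventually (hU.mem_nhds (by simpa [hself] using hp))
  obtain ⟨ρ, hρ, hball⟩ := Metric.eventually_nhds_iff.1 hn
  have hΦ : ∀ σ ∈ Metric.ball (p 0) ρ, ∀ z ∈ Metric.ball p ρ, Φ σ z ∈ U := fun σ hσ z hz =>
    hball (y := (σ, z)) (max_lt hσ hz)
  have h0 : ∀ z ∈ Metric.ball p ρ, z 0 ∈ Metric.ball (p 0) ρ := fun z hz =>
    (dist_le_pi_dist z p 0).trans_lt hz
  refine ⟨Metric.ball p ρ, Metric.isOpen_ball, Metric.mem_ball_self hρ, fun z hz => ?_,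
    fun t => f ![p 0, t - s * p 0 ^ 2 / 2], fun z hz => ?_, fun z hz => ?_⟩
  · have := hΦ _ (h0 z hz) z hz
    rwa [hself] at this
  · have hg : AnalyticAt ℝ (fun t : ℝ => (![p 0, t - s * p 0 ^ 2 / 2] : Pt))
        (s * z 0 ^ 2 / 2 + z 1) := by
      refine analyticAt_pi_iff.2 fun i => ?_
      fin_cases i <;> simp <;> fun_prop
    exact AnalyticAt.comp (g := f) (hf _ (hΦ _ (Metric.mem_ball_self hρ) z hz)) hg
  · have hd : ∀ σ ∈ Metric.ball (p 0) ρ, HasDerivAt (fun σ => f (Φ σ z)) 0 σ := by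
      intro σ hσ
      have hm := hΦ σ hσ z hz
      have hΦ' : HasDerivAt (fun σ => Φ σ z) ![1, -(s * σ)] σ := by
        refine hasDerivAt_pi.2 fun i => ?_
        fin_cases i
        · exact hasDerivAt_id σ
        · refine ((((hasDerivAt_pow 2 σ).const_mul s).div_const 2).const_sub
            (s * z 0 ^ 2 / 2 + z 1)).congr_deriv ?_
          simp
          ring
      refine (hasDerivAt_comp_pd (u := fun σ => Φ σ z) (hf _ hm) hΦ').congr_deriv ?_
      rw [Fin.sum_univ_two, h _ hm]
      simp [Φ]
      ring
    have := Metric.isOpen_ball.is_const_of_deriv_eq_zero (convex_ball (p 0) ρ).isPreconnected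
      (fun σ hσ => (hd σ hσ).differentiableAt.differentiableWithinAt)
      (fun σ hσ => (hd σ hσ).deriv) (h0 z hz) (Metric.mem_ball_self hρ)
    rw [hself] at this
    exact this

/-- Two deformations of the flow `(2,1)` with the same traces are locally equivalent. -/
theorem exists_transform (ha : ∀ z, AnalyticAt ℝ a z) (hja : jac a = mT k) (hU : IsOpen U)
    (hu : ∀ z ∈ U, z 0 ≠ 0) (h₁ : AnalyticOnNhd ℝ B₁ U) (h₂ : AnalyticOnNhd ℝ B₂ U)
    (ht : ∀ z ∈ U, B₁ z 0 0 + B₁ z 1 1 = B₂ z 0 0 + B₂ z 1 1)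
    (hA : ∀ z ∈ U, (2 * k - 1) * z 0 * B₁ z 0 0 + B₁ z 1 0 + k * (1 - k) * z 0 ^ 2 * B₁ z 0 1
      = (2 * k - 1) * z 0 * B₂ z 0 0 + B₂ z 1 0 + k * (1 - k) * z 0 ^ 2 * B₂ z 0 1)
    (hp : p ∈ U) :
    ∃ V : Set Pt, IsOpen V ∧ p ∈ V ∧ V ⊆ U ∧ ∃ M : Pt → Pt, AnalyticOnNhd ℝ M V ∧
      TransformsTo V (miura id (jac M)) (consLaw a B₁) (consLaw a B₂) := by
  -- Because [T, J] = u [A, J], the difference is divided by u, after which the Cauchy problem for A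
  -- applies.
  have hB : AnalyticOnNhd ℝ (fun z i j => (B₁ z i j - B₂ z i j) / z 0 : MatField) U :=
    fun z hz => analyticAt_mat fun i j => (((h₁ z hz).entry i j).fun_sub
      ((h₂ z hz).entry i j)).fun_div (analyticAt_coord 0 z) (hu z hz)
  obtain ⟨V, hV, hpV, hVU, M, hM, h⟩ := exists_potential k hU hB (fun z hz => by
      have h0 := hu z hz
      have := ht z hz
      field_simp
      linear_combination this) (fun z hz => by
      have h0 := hu z hz
      have := hA z hz
      field_simp
      linear_combination this) hp
  refine ⟨V, hV, hpV, hVU, M, hM, transformsTo_consLaw_of_comm hV (fun z _ => ha z)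
    (fun z hz => h₁ z (hVU hz)) (fun z hz => h₂ z (hVU hz)) hM fun z hz i j => ?_⟩
  have e : commMat (jac a) (jac M) z i j = z 0 * commMat (mA k) (jac M) z i j := by
    rw [hja]
    fin_cases i <;> fin_cases j <;> simp [commMat, mA, mT, Fin.sum_univ_two] <;> ring
  rw [e, ← h z hz, mul_div_cancel₀ _ (hu z (hVU hz))]
  ring

theorem commMat_mT_mA (k : ℝ) (z : Pt) (i j : Fin 2) : commMat (mT k) (mA k) z i j = 0 := by
  fin_cases i <;> fin_cases j <;> simp [commMat, mA, mT, Fin.sum_univ_two] <;> ring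

/-- The symmetry to extend is `mA k`. The bracket is antisymmetric, so exchanging the roles of the
two flows only changes signs. -/
theorem exists_isPair (ha : ∀ z, AnalyticAt ℝ a z) (hja : jac a = mT k) (hk : k + 1 ≠ 0)
    (hk' : k - 2 ≠ 0) (hU : IsOpen U) (hB' : AnalyticOnNhd ℝ B' U)
    (h : IsIntegrable U (consLaw a B')) : ∃ B, IsPair k B B' U := by
  have hA : AnalyticOnNhd ℝ (mA k) U := fun w _ => mA_analyticAt k w
  have hT : AnalyticOnNhd ℝ (mT k) U := fun w _ => mT_analyticAt k w
  obtain ⟨B, C, hB, hC, h⟩ := h (mA k) (by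
    rw [isDispersionlessSymmetry_iff_commuteZero hU (fun z _ => ha z) hB', hja]
    exact ⟨hA, commuteZero_of hT hA (mT_curlFree k U) (mA_curlFree k U) hU
      fun z _ => commMat_mT_mA k z⟩)
  rw [commute_iff hU (fun z _ => ha z) hB' hA hB hC, hja] at h
  obtain ⟨hK, hG, -⟩ := conditions_of_remainder hT hB' hA hB hC (mT_curlFree k U)
    (mA_curlFree k U) hU h fun Q hQ h z hz hz0 =>
      remainder_zero_mT hk hk' hB' hA hB hQ (mA_curlFree k U) hU h hz hz0
  refine ⟨B, hB, hB', fun z hz i j => ?_, fun z hz i a => ?_⟩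
  · rw [fluxK_swap, hK z hz, neg_zero]
  · have := hG z hz i a
    simp only [Fin.sum_univ_two, fluxG_swap (mA k) B (mT k) B'] at this ⊢
    linear_combination -this

theorem IsPair.pd_sub_eq (h : IsPair k B B' U) (hz : z ∈ U) (i j l : Fin 2) :
    pd l (fun w => B' w i j - w 0 * B w i j) z
      = dMat B' z i j l - (![1, 0] l * B z i j + z 0 * dMat B z i j l) := by
  have c := analyticAt_coord 0 z
  have b := (h.analytic z hz).entry i j
  rw [pd_sub ((h.analytic' z hz).entry i j) (c.fun_mul b), pd_mul_mat c b,
    pd_of_hasFDerivAt (f := fun w : Pt => w 0) (a := 1) (b := 0) ((hasFDerivAt_coord 0 z).congr_fderiv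
      (by ext v; simp [lin2])) l]
  rfl

theorem normalFormPlus_analytic (hF : ∀ z ∈ U, AnalyticAt ℝ F (rPlus z)) :
    AnalyticOnNhd ℝ (normalFormPlus F) U := by
  intro z hz
  have c0 := analyticAt_coord 0 z
  have c1 := analyticAt_coord 1 z
  have hr : AnalyticAt ℝ rPlus z := ((c0.fun_pow 2).fun_div analyticAt_const two_ne_zero).fun_add c1
  have hFr : AnalyticAt ℝ (fun z => F (rPlus z)) z := (hF z hz).comp hr
  refine analyticAt_mat fun i j => ?_
  fin_cases i <;> fin_cases j
  · exact analyticAt_const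
  · exact analyticAt_const
  · exact hFr.fun_mul (c0.fun_pow 2)
  · exact hFr.fun_mul c0

theorem normalFormMinus_analytic (hF : ∀ z ∈ U, AnalyticAt ℝ F (rMinus z)) :
    AnalyticOnNhd ℝ (normalFormMinus F) U := by
  intro z hz
  have c0 := analyticAt_coord 0 z
  have c1 := analyticAt_coord 1 z
  have hr : AnalyticAt ℝ rMinus z :=
    ((c0.fun_pow 2).fun_div analyticAt_const two_ne_zero).fun_neg.fun_add c1
  have hFr : AnalyticAt ℝ (fun z => F (rMinus z)) z := (hF z hz).comp hr
  refine analyticAt_mat fun i j => ?_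
  fin_cases i <;> fin_cases j
  · exact hFr.fun_mul c0
  · exact analyticAt_const
  · exact analyticAt_const
  · exact analyticAt_const

/-- For k = 1 the eigenvalue of B' - uB on e₂ is γ and must vanish, while the one on e₁ = (1,0),
namely uδ, may survive. The mixed condition then says that δ is constant along e₂ = (1,-u), so it is
a function of r. -/
theorem exists_normalFormPlus (ha : ∀ z, AnalyticAt ℝ a z) (hja : jac a = mT 1) (hU : IsOpen U)
    (hu : ∀ z ∈ U, z 0 ≠ 0) (hB' : AnalyticOnNhd ℝ B' U) (h : IsIntegrable U (consLaw a B'))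
    (hp : p ∈ U) :
    ∃ V : Set Pt, IsOpen V ∧ p ∈ V ∧ V ⊆ U ∧ ∃ (F : ℝ → ℝ) (M : Pt → Pt),
      AnalyticOnNhd ℝ F (rPlus '' V) ∧ AnalyticOnNhd ℝ M V ∧
      TransformsTo V (miura id (jac M)) (consLaw a B') (consLaw a (normalFormPlus F)) := by
  obtain ⟨B, hP⟩ := exists_isPair ha hja (by norm_num) (by norm_num) hU hB' h
  have hγ : ∀ z ∈ U, B' z 1 1 - z 0 * B z 1 1 = 0 := fun z hz => by
    have := hP.eigenvalue_two hU hz (hu z hz) one_ne_zero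
    linear_combination this
  have hδ : AnalyticOnNhd ℝ (fun z => B' z 0 1 - z 0 * B z 0 1) U := fun z hz =>
    ((hP.analytic' z hz).entry 0 1).fun_sub
      ((analyticAt_coord 0 z).fun_mul ((hP.analytic z hz).entry 0 1))
  have hpd : ∀ z ∈ U, pd 0 (fun z => B' z 0 1 - z 0 * B z 0 1) z
      = 1 * z 0 * pd 1 (fun z => B' z 0 1 - z 0 * B z 0 1) z := by
    intro z hz
    have m := (hP.mixed hU hz (hu z hz) (hP.pd_sub_eq hz 1 1) (hP.pd_sub_eq hz 0 1)).1
    have g : ∀ l, pd l (fun w => B' w 1 1 - w 0 * B w 1 1) z = 0 := fun l => by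
      have : (fun w => B' w 1 1 - w 0 * B w 1 1) =ᶠ[𝓝 z] fun _ => 0 := by
        filter_upwards [hU.mem_nhds hz] with w hw
        exact hγ w hw
      rw [pd_congr this]
      simp [pd]
    rw [g, g] at m
    refine mul_left_cancel₀ (hu z hz) ?_
    linear_combination m
  obtain ⟨V, hV, hpV, hVU, F, hF, hFδ⟩ := exists_eq_comp hU hδ hpd hp
  have hr : ∀ z : Pt, 1 * z 0 ^ 2 / 2 + z 1 = rPlus z := fun z => by rw [rPlus, one_mul]
  simp only [hr] at hF hFδ
  have hF2 : ∀ z ∈ V, AnalyticAt ℝ (fun t => 2 * F t) (rPlus z) := fun z hz =>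
    analyticAt_const.fun_mul (hF z hz)
  -- The relations along e₁ and e₂ give u tr B = uδ, hence tr B' = u tr B + uδ = 2uδ. Matching this
  -- with the trace of the normal form accounts for the factor 2.
  obtain ⟨V', hV', hpV', hVV', M, hM, hT⟩ := exists_transform (B₁ := B')
    (B₂ := normalFormPlus fun t => 2 * F t) (p := p) ha hja hV
    (fun z hz => hu z (hVU hz)) (fun z hz => hB' z (hVU hz)) (normalFormPlus_analytic hF2)
    (fun z hz => by
      have e := (hP.entry_eq (hVU hz)).1
      have e1 := (hP.eigenvector_one hU (hVU hz)).1
      have e2 := (hP.eigenvector_two hU (hVU hz)).1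
      have g := hγ z (hVU hz)
      have d := hFδ z hz
      simp only [normalFormPlus]
      simp
      rw [← d]
      linear_combination e + e1 - e2 + 2 * g)
    (fun z hz => by
      have e := hP.entry_eq (hVU hz)
      have e1 := (hP.eigenvector_one hU (hVU hz)).1
      have g := hγ z (hVU hz)
      have d := hFδ z hz
      simp only [normalFormPlus]
      simp
      rw [← d]
      linear_combination z 0 * e.1 + e.2 + z 0 * e1 + 2 * z 0 * g) hpV
  refine ⟨V', hV', hpV', hVV'.trans hVU, fun t => 2 * F t, M, ?_, hM, hT⟩
  rintro _ ⟨z, hz, rfl⟩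
  exact hF2 z (hVV' hz)

/-- The mirror case k = 0: the eigenvalue on e₁ forces γ = 0, and δ is constant along e₁ = (1,u).
Here tr B' = -2uδ, whence the factor -2. -/
theorem exists_normalFormMinus (ha : ∀ z, AnalyticAt ℝ a z) (hja : jac a = mT 0) (hU : IsOpen U)
    (hu : ∀ z ∈ U, z 0 ≠ 0) (hB' : AnalyticOnNhd ℝ B' U) (h : IsIntegrable U (consLaw a B'))
    (hp : p ∈ U) :
    ∃ V : Set Pt, IsOpen V ∧ p ∈ V ∧ V ⊆ U ∧ ∃ (F : ℝ → ℝ) (M : Pt → Pt),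
      AnalyticOnNhd ℝ F (rMinus '' V) ∧ AnalyticOnNhd ℝ M V ∧
      TransformsTo V (miura id (jac M)) (consLaw a B') (consLaw a (normalFormMinus F)) := by
  obtain ⟨B, hP⟩ := exists_isPair ha hja (by norm_num) (by norm_num) hU hB' h
  have hγ : ∀ z ∈ U, B' z 1 1 - z 0 * B z 1 1 = 0 := fun z hz => by
    have := hP.eigenvalue_one hU hz (hu z hz) zero_ne_one
    linear_combination this
  have hδ : AnalyticOnNhd ℝ (fun z => B' z 0 1 - z 0 * B z 0 1) U := fun z hz =>
    ((hP.analytic' z hz).entry 0 1).fun_sub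
      ((analyticAt_coord 0 z).fun_mul ((hP.analytic z hz).entry 0 1))
  have hpd : ∀ z ∈ U, pd 0 (fun z => B' z 0 1 - z 0 * B z 0 1) z
      = (-1) * z 0 * pd 1 (fun z => B' z 0 1 - z 0 * B z 0 1) z := by
    intro z hz
    have m := (hP.mixed hU hz (hu z hz) (hP.pd_sub_eq hz 1 1) (hP.pd_sub_eq hz 0 1)).2
    have g : ∀ l, pd l (fun w => B' w 1 1 - w 0 * B w 1 1) z = 0 := fun l => by
      have : (fun w => B' w 1 1 - w 0 * B w 1 1) =ᶠ[𝓝 z] fun _ => 0 := by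
        filter_upwards [hU.mem_nhds hz] with w hw
        exact hγ w hw
      rw [pd_congr this]
      simp [pd]
    rw [g, g] at m
    refine mul_left_cancel₀ (hu z hz) ?_
    linear_combination -m
  obtain ⟨V, hV, hpV, hVU, F, hF, hFδ⟩ := exists_eq_comp hU hδ hpd hp
  have hr : ∀ z : Pt, (-1) * z 0 ^ 2 / 2 + z 1 = rMinus z := fun z => by rw [rMinus]; ring
  simp only [hr] at hF hFδ
  have hF2 : ∀ z ∈ V, AnalyticAt ℝ (fun t => -2 * F t) (rMinus z) := fun z hz =>
    analyticAt_const.fun_mul (hF z hz)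
  obtain ⟨V', hV', hpV', hVV', M, hM, hT⟩ := exists_transform (B₁ := B')
    (B₂ := normalFormMinus fun t => -2 * F t) (p := p) ha hja hV
    (fun z hz => hu z (hVU hz)) (fun z hz => hB' z (hVU hz)) (normalFormMinus_analytic hF2)
    (fun z hz => by
      have e := (hP.entry_eq (hVU hz)).1
      have e1 := (hP.eigenvector_one hU (hVU hz)).1
      have e2 := (hP.eigenvector_two hU (hVU hz)).1
      have g := hγ z (hVU hz)
      have d := hFδ z hz
      simp only [normalFormMinus]
      simp
      rw [← d]
      linear_combination e + e1 - e2 + 2 * g)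
    (fun z hz => by
      have e := hP.entry_eq (hVU hz)
      have e2 := (hP.eigenvector_two hU (hVU hz)).1
      have g := hγ z (hVU hz)
      have d := hFδ z hz
      simp only [normalFormMinus]
      simp
      rw [← d]
      linear_combination -z 0 * e.1 + e.2 + z 0 * e2 - 2 * z 0 * g) hpV
  refine ⟨V', hV', hpV', hVV'.trans hVU, fun t => -2 * F t, M, ?_, hM, hT⟩
  rintro _ ⟨z, hz, rfl⟩
  exact hF2 z (hVV' hz)
end

theorem pd_coord (z : Pt) (l : Fin 2) : pd l (fun w : Pt => w 0) z = ![1, 0] l :=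
  pd_of_hasFDerivAt (f := fun w : Pt => w 0) (a := 1) (b := 0)
    ((hasFDerivAt_coord 0 z).congr_fderiv (by ext v; simp [lin2])) l

theorem pd_coord_mul {z : Pt} {f : Pt → ℝ} (hf : AnalyticAt ℝ f z) (l : Fin 2) :
    pd l (fun w => w 0 * f w) z = ![1, 0] l * f z + z 0 * pd l f z := by
  rw [pd_mul_mat (analyticAt_coord 0 z) hf, pd_coord]

theorem pd_const_mul {z : Pt} {f : Pt → ℝ} (r : ℝ) (hf : AnalyticAt ℝ f z) (l : Fin 2) :
    pd l (fun w => r * f w) z = r * pd l f z := by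
  rw [pd_mul_mat analyticAt_const hf]
  simp [pd]

/-! ### Symmetries in the exceptional cases -/

/-- A symmetry of the flow `(2,1)` in the exceptional cases, with `h` the quotient of its upper
right entry by `u`. -/
structure IsSym (k : ℝ) (W : MatField) (h : Pt → ℝ) (U : Set Pt) : Prop where
  analytic : AnalyticOnNhd ℝ W U
  analytic_quot : AnalyticOnNhd ℝ h U
  commuteZero : CommuteZero (mT k) W U
  entry_zero_one : ∀ z ∈ U, W z 0 1 = z 0 * h z

namespace IsSym
variable {k : ℝ} {W : MatField} {h φ : Pt → ℝ} {U : Set Pt} {z : Pt}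

theorem comm_and_curlFree (hW : IsSym k W h U) (hU : IsOpen U) (hu : ∀ z ∈ U, z 0 ≠ 0) :
    (∀ z ∈ U, ∀ i j, commMat (mT k) W z i j = 0) ∧ CurlFree W U :=
  hW.commuteZero.comm_and_curlFree (fun w _ => mT_analyticAt k w) hW.analytic (mT_curlFree k U) hU
    fun z hz => by simpa [mT] using hu z hz

theorem entries (hW : IsSym k W h U) (hk : k * (1 - k) = 0) (hU : IsOpen U)
    (hu : ∀ z ∈ U, z 0 ≠ 0) (hz : z ∈ U) :
    W z 0 0 = W z 1 1 + (2 * k - 1) * (z 0 * (z 0 * h z)) ∧ W z 1 0 = 0 := by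
  have c := (hW.comm_and_curlFree hU hu).1 z hz
  have c0 := c 0 0
  have c1 := c 0 1
  have e := hW.entry_zero_one z hz
  simp [commMat, mT, Fin.sum_univ_two, hk, e] at c0 c1
  exact ⟨mul_left_cancel₀ (hu z hz) (by linear_combination -c1),
    mul_left_cancel₀ (hu z hz) (by linear_combination c0)⟩

/-- W lies in the commutant of T, so it is W¹₁ + uh A, and closedness of its rows expresses every
first derivative through h and its first derivatives. -/
theorem derivatives (hW : IsSym k W h U) (hk : k * (1 - k) = 0) (hU : IsOpen U)
    (hu : ∀ z ∈ U, z 0 ≠ 0) (hz : z ∈ U) :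
    dMat W z 0 0 0 = (2 * k - 1) * (2 * z 0 * h z + z 0 ^ 2 * pd 0 h z) ∧
    dMat W z 0 0 1 = h z + z 0 * pd 0 h z ∧
    dMat W z 0 1 0 = h z + z 0 * pd 0 h z ∧
    dMat W z 0 1 1 = z 0 * pd 1 h z ∧
    (∀ l, dMat W z 1 0 l = 0) ∧
    dMat W z 1 1 0 = 0 ∧
    dMat W z 1 1 1 = h z + z 0 * pd 0 h z - (2 * k - 1) * z 0 ^ 2 * pd 1 h z := by
  have hh := hW.analytic_quot z hz
  have hc := (hW.comm_and_curlFree hU hu).2 z hz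
  have c := analyticAt_coord 0 z
  have d01 : ∀ l, dMat W z 0 1 l = ![1, 0] l * h z + z 0 * pd l h z := fun l => by
    rw [← pd_coord_mul hh]
    refine pd_congr ?_ l
    filter_upwards [hU.mem_nhds hz] with w hw
    exact hW.entry_zero_one w hw
  have d10 : ∀ l, dMat W z 1 0 l = 0 := fun l => by
    have : (fun w => W w 1 0) =ᶠ[𝓝 z] fun _ => 0 := by
      filter_upwards [hU.mem_nhds hz] with w hw
      exact (hW.entries hk hU hu hw).2
    rw [dMat, pd_congr this]
    simp [pd]
  have d00 : ∀ l, dMat W z 0 0 l = dMat W z 1 1 l + (2 * k - 1) * (![1, 0] l * (z 0 * h z)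
      + z 0 * (![1, 0] l * h z + z 0 * pd l h z)) := fun l => by
    have : (fun w => W w 0 0) =ᶠ[𝓝 z]
        fun w => W w 1 1 + (2 * k - 1) * (w 0 * (w 0 * h w)) := by
      filter_upwards [hU.mem_nhds hz] with w hw
      exact (hW.entries hk hU hu hw).1
    rw [dMat, pd_congr this, pd_add ((hW.analytic z hz).entry 1 1)
      (analyticAt_const.fun_mul (c.fun_mul (c.fun_mul hh))),
      pd_const_mul _ (c.fun_mul (c.fun_mul hh)), pd_coord_mul (c.fun_mul hh), pd_coord_mul hh]
    rfl
  have e110 : dMat W z 1 1 0 = 0 := by rw [hc 1 1 0, d10]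
  have e000 := d00 0
  have e001 := d00 1
  have e010 := d01 0
  have e011 := d01 1
  have es := hc 0 0 1
  simp at e000 e001 e010 e011
  refine ⟨?_, ?_, ?_, e011, d10, e110, ?_⟩
  · rw [e000, e110]; ring
  · rw [es, e010]
  · rw [e010]
  · linear_combination es + e010 - e001

/-- Equality of the mixed derivatives of the entry (1,1), whose u-derivative is zero; this yields a
second-order linear equation for h. -/
theorem second_derivative (hW : IsSym k W h U) (hk : k * (1 - k) = 0) (hU : IsOpen U)
    (hu : ∀ z ∈ U, z 0 ≠ 0) (hz : z ∈ U) :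
    z 0 * pd 0 (pd 0 h) z = -2 * pd 0 h z
      + (2 * k - 1) * (2 * z 0 * pd 1 h z + z 0 ^ 2 * pd 1 (pd 0 h) z) := by
  have hh := hW.analytic_quot z hz
  have c := analyticAt_coord 0 z
  have e1 : (fun w => pd 1 (fun y => W y 1 1) w) =ᶠ[𝓝 z]
      fun w => h w + w 0 * pd 0 h w - (2 * k - 1) * (w 0 * (w 0 * pd 1 h w)) := by
    filter_upwards [hU.mem_nhds hz] with w hw
    refine (hW.derivatives hk hU hu hw).2.2.2.2.2.2.trans ?_
    ring
  have e2 : (fun w => pd 0 (fun y => W y 1 1) w) =ᶠ[𝓝 z] fun _ => 0 := by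
    filter_upwards [hU.mem_nhds hz] with w hw
    exact (hW.derivatives hk hU hu hw).2.2.2.2.2.1
  have e3 := pd_congr e1 0
  have e4 := pd_congr e2 1
  have e5 := pd_comm ((hW.analytic z hz).entry 1 1) 0 1
  have e6 := pd_comm hh 0 1
  rw [pd_sub (hh.fun_add (c.fun_mul (hh.pd 0)))
    (analyticAt_const.fun_mul (c.fun_mul (c.fun_mul (hh.pd 1)))), pd_add hh (c.fun_mul (hh.pd 0)),
    pd_const_mul _ (c.fun_mul (c.fun_mul (hh.pd 1))), pd_coord_mul (c.fun_mul (hh.pd 1)),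
    pd_coord_mul (hh.pd 1), pd_coord_mul (hh.pd 0)] at e3
  have e7 : pd 1 (fun _ : Pt => (0 : ℝ)) z = 0 := by simp [pd]
  rw [e7] at e4
  simp at e3
  linear_combination e4 + e5 - e3 + (2 * k - 1) * z 0 ^ 2 * e6
end IsSym

/-- The `ε`-terms of the extended symmetries for `c = -1`. -/
noncomputable def extPlus (φ h : Pt → ℝ) : MatField := fun z =>
  ![![φ z * (1 / 2 * (z 0 * (z 0 * pd 0 h z))), φ z * (1 / 2 * (z 0 * pd 0 h z))],
    ![φ z * (z 0 * (z 0 * h z)), φ z * (z 0 * h z)]]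

/-- The `ε`-terms of the extended symmetries for `c = -1/2`. -/
noncomputable def extMinus (φ h : Pt → ℝ) : MatField := fun z =>
  ![![φ z * (z 0 * h z + 1 / 2 * (z 0 * (z 0 * pd 0 h z))), φ z * (-(1 / 2) * (z 0 * pd 0 h z))],
    ![0, 0]]

section
variable {k : ℝ} {W W' : MatField} {h h' φ : Pt → ℝ} {U : Set Pt} {z : Pt}

theorem extPlus_analytic (hφ : AnalyticOnNhd ℝ φ U) (hh : AnalyticOnNhd ℝ h U) :
    AnalyticOnNhd ℝ (extPlus φ h) U := by
  intro z hz
  have c := analyticAt_coord 0 z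
  have f := hφ z hz
  have g := hh z hz
  refine analyticAt_mat fun i j => ?_
  fin_cases i <;> fin_cases j
  · exact f.fun_mul (analyticAt_const.fun_mul (c.fun_mul (c.fun_mul (g.pd 0))))
  · exact f.fun_mul (analyticAt_const.fun_mul (c.fun_mul (g.pd 0)))
  · exact f.fun_mul (c.fun_mul (c.fun_mul g))
  · exact f.fun_mul (c.fun_mul g)

theorem extMinus_analytic (hφ : AnalyticOnNhd ℝ φ U) (hh : AnalyticOnNhd ℝ h U) :
    AnalyticOnNhd ℝ (extMinus φ h) U := by
  intro z hz
  have c := analyticAt_coord 0 z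
  have f := hφ z hz
  have g := hh z hz
  refine analyticAt_mat fun i j => ?_
  fin_cases i <;> fin_cases j
  · exact f.fun_mul ((c.fun_mul g).fun_add
      (analyticAt_const.fun_mul (c.fun_mul (c.fun_mul (g.pd 0)))))
  · exact f.fun_mul (analyticAt_const.fun_mul (c.fun_mul (g.pd 0)))
  · exact analyticAt_const
  · exact analyticAt_const

/-- The hypothesis `h2` eliminates h_uu, so the result involves only quantities that stay
independent in the verification of commutation. -/
theorem dMat_extPlus (hf : AnalyticAt ℝ φ z) (hg : AnalyticAt ℝ h z)
    (h2 : z 0 * pd 0 (pd 0 h) z = -2 * pd 0 h z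
      + (2 * z 0 * pd 1 h z + z 0 ^ 2 * pd 1 (pd 0 h) z)) (i j l : Fin 2) :
    dMat (extPlus φ h) z i j l = ![![
      ![pd 0 φ z * (1 / 2 * (z 0 ^ 2 * pd 0 h z))
          + φ z * (1 / 2 * (z 0 * (2 * z 0 * pd 1 h z + z 0 ^ 2 * pd 1 (pd 0 h) z))),
        pd 1 φ z * (1 / 2 * (z 0 ^ 2 * pd 0 h z)) + φ z * (1 / 2 * (z 0 ^ 2 * pd 1 (pd 0 h) z))],
      ![pd 0 φ z * (1 / 2 * (z 0 * pd 0 h z))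
          + φ z * (1 / 2 * (2 * z 0 * pd 1 h z + z 0 ^ 2 * pd 1 (pd 0 h) z - pd 0 h z)),
        pd 1 φ z * (1 / 2 * (z 0 * pd 0 h z)) + φ z * (1 / 2 * (z 0 * pd 1 (pd 0 h) z))]],
      ![![pd 0 φ z * (z 0 ^ 2 * h z) + φ z * (2 * z 0 * h z + z 0 ^ 2 * pd 0 h z),
          pd 1 φ z * (z 0 ^ 2 * h z) + φ z * (z 0 ^ 2 * pd 1 h z)],
        ![pd 0 φ z * (z 0 * h z) + φ z * (h z + z 0 * pd 0 h z),
          pd 1 φ z * (z 0 * h z) + φ z * (z 0 * pd 1 h z)]]] i j l := by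
  have c := analyticAt_coord 0 z
  have g := hg.pd 0
  fin_cases i <;> fin_cases j
  · change pd l (fun z => φ z * (1 / 2 * (z 0 * (z 0 * pd 0 h z)))) z = _
    rw [pd_mul_mat hf (analyticAt_const.fun_mul (c.fun_mul (c.fun_mul g))),
      pd_const_mul _ (c.fun_mul (c.fun_mul g)), pd_coord_mul (c.fun_mul g), pd_coord_mul g]
    fin_cases l
    · simp
      linear_combination φ z * (1 / 2) * z 0 * h2
    · simp
      ring
  · change pd l (fun z => φ z * (1 / 2 * (z 0 * pd 0 h z))) z = _
    rw [pd_mul_mat hf (analyticAt_const.fun_mul (c.fun_mul g)),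
      pd_const_mul _ (c.fun_mul g), pd_coord_mul g]
    fin_cases l
    · simp
      left
      linear_combination h2
    · simp
  · change pd l (fun z => φ z * (z 0 * (z 0 * h z))) z = _
    rw [pd_mul_mat hf (c.fun_mul (c.fun_mul hg)), pd_coord_mul (c.fun_mul hg), pd_coord_mul hg]
    fin_cases l
    · simp
      ring
    · simp
      ring
  · change pd l (fun z => φ z * (z 0 * h z)) z = _
    rw [pd_mul_mat hf (c.fun_mul hg), pd_coord_mul hg]
    fin_cases l
    · simp
    · simp

theorem dMat_extMinus (hf : AnalyticAt ℝ φ z) (hg : AnalyticAt ℝ h z)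
    (h2 : z 0 * pd 0 (pd 0 h) z = -2 * pd 0 h z
      - (2 * z 0 * pd 1 h z + z 0 ^ 2 * pd 1 (pd 0 h) z)) (i j l : Fin 2) :
    dMat (extMinus φ h) z i j l = ![![
      ![pd 0 φ z * (z 0 * h z + 1 / 2 * (z 0 ^ 2 * pd 0 h z))
          + φ z * (h z + z 0 * pd 0 h z
            - 1 / 2 * (z 0 * (2 * z 0 * pd 1 h z + z 0 ^ 2 * pd 1 (pd 0 h) z))),
        pd 1 φ z * (z 0 * h z + 1 / 2 * (z 0 ^ 2 * pd 0 h z))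
          + φ z * (z 0 * pd 1 h z + 1 / 2 * (z 0 ^ 2 * pd 1 (pd 0 h) z))],
      ![-(pd 0 φ z * (1 / 2 * (z 0 * pd 0 h z)))
          + φ z * (1 / 2 * (2 * z 0 * pd 1 h z + z 0 ^ 2 * pd 1 (pd 0 h) z + pd 0 h z)),
        -(pd 1 φ z * (1 / 2 * (z 0 * pd 0 h z))) - φ z * (1 / 2 * (z 0 * pd 1 (pd 0 h) z))]],
      ![![0, 0], ![0, 0]]] i j l := by
  have c := analyticAt_coord 0 z
  have g := hg.pd 0
  fin_cases i <;> fin_cases j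
  · change pd l (fun z => φ z * (z 0 * h z + 1 / 2 * (z 0 * (z 0 * pd 0 h z)))) z = _
    have e := (analyticAt_const (v := (1 / 2 : ℝ))).fun_mul (c.fun_mul (c.fun_mul g))
    rw [pd_mul_mat hf ((c.fun_mul hg).fun_add e), pd_add (c.fun_mul hg) e,
      pd_const_mul _ (c.fun_mul (c.fun_mul g)), pd_coord_mul (c.fun_mul g), pd_coord_mul g,
      pd_coord_mul hg]
    fin_cases l
    · simp
      linear_combination φ z * (1 / 2) * z 0 * h2
    · simp
      ring
  · change pd l (fun z => φ z * (-(1 / 2) * (z 0 * pd 0 h z))) z = _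
    rw [pd_mul_mat hf (analyticAt_const.fun_mul (c.fun_mul g)),
      pd_const_mul _ (c.fun_mul g), pd_coord_mul g]
    fin_cases l
    · simp
      linear_combination -φ z * (1 / 2) * h2
    · simp
      ring
  · change pd l (fun _ => (0 : ℝ)) z = _
    fin_cases l <;> simp [pd]
  · change pd l (fun _ => (0 : ℝ)) z = _
    fin_cases l <;> simp [pd]

theorem commMat_eq_zero_of_isSym (hW : IsSym k W h U) (hW' : IsSym k W' h' U)
    (hk : k * (1 - k) = 0) (hU : IsOpen U) (hu : ∀ z ∈ U, z 0 ≠ 0) (hz : z ∈ U) (i j : Fin 2) :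
    commMat W W' z i j = 0 := by
  have e := hW.entries hk hU hu hz
  have e' := hW'.entries hk hU hu hz
  have f := hW.entry_zero_one z hz
  have f' := hW'.entry_zero_one z hz
  fin_cases i <;> fin_cases j <;> simp [commMat, Fin.sum_univ_two, e, e', f, f'] <;> ring

/-- The flux condition on u_xx is algebraic in the entries. The one on u_x u_x is an identity in h,
h', φ and their remaining derivatives once closedness, the equation for h_uu and φ_u = u φ_v are
substituted. -/
theorem commute_extPlus (hW : IsSym 1 W h U) (hW' : IsSym 1 W' h' U) (hU : IsOpen U)
    (hu : ∀ z ∈ U, z 0 ≠ 0) (hφ : AnalyticOnNhd ℝ φ U)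
    (hφr : ∀ z ∈ U, pd 0 φ z = z 0 * pd 1 φ z) :
    CommuteUpToFirstOrder U (firstOrder W (extPlus φ h) (dMat (extPlus φ h)))
      (firstOrder W' (extPlus φ h') (dMat (extPlus φ h'))) := by
  have hk : (1 : ℝ) * (1 - 1) = 0 := by norm_num
  have a := hW.analytic_quot
  have a' := hW'.analytic_quot
  refine commute_of hW.analytic (extPlus_analytic hφ a) hW'.analytic (extPlus_analytic hφ a')
    (hW.comm_and_curlFree hU hu).2 (hW'.comm_and_curlFree hU hu).2 hU
    (fun z hz => commMat_eq_zero_of_isSym hW hW' hk hU hu hz) (fun z hz i j => ?_)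
    fun z hz i x => ?_
  · have e := hW.entries hk hU hu hz
    have e' := hW'.entries hk hU hu hz
    have f := hW.entry_zero_one z hz
    have f' := hW'.entry_zero_one z hz
    fin_cases i <;> fin_cases j <;>
      simp [fluxK, extPlus, Fin.sum_univ_two, e, e', f, f'] <;> ring
  · have e := hW.entries hk hU hu hz
    have e' := hW'.entries hk hU hu hz
    have f := hW.entry_zero_one z hz
    have f' := hW'.entry_zero_one z hz
    have d := hW.derivatives hk hU hu hz
    have d' := hW'.derivatives hk hU hu hz
    have s := hW.second_derivative hk hU hu hz
    have s' := hW'.second_derivative hk hU hu hz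
    have r := hφr z hz
    simp only [fluxG, dMat_extPlus (hφ z hz) (a z hz) (by linear_combination s),
      dMat_extPlus (hφ z hz) (a' z hz) (by linear_combination s'), r]
    fin_cases i <;>
      simp [extPlus, Fin.sum_univ_two, e, e', f, f', d, d'] <;> ring

/-- As for k = 1, with the sign of u reversed in φ_u; the second row of the corrections vanishes, so
only the first component needs the derivative relations. -/
theorem commute_extMinus (hW : IsSym 0 W h U) (hW' : IsSym 0 W' h' U) (hU : IsOpen U)
    (hu : ∀ z ∈ U, z 0 ≠ 0) (hφ : AnalyticOnNhd ℝ φ U)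
    (hφr : ∀ z ∈ U, pd 0 φ z = -z 0 * pd 1 φ z) :
    CommuteUpToFirstOrder U (firstOrder W (extMinus φ h) (dMat (extMinus φ h)))
      (firstOrder W' (extMinus φ h') (dMat (extMinus φ h'))) := by
  have hk : (0 : ℝ) * (1 - 0) = 0 := by norm_num
  have a := hW.analytic_quot
  have a' := hW'.analytic_quot
  refine commute_of hW.analytic (extMinus_analytic hφ a) hW'.analytic (extMinus_analytic hφ a')
    (hW.comm_and_curlFree hU hu).2 (hW'.comm_and_curlFree hU hu).2 hU
    (fun z hz => commMat_eq_zero_of_isSym hW hW' hk hU hu hz) (fun z hz i j => ?_)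
    fun z hz i x => ?_
  · have e := hW.entries hk hU hu hz
    have e' := hW'.entries hk hU hu hz
    have f := hW.entry_zero_one z hz
    have f' := hW'.entry_zero_one z hz
    fin_cases i <;> fin_cases j <;>
      simp [fluxK, extMinus, Fin.sum_univ_two, e, e', f, f'] <;> ring
  · have e := hW.entries hk hU hu hz
    have e' := hW'.entries hk hU hu hz
    have f := hW.entry_zero_one z hz
    have f' := hW'.entry_zero_one z hz
    have d := hW.derivatives hk hU hu hz
    have d' := hW'.derivatives hk hU hu hz
    have s := hW.second_derivative hk hU hu hz
    have s' := hW'.second_derivative hk hU hu hz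
    have r := hφr z hz
    simp only [fluxG, dMat_extMinus (hφ z hz) (a z hz) (by linear_combination s),
      dMat_extMinus (hφ z hz) (a' z hz) (by linear_combination s'), r]
    fin_cases i
    · simp [extMinus, Fin.sum_univ_two, e, e', f, f', d, d']
      ring
    · simp [extMinus, Fin.sum_univ_two, e, e', f, f']
end

/-! ### Normal forms parameterized by a function of the Riemann invariant. -/

section
variable {k s : ℝ} {F : ℝ → ℝ} {a : Pt → Pt} {U : Set Pt} {z : Pt}

theorem isSym_mT (k : ℝ) (U : Set Pt) : IsSym k (mT k) (fun _ => 1) U where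
  analytic := fun w _ => mT_analyticAt k w
  analytic_quot := fun _ _ => analyticAt_const
  commuteZero := fun _ _ _ _ => rfl
  entry_zero_one := fun z _ => by simp [mT]

theorem isSym_of_commuteZero {W : MatField} (hW : AnalyticOnNhd ℝ W U)
    (h : CommuteZero (mT k) W U) (hu : ∀ z ∈ U, z 0 ≠ 0) :
    IsSym k W (fun z => W z 0 1 / z 0) U where
  analytic := hW
  analytic_quot := fun z hz => ((hW z hz).entry 0 1).fun_div (analyticAt_coord 0 z) (hu z hz)
  commuteZero := h
  entry_zero_one := fun z hz => (mul_div_cancel₀ _ (hu z hz)).symm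

/-- The derivatives of a function of `s u² / 2 + v`. -/
theorem pd_comp_of_quadratic {r : Pt → ℝ} (hr : ∀ z, r z = s * (z 0 ^ 2 / 2) + z 1)
    (hF : AnalyticAt ℝ F (r z)) :
    AnalyticAt ℝ (fun w => F (r w)) z ∧
      pd 0 (fun w => F (r w)) z = s * z 0 * pd 1 (fun w => F (r w)) z := by
  have h0 := hasFDerivAt_coord 0 z
  have h1 := hasFDerivAt_coord 1 z
  have c0 := analyticAt_coord 0 z
  have c1 := analyticAt_coord 1 z
  obtain rfl : r = fun z => s * (z 0 ^ 2 / 2) + z 1 := funext hr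
  have hra : AnalyticAt ℝ (fun z : Pt => s * (z 0 ^ 2 / 2) + z 1) z :=
    (analyticAt_const.fun_mul ((c0.fun_pow 2).fun_div analyticAt_const two_ne_zero)).fun_add c1
  refine ⟨AnalyticAt.comp (g := F) hF hra, ?_⟩
  have hd : HasFDerivAt (fun z : Pt => s * (z 0 ^ 2 / 2) + z 1) (lin2 (s * z 0) 1) z := by
    have e : (fun z : Pt => s * (z 0 ^ 2 / 2) + z 1) = fun z => s / 2 * z 0 ^ 2 + z 1 := by
      funext z
      ring
    rw [e]
    refine (((h0.pow 2).const_mul (s / 2)).add h1).congr_fderiv ?_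
    ext v
    simp [lin2]
    ring
  have hc := hF.differentiableAt.hasDerivAt.comp_hasFDerivAt z hd
  have := pd_of_hasFDerivAt (a := deriv F (s * (z 0 ^ 2 / 2) + z 1) * (s * z 0))
    (b := deriv F (s * (z 0 ^ 2 / 2) + z 1)) (hc.congr_fderiv (by
      ext v
      simp [lin2]
      ring))
  have e0 := this 0
  have e1 := this 1
  simp at e0 e1
  change pd 0 (F ∘ fun z : Pt => s * (z 0 ^ 2 / 2) + z 1) z
    = s * z 0 * pd 1 (F ∘ fun z : Pt => s * (z 0 ^ 2 / 2) + z 1) z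
  rw [e0, e1]
  ring

/-- By `hext_one` the normal form is itself the extension of the flow (2,1), whose quotient is 1.
Hence `hcomm` yields both integrability and the mutual commutation of all extensions. The trace
F(r)u, with u ≠ 0, recovers F in the last two assertions. -/
theorem parameterizedBy_of {r : Pt → ℝ} {nf : (ℝ → ℝ) → MatField}
    {ext : (Pt → ℝ) → (Pt → ℝ) → MatField} (ha : ∀ z, AnalyticAt ℝ a z) (hja : jac a = mT k)
    (hnf : ∀ (U : Set Pt) (F : ℝ → ℝ), (∀ z ∈ U, AnalyticAt ℝ F (r z)) →
      AnalyticOnNhd ℝ (nf F) U)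
    (htr : ∀ F z, nf F z 0 0 + nf F z 1 1 = F (r z) * z 0)
    (hzero : ∀ F z, F (r z) = 0 → ∀ i j, nf F z i j = 0)
    (hext : ∀ (U : Set Pt) (φ h : Pt → ℝ), AnalyticOnNhd ℝ φ U → AnalyticOnNhd ℝ h U →
      AnalyticOnNhd ℝ (ext φ h) U)
    (hext_one : ∀ F : ℝ → ℝ, ext (fun z => F (r z)) (fun _ => 1) = nf F)
    (hr : ∀ z, r z = s * (z 0 ^ 2 / 2) + z 1)
    (hcomm : ∀ (U : Set Pt) (φ h h' : Pt → ℝ) (W W' : MatField), IsSym k W h U →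
      IsSym k W' h' U → IsOpen U → (∀ z ∈ U, z 0 ≠ 0) → AnalyticOnNhd ℝ φ U →
      (∀ z ∈ U, pd 0 φ z = s * z 0 * pd 1 φ z) →
      CommuteUpToFirstOrder U (firstOrder W (ext φ h) (dMat (ext φ h)))
        (firstOrder W' (ext φ h') (dMat (ext φ h'))))
    (hred : ∀ (U : Set Pt) (B : MatField), IsOpen U → (∀ z ∈ U, z 0 ≠ 0) → AnalyticOnNhd ℝ B U →
      IsIntegrable U (consLaw a B) →
      ∀ p ∈ U, ∃ V : Set Pt, IsOpen V ∧ p ∈ V ∧ V ⊆ U ∧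
        ∃ (F : ℝ → ℝ) (M : Pt → Pt), AnalyticOnNhd ℝ F (r '' V) ∧ AnalyticOnNhd ℝ M V ∧
          TransformsTo V (miura id (jac M)) (consLaw a B) (consLaw a (nf F))) :
    ParameterizedBy a r nf := by
  have himg : ∀ (U : Set Pt) (F : ℝ → ℝ), AnalyticOnNhd ℝ F (r '' U) →
      ∀ z ∈ U, AnalyticAt ℝ F (r z) := fun U F hF z hz => hF _ (Set.mem_image_of_mem r hz)
  refine ⟨hred, fun U F hU hu hF => ?_, fun U F G N hU hu hF hG hN h z hz => ?_,
    fun U F hU hu hF => ⟨fun h z hz => ?_, fun h => ?_⟩⟩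
  · have hF' := himg U F hF
    have hB := hnf U F hF'
    have hφ : AnalyticOnNhd ℝ (fun z => F (r z)) U := fun z hz =>
      (pd_comp_of_quadratic hr (hF' z hz)).1
    have hφr : ∀ z ∈ U, pd 0 (fun z => F (r z)) z = s * z 0 * pd 1 (fun z => F (r z)) z :=
      fun z hz => (pd_comp_of_quadratic hr (hF' z hz)).2
    have hsym : ∀ W, IsDispersionlessSymmetry U (consLaw a (nf F)) W →
        IsSym k W (fun z => W z 0 1 / z 0) U := fun W hW => by
      rw [isDispersionlessSymmetry_iff_commuteZero hU (fun z _ => ha z) hB, hja] at hW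
      exact isSym_of_commuteZero hW.1 hW.2 hu
    have hext' : ∀ W, IsDispersionlessSymmetry U (consLaw a (nf F)) W →
        AnalyticOnNhd ℝ (ext (fun z => F (r z)) fun z => W z 0 1 / z 0) U ∧
        AnalyticOnNhd ℝ (dMat (ext (fun z => F (r z)) fun z => W z 0 1 / z 0)) U ∧
        CommuteUpToFirstOrder U (consLaw a (nf F))
          (firstOrder W (ext (fun z => F (r z)) fun z => W z 0 1 / z 0)
            (dMat (ext (fun z => F (r z)) fun z => W z 0 1 / z 0))) := fun W hW => by
      have hS := hsym W hW
      have hE := hext U _ _ hφ hS.analytic_quot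
      refine ⟨hE, fun z hz => (hE z hz).dMat, ?_⟩
      rw [commute_iff hU (fun z _ => ha z) hB hS.analytic hE fun z hz => (hE z hz).dMat, hja,
        ← hext_one]
      exact hcomm U _ _ _ _ _ (isSym_mT k U) hS hU hu hφ hφr
    exact ⟨fun W hW => ⟨_, _, hext' W hW⟩, _, _, hext',
      fun W W' hW hW' => hcomm U _ _ _ _ _ (hsym W hW) (hsym W' hW') hU hu hφ hφr⟩
  · have := trace_eq_of_transformsTo_consLaw hU (fun z _ => ha z) (hnf U F (himg U F hF))
      (hnf U G (himg U G hG)) hN h hz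
    rw [htr, htr] at this
    exact mul_right_cancel₀ (hu z hz) this
  · have := trace_eq_zero_of_isMiuraTrivial hU (fun z _ => ha z) (hnf U F (himg U F hF)) h hz
    rw [htr] at this
    exact (mul_eq_zero.1 this).resolve_right (hu z hz)
  · exact isMiuraTrivial_of_eq_zero hU (fun z _ => ha z) (hnf U F (himg U F hF))
      fun z hz => hzero F z (h z hz)

theorem pd_zero_one (z : Pt) : pd 0 (fun _ : Pt => (1 : ℝ)) z = 0 := by
  simp [pd]

theorem parameterizedBy_plus (ha : ∀ z, AnalyticAt ℝ a z) (hja : jac a = mT 1) :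
    ParameterizedBy a rPlus normalFormPlus := by
  refine parameterizedBy_of (ext := extPlus) (s := 1) ha hja (fun U F => normalFormPlus_analytic)
    (fun F z => by simp [normalFormPlus]) (fun F z h i j => ?_)
    (fun U φ h => extPlus_analytic) (fun F => ?_) (fun z => by simp [rPlus])
    (fun U φ h h' W W' hW hW' hU hu hφ hφr => commute_extPlus hW hW' hU hu hφ fun z hz => by
      rw [hφr z hz, one_mul])
    (fun U B hU hu hB hI p hp => exists_normalFormPlus ha hja hU hu hB hI hp)
  · fin_cases i <;> fin_cases j <;> simp [normalFormPlus, h]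
  · funext z i j
    fin_cases i <;> fin_cases j <;> simp [normalFormPlus, extPlus, pd_zero_one, pow_two]

theorem parameterizedBy_minus (ha : ∀ z, AnalyticAt ℝ a z) (hja : jac a = mT 0) :
    ParameterizedBy a rMinus normalFormMinus := by
  refine parameterizedBy_of (ext := extMinus) (s := -1) ha hja
    (fun U F => normalFormMinus_analytic) (fun F z => by simp [normalFormMinus])
    (fun F z h i j => ?_) (fun U φ h => extMinus_analytic) (fun F => ?_)
    (fun z => by simp [rMinus])
    (fun U φ h h' W W' hW hW' hU hu hφ hφr => commute_extMinus hW hW' hU hu hφ fun z hz => by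
      rw [hφr z hz, neg_one_mul])
    (fun U B hU hu hB hI p hp => exists_normalFormMinus ha hja hU hu hB hI hp)
  · fin_cases i <;> fin_cases j <;> simp [normalFormMinus, h]
  · funext z i j
    fin_cases i <;> fin_cases j <;> simp [normalFormMinus, extMinus, pd_zero_one]
end

/-! ### The theorem for all values of the parameter. -/

theorem mainTheorem3 (c : ℝ) (X : Fin 2 → ℕ → Pt → Pt) (hX : IsPrincipalHierarchy c X) :
    (c ≠ -1 → c ≠ -(1 / 2) →
      ∀ (U : Set Pt) (B : MatField), IsOpen U → AnalyticOnNhd ℝ B U →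
        IsIntegrable U (consLaw (X 0 1) B) →
        ∀ p ∈ U, ∃ V : Set Pt, IsOpen V ∧ p ∈ V ∧ V ⊆ U ∧
          IsMiuraTrivial V (consLaw (X 0 1) B) ∧
          ∃ M : Pt → Pt, AnalyticOnNhd ℝ M V ∧
            TransformsTo V (miura id (jac M)) (consLaw (X 0 1) B) (consLaw (X 0 1) 0) ∧
            ∀ (W B' : MatField) (C' : QuadField),
              AnalyticOnNhd ℝ W V → AnalyticOnNhd ℝ B' V → AnalyticOnNhd ℝ C' V →
              CommuteUpToFirstOrder V (consLaw (X 0 1) B) (firstOrder W B' C') →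
              TransformsTo V (miura id (jac M)) (firstOrder W B' C') (hydro W)) ∧
    (c = -1 → ParameterizedBy (X 1 2) rPlus normalFormPlus) ∧
    (c = -(1 / 2) → ParameterizedBy (X 1 2) rMinus normalFormMinus) := by
  -- With k = -(2c+1), the excluded values k = 0 and k = 1 are c = -1/2 and c = -1.
  refine ⟨fun h1 h2 U B hU hB hI p hp => generic_trivial (k := -(2 * c + 1)) (fun h => h2 ?_)
    (fun h => h1 ?_) hX.analyticAt_zero_one hX.jac_zero_one hU hB hI hp, fun h => ?_, fun h => ?_⟩
  · linarith
  · linarith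
  · refine parameterizedBy_plus hX.analyticAt_one_two (hX.jac_one_two.trans ?_)
    rw [h]
    norm_num
  · refine parameterizedBy_minus hX.analyticAt_one_two (hX.jac_one_two.trans ?_)
    rw [h]
    norm_num
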